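/- Let $(M,d)$ be a proper geodesic metric space with a locally finite Borel measure $\mu$, and let $1<p<3$, $p\neq 2$. Let $\mathcal P_p(M)$ be the set of Borel probability measures on $M$ with finite $p$-th moment, with the distance $w_p(\nu_0,\nu_1)^p=\inf_\pi \frac1p\int d(x,y)^p\,d\pi(x,y)$ (infimum over all couplings $\pi$ of $\nu_0,\nu_1$). Put $U_p(x)=\frac{1}{(3-p)(2-p)}(x^{3-p}-x)$ and $\mathcal U_p=\mathcal U_\mu$ for $U=U_p$, where $$\mathcal U_\mu(\nu)=\int U(\rho)\,d\mu+U'(\infty)\,\nu_s(M),\qquad U'(\infty)=\lim_{r\to\infty}\frac{U(r)}{r},$$ and $\nu=\rho\mu+\nu_s$ is the Lebesgue decomposition of $\nu$ with respect to $\mu$. The descending slope of $E:\mathcal P_p(M)\to[-\infty,\infty]$ is $|D^-E|(\nu)=\limsup_{\sigma\to\nu,\,\sigma\ne\nu}\frac{\max\{E(\nu)-E(\sigma),0\}}{w_p(\nu,\sigma)}$ where $E(\nu)\in\mathbb R$, and $\infty$ elsewhere. The strong $CD_p(K,\infty)$ condition says: any two $\nu_i=\rho_i\mu\in\mathcal P_p(M)$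 ($i=0,1$) are joined by a constant speed geodesic $(\nu_t)_{t\in[0,1]}$ of $(\mathcal P_p(M),w_p)$ and have an optimal coupling $\pi$ such that for all $t\in[0,1]$ and all continuous convex $U:[0,\infty)\to\mathbb R$ with $U(0)=0$ and $s\mapsto e^sU(e^{-s})$ convex on $\mathbb R$, $$\mathcal U_\mu(\nu_t)\le (1-t)\int \frac{\beta_{1-t}(x,y)}{\rho_0(x)}U\Big(\frac{\rho_0(x)}{\beta_{1-t}(x,y)}\Big)d\pi+t\int \frac{\beta_{t}(x,y)}{\rho_1(y)}U\Big(\frac{\rho_1(y)}{\beta_{t}(x,y)}\Big)d\pi,\qquad \beta_s(x,y)=e^{\frac K6(1-s^2)d(x,y)^2},$$ whenever both integrals on the right are well defined in $(-\infty,\infty]$. The $CD_p(0,N)$ condition says: any two $\nu_i=\rho_i\mu\in\mathcal P_p(M)$ are joined by a constant speed geodesic $(\nu_t)$ of $(\mathcal P_p(M),w_p)$ such that, $\rho_t$ being the density of the absolutely continuous part of $\nu_t$, for all $t\in[0,1]$ and $N'\ge N$, $$\int\rho_t^{1-1/N'}d\mu\ \ge\ (1-t)\int\rho_0^{1-1/N'}d\mu+t\int\rho_1^{1-1/N'}d\mu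 .$$ Assume one of the following: - $p\in(1,2)$ and $(M,d,\mu)$ satisfies the strong $CD_p(K,\infty)$ condition for some $K\ge0$; - $p\in\big(2,\frac{3+\sqrt5}{2}\big)$, $(M,d,\mu)$ satisfies $CD_p(0,N)$ with $p=\frac{2N+1}{N}$, and $M$ is $n$-Ahlfors regular for some $0<n<N$, i.e. there are $c,C>0$ with $c\,r^n\le\mu(B_r(x))\le C\,r^n$ for all $x\in M$ and $0<r\le\operatorname{diam}M$. Then $|D^-\mathcal U_p|$ is lower semicontinuous on $(\mathcal P_p(M),w_p)$, and it is an upper gradient of $\mathcal U_p$: for every absolutely continuous curve $\gamma:[0,1]\to\mathcal P_p(M)$ along which $\mathcal U_p$ is real, with metric derivative $|\dot\gamma_t|$, the function $t\mapsto|D^-\mathcal U_p|(\gamma_t)\,|\dot\gamma_t|$ (with $\infty\cdot0=0$) is Lebesgue measurable and $$|\mathcal U_p(\gamma_1)-\mathcal U_p(\gamma_0)|\le\int_0^1|D^-\mathcal U_p|(\gamma_t)\,|\dot\gamma_t|\,dt .$$ -/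

import Mathlib

open MeasureTheory Filter Set Topology
open scoped ENNReal

noncomputable section

namespace RenyiFlow

/-! ### Curves, slopes and upper gradients

These notions are written for a set `X` with an (extended) distance function
`d : X → X → ℝ≥0∞`; they are applied to the Wasserstein distance below. -/

section Metric

variable {X : Type*}

/-- The domain `D(f)` of an extended real valued function: the points at which `f` is real. -/
def finiteDomain (f : X → EReal) : Set X := {x | f x ≠ ⊤ ∧ f x ≠ ⊥}

open Classical in
/-- The descending slope: `|D⁻f|(x) = limsup_{y → x} [f(y) - f(x)]₋ / d(y, x)` (limit over `y ≠ x`)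
for `x ∈ D(f)`, and `∞` for all other `x`. -/
def descendingSlope (d : X → X → ℝ≥0∞) (f : X → EReal) (x : X) : ℝ≥0∞ :=
  if x ∈ finiteDomain f then
    limsup (fun y => (f x - f y).toENNReal / d x y) (comap (d x) (𝓝[>] 0))
  else ⊤

/-- Lower semicontinuity with respect to the topology of the distance `d`. -/
def IsLSC (d : X → X → ℝ≥0∞) (g : X → ℝ≥0∞) : Prop :=
  ∀ x, ∀ c < g x, ∀ᶠ y in comap (d x) (𝓝 0), c < g y

/-- `γ`, restricted to `[0,1]`, is an absolutely continuous curve. -/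
def IsAbsCont (d : X → X → ℝ≥0∞) (γ : ℝ → X) : Prop :=
  ∃ g : ℝ → ℝ≥0∞, Measurable g ∧ ∫⁻ r in Icc (0 : ℝ) 1, g r ≠ ⊤ ∧
    ∀ s ∈ Icc (0 : ℝ) 1, ∀ t ∈ Icc (0 : ℝ) 1, s ≤ t →
      d (γ s) (γ t) ≤ ∫⁻ r in Icc s t, g r

/-- The metric derivative `limsup_{s → t} d(γ_s, γ_t) / |s - t|` of a curve on `[0,1]`. -/
def metricDeriv (d : X → X → ℝ≥0∞) (γ : ℝ → X) (t : ℝ) : ℝ≥0∞ :=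
  limsup (fun s => d (γ s) (γ t) / ENNReal.ofReal |s - t|) (𝓝[Icc (0 : ℝ) 1 \ {t}] t)

/-- `g` is an upper gradient of `f`: along every absolutely continuous curve `γ : [0,1] → D(f)`
the function `t ↦ g(γ_t) |γ'_t|` (with `0 · ∞ = 0`) is Lebesgue measurable and
`|f(γ_1) - f(γ_0)| ≤ ∫₀¹ g(γ_t) |γ'_t| dt`. -/
def IsUpperGradient (d : X → X → ℝ≥0∞) (g : X → ℝ≥0∞) (f : X → EReal) : Prop :=
  ∀ γ : ℝ → X, IsAbsCont d γ → (∀ t ∈ Icc (0 : ℝ) 1, γ t ∈ finiteDomain f) →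
    AEMeasurable (fun t => g (γ t) * metricDeriv d γ t) (volume.restrict (Icc (0 : ℝ) 1)) ∧
    ENNReal.ofReal |(f (γ 1)).toReal - (f (γ 0)).toReal| ≤
      ∫⁻ t in Icc (0 : ℝ) 1, g (γ t) * metricDeriv d γ t

/-- `γ`, restricted to `[0,1]`, is a constant speed geodesic from `x` to `y`. -/
def IsGeodesicFromTo (d : X → X → ℝ≥0∞) (γ : ℝ → X) (x y : X) : Prop :=
  γ 0 = x ∧ γ 1 = y ∧
    ∀ s ∈ Icc (0 : ℝ) 1, ∀ t ∈ Icc (0 : ℝ) 1,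
      d (γ s) (γ t) = ENNReal.ofReal |t - s| * d x y

/-- Any two points are joined by a constant speed geodesic. -/
def IsGeodesicSpace (M : Type*) [MetricSpace M] : Prop :=
  ∀ x y : M, ∃ γ : ℝ → M, IsGeodesicFromTo edist γ x y

end Metric

/-! ### The Wasserstein space -/

section Wasserstein

variable {M : Type*} [MetricSpace M] [MeasurableSpace M]

/-- The set `𝒫_p(M)` of Borel probability measures with finite `p`-th moment. -/
def WassersteinSpace (p : ℝ) (M : Type*) [MetricSpace M] [MeasurableSpace M] : Type _ :=
  {ν : ProbabilityMeasure M // ∃ x₀ : M, ∫⁻ x, edist x x₀ ^ p ∂(ν : Measure M) ≠ ⊤}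

/-- The underlying measure of a point of `𝒫_p(M)`. -/
def WassersteinSpace.toMeasure {p : ℝ} (ν : WassersteinSpace p M) : Measure M :=
  (ν.1 : Measure M)

/-- `π` is a coupling of `ν₀` and `ν₁`. -/
def IsCoupling (π : Measure (M × M)) (ν₀ ν₁ : Measure M) : Prop :=
  π.map Prod.fst = ν₀ ∧ π.map Prod.snd = ν₁

/-- The cost `(1/p) ∫ d(x,y)^p dπ(x,y)` of a transport plan. -/
def transportCost (p : ℝ) (π : Measure (M × M)) : ℝ≥0∞ :=
  ENNReal.ofReal (1 / p) * ∫⁻ z, edist z.1 z.2 ^ p ∂π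

/-- `π` is an optimal coupling of `ν₀` and `ν₁` for the cost `d^p / p`. -/
def IsOptimalCoupling (p : ℝ) (π : Measure (M × M)) (ν₀ ν₁ : Measure M) : Prop :=
  IsCoupling π ν₀ ν₁ ∧ ∀ π', IsCoupling π' ν₀ ν₁ → transportCost p π ≤ transportCost p π'

/-- The Wasserstein distance, normalized by
`w_p(ν₀,ν₁)^p = inf_π (1/p) ∫ d(x,y)^p dπ(x,y)`. -/
def wDist (p : ℝ) (ν₀ ν₁ : WassersteinSpace p M) : ℝ≥0∞ :=
  (⨅ (π : Measure (M × M)) (_ : IsCoupling π ν₀.toMeasure ν₁.toMeasure),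
    transportCost p π) ^ (1 / p)

end Wasserstein

/-! ### Integral functionals -/

section Functional

/-- The integral `∫ F dμ = ∫ F⁺ dμ - ∫ F⁻ dμ` with values in `[-∞, ∞]`, meaningful when at least
one of the two terms is finite. -/
def extIntegral {Ω : Type*} [MeasurableSpace Ω] (μ : Measure Ω) (F : Ω → ℝ) : EReal :=
  ((∫⁻ x, ENNReal.ofReal (F x) ∂μ : ℝ≥0∞) : EReal) -
    ((∫⁻ x, ENNReal.ofReal (-F x) ∂μ : ℝ≥0∞) : EReal)

/-- `U'(∞) = lim_{r → ∞} U(r) / r`. -/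
def recession (U : ℝ → ℝ) : EReal := limsup (fun r : ℝ => ((U r / r : ℝ) : EReal)) atTop

variable {M : Type*} [MeasurableSpace M]

/-- The functional `𝒰_μ(ν) = ∫ U(ρ) dμ + U'(∞) ν_s(M)`, where `ν = ρ μ + ν_s` is the Lebesgue
decomposition of `ν` with respect to `μ`. -/
def energy (U : ℝ → ℝ) (μ ν : Measure M) : EReal :=
  extIntegral μ (fun x => U (ν.rnDeriv μ x).toReal) +
    recession U * ((ν.singularPart μ univ : ℝ≥0∞) : EReal)

/-- `U_p(x) = (x^(3-p) - x) / ((3-p)(2-p))`. -/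
def renyiU (p : ℝ) (x : ℝ) : ℝ := 1 / ((3 - p) * (2 - p)) * (x ^ (3 - p) - x)

/-- The functional `𝒰_p` on `𝒫_p(M)`. -/
def renyiEntropy {M : Type*} [MetricSpace M] [MeasurableSpace M] (p : ℝ) (μ : Measure M)
    (ν : WassersteinSpace p M) : EReal :=
  energy (renyiU p) μ ν.toMeasure

end Functional

/-! ### Curvature-dimension conditions -/

section Curvature

variable {M : Type*} [MetricSpace M] [MeasurableSpace M]

/-- The class `𝒟𝒞_∞`: continuous convex functions `U` on `[0,∞)` with `U(0) = 0` such that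
`s ↦ e^s U(e^{-s})` is convex on `ℝ`. -/
def DCInfty (U : ℝ → ℝ) : Prop :=
  ContinuousOn U (Ici 0) ∧ ConvexOn ℝ (Ici 0) U ∧ U 0 = 0 ∧
    ConvexOn ℝ univ (fun s : ℝ => Real.exp s * U (Real.exp (-s)))

/-- The distortion coefficient `β_s^{(K,∞)}(x,y) = exp (K (1 - s²) d(x,y)² / 6)`. -/
def betaInfty (K s : ℝ) (x y : M) : ℝ := Real.exp (K / 6 * (1 - s ^ 2) * dist x y ^ 2)

/-- The integrand `(β / ρ) U(ρ / β)` of the distorted functionals. -/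
def distorted (U : ℝ → ℝ) (β ρ : ℝ) : ℝ := β / ρ * U (ρ / β)

/-- The strong `CD_p(K,∞)` condition: any two measures `ν₀ = ρ₀ μ`, `ν₁ = ρ₁ μ` in `𝒫_p(M)` are
joined by a geodesic `(ν_t)` of `𝒫_p(M)` and have an optimal coupling `π` such that, for all
`t ∈ [0,1]` and all `U ∈ 𝒟𝒞_∞`,
`𝒰_μ(ν_t) ≤ (1-t) ∫ (β_{1-t}(x,y) / ρ₀(x)) U(ρ₀(x) / β_{1-t}(x,y)) dπ
  + t ∫ (β_t(x,y) / ρ₁(y)) U(ρ₁(y) / β_t(x,y)) dπ`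
whenever both integrals on the right are well defined in `(-∞, ∞]`. -/
def StrongCDInfty (p K : ℝ) (μ : Measure M) : Prop :=
  ∀ ν₀ ν₁ : WassersteinSpace p M, ν₀.toMeasure ≪ μ → ν₁.toMeasure ≪ μ →
    ∃ γ : ℝ → WassersteinSpace p M, IsGeodesicFromTo (wDist p) γ ν₀ ν₁ ∧
    ∃ π : Measure (M × M), IsOptimalCoupling p π ν₀.toMeasure ν₁.toMeasure ∧
    ∀ t ∈ Icc (0 : ℝ) 1, ∀ U : ℝ → ℝ, DCInfty U →
      let F₀ : M × M → ℝ := fun z =>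
        distorted U (betaInfty K (1 - t) z.1 z.2) (ν₀.toMeasure.rnDeriv μ z.1).toReal
      let F₁ : M × M → ℝ := fun z =>
        distorted U (betaInfty K t z.1 z.2) (ν₁.toMeasure.rnDeriv μ z.2).toReal
      ∫⁻ z, ENNReal.ofReal (-F₀ z) ∂π ≠ ⊤ → ∫⁻ z, ENNReal.ofReal (-F₁ z) ∂π ≠ ⊤ →
      energy U μ (γ t).toMeasure ≤
        ((1 - t : ℝ) : EReal) * extIntegral π F₀ + (t : EReal) * extIntegral π F₁

open Classical in
/-- The distortion coefficient `τ_{K,N}^{(s)}(θ)`. -/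
def tau (K N s θ : ℝ) : ℝ≥0∞ :=
  if 0 < K * θ ^ 2 then
    if (N - 1) * Real.pi ^ 2 ≤ K * θ ^ 2 then ⊤
    else ENNReal.ofReal (s ^ (1 / N) *
      (Real.sin (s * θ * √(K / (N - 1))) / Real.sin (θ * √(K / (N - 1)))) ^ (1 - 1 / N))
  else if K * θ ^ 2 = 0 ∨ N = 1 then ENNReal.ofReal s
  else ENNReal.ofReal (s ^ (1 / N) *
      (Real.sinh (s * θ * √(-K / (N - 1))) / Real.sinh (θ * √(-K / (N - 1)))) ^ (1 - 1 / N))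

/-- The `CD_p(K,N)` condition, `1 ≤ N < ∞`: any two measures `ν₀ = ρ₀ μ`, `ν₁ = ρ₁ μ` in `𝒫_p(M)`
are joined by a geodesic `(ν_t)` of `𝒫_p(M)` and have an optimal coupling `π` such that, for all
`t ∈ [0,1]` and all `N' ≥ N`, with `ρ_t` the density of the absolutely continuous part of `ν_t`,
`∫ ρ_t^(1-1/N') dμ ≥ ∫ τ_{K,N'}^{(1-t)}(d(x,y)) ρ₀(x)^(-1/N')
  + τ_{K,N'}^{(t)}(d(x,y)) ρ₁(y)^(-1/N') dπ(x,y)`. -/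
def CDCondition (p K N : ℝ) (μ : Measure M) : Prop :=
  ∀ ν₀ ν₁ : WassersteinSpace p M, ν₀.toMeasure ≪ μ → ν₁.toMeasure ≪ μ →
    ∃ γ : ℝ → WassersteinSpace p M, IsGeodesicFromTo (wDist p) γ ν₀ ν₁ ∧
    ∃ π : Measure (M × M), IsOptimalCoupling p π ν₀.toMeasure ν₁.toMeasure ∧
    ∀ t ∈ Icc (0 : ℝ) 1, ∀ N' : ℝ, N ≤ N' →
      ∫⁻ z, (tau K N' (1 - t) (dist z.1 z.2) * ν₀.toMeasure.rnDeriv μ z.1 ^ (-(1 / N')) +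
          tau K N' t (dist z.1 z.2) * ν₁.toMeasure.rnDeriv μ z.2 ^ (-(1 / N'))) ∂π ≤
        ∫⁻ x, (γ t).toMeasure.rnDeriv μ x ^ (1 - 1 / N') ∂μ

/-- `n`-Ahlfors regularity: `c rⁿ ≤ μ(B_r(x)) ≤ C rⁿ` for all `x` and all `0 < r ≤ diam M`. -/
def AhlforsRegular (n : ℝ) (μ : Measure M) : Prop :=
  ∃ c C : ℝ, 0 < c ∧ 0 < C ∧ ∀ x : M, ∀ r : ℝ, 0 < r →
    ENNReal.ofReal r ≤ Metric.ediam (univ : Set M) →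
      ENNReal.ofReal (c * r ^ n) ≤ μ (Metric.ball x r) ∧
      μ (Metric.ball x r) ≤ ENNReal.ofReal (C * r ^ n)

end Curvature

end RenyiFlow

end

namespace RenyiFlow

/-! The proof separates a metric principle from two properties of the entropy.

Metric principle. Let `f` be lower semicontinuous, never `⊥`, and `ApproxConvex`. Moving from `x` a
small fraction `t` of the way towards `y` lowers `f` by almost `t (f x - f y)` over a distance of
almost `t d(x,y)`. The local slope therefore dominates every global quotient `(f x - f y)⁺ /
d(x,y)`, and so equals their supremum (`descendingSlope_eq_iSup`). Lower semicontinuity of the slope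
follows, because a fixed competitor `y` keeps working for all points near `x`. So does the
inequality `f x - f y ≤ |D⁻f|(x) d(x,y)`. Along a curve parametrized by arc length this is a
one-sided bound with the slope at the left end point. Averaging Riemann sums over their offset
integrates it, without any prior absolute continuity of `f ∘ γ` (`ofReal_sub_le_lintegral_of_lsc`).
Reversing the curve controls increases.

Lower semicontinuity of the entropy. Young's inequality presents `𝒰_p` as a supremum of functionals
affine in the measure, with optimal test function `ρ^(2-p)`. For `p < 2` the test functions are
bounded with bounded support, and they are large on a carrier of the singular part. For `p > 2` they
grow like `(1+d)^p`. This requires `(1+d)^(-p(3-p)/(p-2))` to be `μ`-integrable, which Ahlfors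
regularity gives as soon as `n < p(3-p)/(p-2)`; the bound `p < (3+√5)/2` ensures this when `n < N =
1/(p-2)`. In both cases the test functions are replaced by continuous ones
(`exists_continuous_tendsto_integral`).

Approximate convexity of the entropy. For `p < 2` finite energy forces absolute continuity, `U_p` is
admissible in the strong curvature condition, and `K ≥ 0` makes all distortion coefficients at least
one. For `p > 2` singular measures also have finite energy. Their singular part is spread over small
balls, which does not raise the energy, and the curvature condition is applied with `N' = N`. -/

lemma finiteDomain_coe {X : Type*} {f : X → EReal} {x : X} (hx : x ∈ finiteDomain f) :
    ((f x).toReal : EReal) = f x :=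
  EReal.coe_toReal hx.1 hx.2

/-! ### The descending slope of an approximately convex function -/

section Slope

variable {X : Type*} [PseudoMetricSpace X] {f : X → EReal}

/-- Approximate geodesic convexity of `f`: between two points of the domain there are points which
almost satisfy the convexity inequality and the distance bound of a geodesic. -/
def ApproxConvex (f : X → EReal) : Prop :=
  ∀ x ∈ finiteDomain f, ∀ y ∈ finiteDomain f, ∀ t ∈ Ioo (0 : ℝ) 1, ∀ ε > (0 : ℝ),
    ∃ z, edist x z ≤ ENNReal.ofReal (t * dist x y + ε) ∧
      f z ≤ (((1 - t) * (f x).toReal + t * (f y).toReal + ε : ℝ) : EReal)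

/-- Points at distance zero have the same neighbourhoods, so a lower semicontinuous function cannot
tell them apart. This lets the metric part work with a pseudometric. -/
lemma le_of_edist_eq_zero_of_lsc (hf : LowerSemicontinuous f) {x y : X}
    (h : edist x y = 0) : f x ≤ f y := by
  by_contra! hlt
  have := hf x (f y) hlt
  have hxy : Inseparable x y := EMetric.inseparable_iff.2 h
  rw [hxy.nhds_eq] at this
  exact lt_irrefl _ this.self_of_nhds

lemma toENNReal_coe_sub_coe (a b : ℝ) :
    ((a : EReal) - (b : EReal)).toENNReal = ENNReal.ofReal (a - b) := by
  rw [← EReal.coe_sub, EReal.toENNReal_of_ne_top (EReal.coe_ne_top _), EReal.toReal_coe]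

/-- Approximate convexity moves the quotient at `y` to points arbitrarily close to `x`: at parameter
`t` both drop and distance scale by `t`, up to an error chosen small compared with `t`. -/
lemma ratio_le_descendingSlope (hf : LowerSemicontinuous f) (hbot : ∀ x, f x ≠ ⊥)
    (hc : ApproxConvex f) {x : X} (hx : x ∈ finiteDomain f) (y : X) :
    (f x - f y).toENNReal / edist x y ≤ descendingSlope edist f x := by
  rcases eq_or_ne (f y) ⊤ with hy | hy
  · rw [hy, EReal.sub_top]; simp
  have hy' : y ∈ finiteDomain f := ⟨hy, hbot y⟩
  set a := (f x).toReal with ha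
  set b := (f y).toReal with hb
  have hfa : f x = (a : EReal) := (finiteDomain_coe hx).symm
  have hfb : f y = (b : EReal) := (finiteDomain_coe hy').symm
  rw [hfa, hfb, toENNReal_coe_sub_coe]
  rcases le_or_gt a b with hab | hab
  · rw [ENNReal.ofReal_of_nonpos (by linarith)]; simp
  have hD : 0 < dist x y := by
    rcases (dist_nonneg (x := x) (y := y)).eq_or_lt with h | h
    · exfalso
      have h0 : edist x y = 0 := by rw [edist_dist, ← h]; simp
      have := le_of_edist_eq_zero_of_lsc hf h0
      rw [hfa, hfb, EReal.coe_le_coe_iff] at this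
      linarith
    · exact h
  set D := dist x y with hDdef
  rw [edist_dist, ← hDdef, ← ENNReal.ofReal_div_of_pos hD]
  refine le_of_forall_lt fun c' hc' => ?_
  obtain ⟨c, hc1, hc2⟩ := ENNReal.lt_iff_exists_nnreal_btwn.1 hc'
  refine hc1.trans_le ?_
  have hcD : (c : ℝ) * D < a - b := by
    rw [← ENNReal.ofReal_coe_nnreal] at hc2
    exact (lt_div_iff₀ hD).1 ((ENNReal.ofReal_lt_ofReal_iff_of_nonneg c.coe_nonneg).1 hc2)
  rw [descendingSlope, if_pos hx]
  refine le_limsup_of_frequently_le ?_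
    (isBoundedUnder_of ⟨⊤, fun _ => le_top⟩)
  rw [((nhdsGT_basis_of_exists_gt (a := (0 : ℝ≥0∞)) ⟨1, one_pos⟩).comap (edist x)).frequently_iff]
  intro r hr
  obtain ⟨r', hr'0, hr'⟩ : ∃ r' : ℝ, 0 < r' ∧ ENNReal.ofReal r' < r := by
    obtain ⟨r', h1, h2⟩ := ENNReal.lt_iff_exists_nnreal_btwn.1 hr
    exact ⟨r', by exact_mod_cast h1, by simpa using h2⟩
  have hc0 : (0 : ℝ) ≤ c := c.2
  obtain ⟨t, ht0, ht1, htr⟩ : ∃ t : ℝ, 0 < t ∧ t < 1 ∧ t * D < r' / 2 := by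
    refine ⟨min (1 / 2) (r' / (4 * D)), by positivity, ?_, ?_⟩
    · exact (min_le_left _ _).trans_lt (by norm_num)
    · calc min (1 / 2) (r' / (4 * D)) * D ≤ r' / (4 * D) * D := by
            gcongr; exact min_le_right _ _
        _ = r' / 4 := by field_simp
        _ < _ := by linarith
  have hgap : 0 < t * ((a - b) - c * D) := mul_pos ht0 (by linarith)
  -- The first entry keeps `z` within `r'` of `x`. The second pays for an error `ε` in the value and
  -- `c * ε` in the distance, using half of the available gap.
  set ε := min (r' / 4) (t * ((a - b) - c * D) / (2 * (1 + c))) with hε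
  have hε0 : 0 < ε := by positivity
  have hε1 : ε ≤ r' / 4 := min_le_left _ _
  have hε2 : ε * (1 + c) ≤ t * ((a - b) - c * D) / 2 := by
    calc ε * (1 + c) ≤ t * ((a - b) - c * D) / (2 * (1 + c)) * (1 + c) := by
          gcongr; exact min_le_right _ _
      _ = _ := by field_simp
  obtain ⟨z, hz1, hz2⟩ := hc x hx y hy' t ⟨ht0, ht1⟩ ε hε0
  rw [← ha, ← hb, ← hDdef] at *
  have hfz : z ∈ finiteDomain f :=
    ⟨ne_top_of_le_ne_top (EReal.coe_ne_top _) hz2, hbot z⟩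
  have hfc : f z = ((f z).toReal : EReal) := (finiteDomain_coe hfz).symm
  rw [hfc, EReal.coe_le_coe_iff] at hz2
  have hlt : (f z).toReal < a := by
    nlinarith [mul_nonneg hc0 hD.le, mul_nonneg hε0.le hc0,
      mul_nonneg ht0.le (mul_nonneg hc0 hD.le)]
  -- The limsup in the slope ignores points at distance zero, so the strict drop is used to exclude
  -- this.
  have hz0 : edist x z ≠ 0 := by
    intro h0
    have := le_of_edist_eq_zero_of_lsc hf h0
    rw [hfa, hfc, EReal.coe_le_coe_iff] at this
    linarith
  refine ⟨z, ⟨pos_iff_ne_zero.2 hz0,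
    lt_of_le_of_lt (hz1.trans (ENNReal.ofReal_le_ofReal ?_)) hr'⟩, ?_⟩
  · linarith
  · rw [hfc, hfa, toENNReal_coe_sub_coe,
      ENNReal.le_div_iff_mul_le (Or.inl hz0) (Or.inl (edist_ne_top _ _))]
    calc (c : ℝ≥0∞) * edist x z ≤ c * ENNReal.ofReal (t * D + ε) := by gcongr
      _ = ENNReal.ofReal (c * (t * D + ε)) := by
        rw [ENNReal.ofReal_mul hc0, ENNReal.ofReal_coe_nnreal]
      _ ≤ _ := ENNReal.ofReal_le_ofReal (by nlinarith)

lemma descendingSlope_eq_iSup (hf : LowerSemicontinuous f) (hbot : ∀ x, f x ≠ ⊥)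
    (hc : ApproxConvex f) {x : X} (hx : x ∈ finiteDomain f) :
    descendingSlope edist f x = ⨆ y, (f x - f y).toENNReal / edist x y := by
  refine le_antisymm ?_ (iSup_le fun y => ratio_le_descendingSlope hf hbot hc hx y)
  rw [descendingSlope, if_pos hx]
  exact limsup_le_iSup

/-- The form used along curves. Distance zero is treated separately, since the slope may be infinite
there. -/
lemma ofReal_sub_le_slope_mul (hf : LowerSemicontinuous f) (hbot : ∀ x, f x ≠ ⊥)
    (hc : ApproxConvex f) {x y : X} (hx : x ∈ finiteDomain f) (hy : y ∈ finiteDomain f) :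
    ENNReal.ofReal ((f x).toReal - (f y).toReal) ≤ descendingSlope edist f x * edist x y := by
  rcases eq_or_ne (edist x y) 0 with h0 | h0
  · have := le_of_edist_eq_zero_of_lsc hf h0
    rw [← finiteDomain_coe hx, ← finiteDomain_coe hy, EReal.coe_le_coe_iff] at this
    rw [ENNReal.ofReal_of_nonpos (by linarith)]
    simp
  · have := ratio_le_descendingSlope hf hbot hc hx y
    rw [ENNReal.div_le_iff_le_mul (Or.inl h0) (Or.inl (edist_ne_top _ _)),
      ← finiteDomain_coe hx, ← finiteDomain_coe hy, toENNReal_coe_sub_coe] at this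
    exact this

/-- One competitor `y` serves a whole neighbourhood of `x`: `f z` stays high by lower semicontinuity
while `dist z y` stays below `D`. Points outside the domain have infinite slope anyway. -/
lemma eventually_lt_descendingSlope (hf : LowerSemicontinuous f) (hbot : ∀ x, f x ≠ ⊥)
    (hc : ApproxConvex f) {x y : X} (hy : y ∈ finiteDomain f) {c D : ℝ} (hc0 : 0 ≤ c)
    (hD : dist x y < D) (h : (((f y).toReal + c * D : ℝ) : EReal) < f x) :
    ∀ᶠ z in 𝓝 x, ENNReal.ofReal c < descendingSlope edist f z := by
  have h1 : ∀ᶠ z in 𝓝 x, dist z y < D :=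
    (continuous_id.dist continuous_const).continuousAt.eventually (gt_mem_nhds hD)
  filter_upwards [h1, hf x _ h] with z hz hfz
  by_cases hzd : z ∈ finiteDomain f
  · refine lt_of_lt_of_le ?_ (ratio_le_descendingSlope hf hbot hc hzd y)
    rw [← finiteDomain_coe hzd, gt_iff_lt, EReal.coe_lt_coe_iff] at hfz
    rw [← finiteDomain_coe hzd, ← finiteDomain_coe hy, toENNReal_coe_sub_coe]
    have hcz : c * dist z y ≤ c * D := by gcongr
    have hpos : 0 < (f z).toReal - (f y).toReal := by
      have : 0 ≤ c * dist z y := by positivity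
      linarith
    rcases eq_or_ne (edist z y) 0 with h0 | h0
    · rw [h0, ENNReal.div_zero (by simpa using hpos)]
      exact ENNReal.ofReal_lt_top
    · rw [ENNReal.lt_div_iff_mul_lt (Or.inl h0) (Or.inl (edist_ne_top _ _)), edist_dist,
        ← ENNReal.ofReal_mul hc0]
      exact (ENNReal.ofReal_lt_ofReal_iff hpos).2 (by linarith)
  · rw [descendingSlope, if_neg hzd]
    exact ENNReal.ofReal_lt_top

/-- The descending slope of a lower semicontinuous, approximately convex function is lower
semicontinuous. -/
theorem lowerSemicontinuous_descendingSlope (hf : LowerSemicontinuous f) (hbot : ∀ x, f x ≠ ⊥)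
    (hc : ApproxConvex f) : LowerSemicontinuous (descendingSlope edist f) := by
  intro x c' hcx
  obtain ⟨c, hc'c, hcx⟩ := ENNReal.lt_iff_exists_nnreal_btwn.1 hcx
  suffices ∀ᶠ z in 𝓝 x, ENNReal.ofReal c < descendingSlope edist f z by
    filter_upwards [this] with z hz
    exact hc'c.trans (by simpa using hz)
  have hc0 : (0 : ℝ) ≤ c := c.2
  by_cases hx : x ∈ finiteDomain f
  · rw [descendingSlope_eq_iSup hf hbot hc hx, lt_iSup_iff] at hcx
    obtain ⟨y, hy⟩ := hcx
    have hyt : f y ≠ ⊤ := by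
      rintro hyt
      rw [hyt, EReal.sub_top] at hy
      simp at hy
    have hyd : y ∈ finiteDomain f := ⟨hyt, hbot y⟩
    rw [← finiteDomain_coe hx, ← finiteDomain_coe hyd, toENNReal_coe_sub_coe] at hy
    have hpos : 0 < (f x).toReal - (f y).toReal := by
      by_contra! h
      rw [ENNReal.ofReal_of_nonpos h] at hy
      simp at hy
    have hreal : c * dist x y < (f x).toReal - (f y).toReal := by
      rcases (dist_nonneg (x := x) (y := y)).eq_or_lt with h | h
      · rw [← h]; simpa using hpos
      · rw [edist_dist, ← ENNReal.ofReal_div_of_pos h, ← ENNReal.ofReal_coe_nnreal] at hy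
        exact (lt_div_iff₀ h).1 ((ENNReal.ofReal_lt_ofReal_iff_of_nonneg c.coe_nonneg).1 hy)
    -- Increasing the distance to `y` by `η` consumes at most half of the strict gap.
    set η := ((f x).toReal - (f y).toReal - c * dist x y) / (2 * (1 + c)) with hη
    have hη0 : 0 < η := div_pos (by linarith) (by positivity)
    have hη1 : η * (1 + c) = ((f x).toReal - (f y).toReal - c * dist x y) / 2 := by
      rw [hη]; field_simp
    refine eventually_lt_descendingSlope hf hbot hc hyd hc0 (D := dist x y + η) (by linarith) ?_
    rw [← finiteDomain_coe hx, EReal.coe_lt_coe_iff]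
    nlinarith
  · have hxt : f x = ⊤ := by
      by_contra h
      exact hx ⟨h, hbot x⟩
    -- When `f x = ⊤` any finite competitor works for every `c`; without one the slope is infinite
    -- everywhere.
    by_cases hne : ∃ y, y ∈ finiteDomain f
    · obtain ⟨y, hy⟩ := hne
      refine eventually_lt_descendingSlope hf hbot hc hy hc0 (D := dist x y + 1) (by linarith) ?_
      rw [hxt]
      exact EReal.coe_lt_top _
    · push Not at hne
      refine Eventually.of_forall fun z => ?_
      rw [descendingSlope, if_neg (hne z)]
      exact ENNReal.ofReal_lt_top

end Slope

/-! ### Integrating one-sided difference quotients -/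

lemma lintegral_Ioc_add_right (F : ℝ → ℝ≥0∞) (a h : ℝ) :
    ∫⁻ s in Ioc 0 h, F (s + a) = ∫⁻ s in Ioc a (a + h), F s := by
  have hpre : (fun s : ℝ => s + a) ⁻¹' Ioc a (a + h) = Ioc 0 h := by
    ext s; simp [add_comm a h]
  rw [← hpre]
  exact (measurePreserving_add_right volume a).setLIntegral_comp_preimage_emb
    (measurableEmbedding_addRight a) F _

/-- Averaged over its offset, a Riemann sum becomes the integral exactly, with no regularity of `F`.
-/
lemma sum_lintegral_Ioc_add (F : ℝ → ℝ≥0∞) {h : ℝ} (hh : 0 ≤ h) (n : ℕ) :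
    ∑ i ∈ Finset.range n, ∫⁻ s in Ioc 0 h, F (s + i * h) = ∫⁻ s in Ioc 0 (n * h), F s := by
  induction n with
  | zero => simp
  | succ n ih =>
    have hn : (0 : ℝ) ≤ n * h := by positivity
    rw [Finset.sum_range_succ, ih, lintegral_Ioc_add_right, ← lintegral_union measurableSet_Ioc
      (Set.Ioc_disjoint_Ioc_of_le le_rfl), Ioc_union_Ioc_eq_Ioc hn (by linarith)]
    congr 2
    push_cast; ring_nf

/-- A function on `[0, ℓ]` whose one-sided difference quotients at `s` are bounded by `F s` drops by
at most `∫ F`, provided that it is lower semicontinuous at the left end point. -/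
lemma ofReal_sub_le_lintegral_of_lsc {ℓ : ℝ} (hℓ : 0 < ℓ) {u : ℝ → ℝ} {F : ℝ → ℝ≥0∞}
    (hF : Measurable F)
    (hu : ∀ s ∈ Icc 0 ℓ, ∀ t ∈ Icc 0 ℓ, s ≤ t →
      ENNReal.ofReal (u s - u t) ≤ F s * ENNReal.ofReal (t - s))
    (hlsc : ∀ ε > 0, ∃ δ > 0, ∀ s ∈ Icc 0 ℓ, s < δ → u 0 ≤ u s + ε) :
    ENNReal.ofReal (u 0 - u ℓ) ≤ ∫⁻ s in Ioc 0 ℓ, F s := by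
  suffices H : ∀ ε > 0, ENNReal.ofReal (u 0 - u ℓ - ε) ≤ ∫⁻ s in Ioc 0 ℓ, F s by
    have hlim : Tendsto (fun ε : ℝ => ENNReal.ofReal (u 0 - u ℓ - ε)) (𝓝[>] 0)
        (𝓝 (ENNReal.ofReal (u 0 - u ℓ - 0))) :=
      ((ENNReal.continuous_ofReal.comp (continuous_const.sub continuous_id)).tendsto
        (0 : ℝ)).mono_left nhdsWithin_le_nhds
    rw [sub_zero] at hlim
    exact le_of_tendsto hlim (eventually_mem_nhdsWithin.mono fun ε hε => H ε hε)
  intro ε hε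
  obtain ⟨δ, hδ, hlscδ⟩ := hlsc ε hε
  -- The mesh `h = ℓ / (m + 1)` is below `δ`, so every offset `s < h` satisfies `u 0 ≤ u s + ε`.
  obtain ⟨m, hm⟩ := exists_nat_gt (ℓ / δ)
  set n := m + 1 with hn
  set h := ℓ / n with hh
  have hn0 : (0 : ℝ) < n := by positivity
  have hh0 : 0 < h := by positivity
  have hnh : n * h = ℓ := by rw [hh]; field_simp
  have hhδ : h < δ := by
    rw [hh, div_lt_iff₀ hn0]
    rw [div_lt_iff₀ hδ] at hm
    have : (n : ℝ) = m + 1 := by rw [hn]; push_cast; ring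
    rw [this]; nlinarith
  have hmh : m * h + h = ℓ := by rw [← hnh, hn]; push_cast; ring
  have hpt : ∀ s ∈ Ioo 0 h, ENNReal.ofReal (u 0 - u ℓ - ε) ≤
      ∑ i ∈ Finset.range n, F (s + i * h) * ENNReal.ofReal h := by
    intro s hs
    have hmem : ∀ k : ℕ, k ≤ m → s + k * h ∈ Icc 0 ℓ := by
      intro k hk
      have hk' : (k : ℝ) * h ≤ m * h := by gcongr
      have : (0 : ℝ) ≤ k * h := by positivity
      constructor <;> linarith [hs.1, hs.2]
    have hsum : ∀ k : ℕ, k ≤ m → ENNReal.ofReal (u s - u (s + k * h)) ≤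
        ∑ i ∈ Finset.range k, F (s + i * h) * ENNReal.ofReal h := by
      intro k
      induction k with
      | zero => simp
      | succ k ih =>
        intro hk
        rw [Finset.sum_range_succ]
        calc ENNReal.ofReal (u s - u (s + (k + 1 : ℕ) * h))
            = ENNReal.ofReal ((u s - u (s + k * h)) +
                (u (s + k * h) - u (s + (k + 1 : ℕ) * h))) := by ring_nf
          _ ≤ _ := ENNReal.ofReal_add_le
          _ ≤ _ := by
            gcongr
            · exact ih (by lia)
            · refine (hu _ (hmem k (by lia)) _ (hmem (k + 1) hk) ?_).trans_eq ?_
              · push_cast; nlinarith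
              · congr 2; push_cast; ring
    have h0 : u 0 ≤ u s + ε := by
      refine hlscδ s ?_ (hs.2.trans hhδ)
      simpa using hmem 0 (by lia)
    -- The first `m` summands telescope from `s` to `s + m * h`; the last covers the remaining step
    -- to `ℓ`, of length `h - s`.
    rw [hn, Finset.sum_range_succ]
    calc ENNReal.ofReal (u 0 - u ℓ - ε)
        ≤ ENNReal.ofReal ((u s - u (s + m * h)) + (u (s + m * h) - u ℓ)) :=
          ENNReal.ofReal_le_ofReal (by linarith)
      _ ≤ _ := ENNReal.ofReal_add_le
      _ ≤ _ := by
        gcongr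
        · exact hsum m le_rfl
        · refine (hu _ (hmem m le_rfl) ℓ ⟨hℓ.le, le_rfl⟩ (by linarith [hs.2])).trans ?_
          gcongr
          linarith [hs.1]
  have hint : ∫⁻ s in Ioc 0 h, ENNReal.ofReal (u 0 - u ℓ - ε) ≤
      (∫⁻ s in Ioc 0 ℓ, F s) * ENNReal.ofReal h := by
    have hFm : ∀ i : ℕ, Measurable fun s => F (s + i * h) := fun i =>
      hF.comp (measurable_id.add_const _)
    have hsplit := sum_lintegral_Ioc_add F hh0.le n
    rw [hnh] at hsplit
    rw [← hsplit, Finset.sum_mul, ← restrict_Ioo_eq_restrict_Ioc]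
    calc ∫⁻ s in Ioo 0 h, ENNReal.ofReal (u 0 - u ℓ - ε)
        ≤ ∫⁻ s in Ioo 0 h, ∑ i ∈ Finset.range n, F (s + i * h) * ENNReal.ofReal h :=
          setLIntegral_mono' measurableSet_Ioo hpt
      _ = _ := by
        rw [lintegral_finsetSum _ fun i _ => (hFm i).mul_const _]
        exact Finset.sum_congr rfl fun i _ => lintegral_mul_const _ (hFm i)
  rw [setLIntegral_const, Real.volume_Ioc, sub_zero] at hint
  exact (ENNReal.mul_le_mul_iff_left (by simpa using hh0) ENNReal.ofReal_ne_top).1 hint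

lemma lintegral_Ioc_withDensity_of_integrable {w : ℝ → ℝ} (hw : Integrable w) (hw0 : 0 ≤ w)
    {s t : ℝ} (hst : s ≤ t) :
    (volume.withDensity fun r => ENNReal.ofReal (w r)) (Ioc s t) =
      ENNReal.ofReal (∫ r in s..t, w r) := by
  rw [withDensity_apply _ measurableSet_Ioc, intervalIntegral.integral_of_le hst,
    ofReal_integral_eq_lintegral_ofReal hw.integrableOn (ae_of_all _ hw0)]

/-- The primitive of a nonnegative integrable function supported in `[0, 1]` pushes the measure with
that density forward to Lebesgue measure. -/
lemma map_primitive_withDensity {w : ℝ → ℝ} (hw : Integrable w) (hw0 : 0 ≤ w)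
    (hsupp : ∀ r, r ∉ Icc (0 : ℝ) 1 → w r = 0) :
    (volume.withDensity fun r => ENNReal.ofReal (w r)).map (fun t => ∫ r in (0 : ℝ)..t, w r) =
      volume.restrict (Ioc 0 (∫ r in (0 : ℝ)..1, w r)) := by
  set L : ℝ → ℝ := fun t => ∫ r in (0 : ℝ)..t, w r with hL
  set ν := volume.withDensity fun r => ENNReal.ofReal (w r) with hν
  set ℓ := ∫ r in (0 : ℝ)..1, w r with hℓ
  have hLcont : Continuous L := intervalIntegral.continuous_primitive
    (fun a b => hw.intervalIntegrable) 0
  have hLsub : ∀ s t, L t - L s = ∫ r in s..t, w r := fun s t =>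
    intervalIntegral.integral_interval_sub_left hw.intervalIntegrable hw.intervalIntegrable
  have hLmono : Monotone L := fun s t hst => by
    have : 0 ≤ ∫ r in s..t, w r := intervalIntegral.integral_nonneg hst fun r _ => hw0 r
    rw [← hLsub] at this
    linarith
  have hL0 : L 0 = 0 := by simp [hL]
  have hL1 : L 1 = ℓ := rfl
  have hout : ∀ s t : ℝ, s ≤ t → (t ≤ 0 ∨ 1 ≤ s) → ν (Ioc s t) = 0 := by
    intro s t hst h
    rw [hν, withDensity_apply _ measurableSet_Ioc, ← restrict_Ioo_eq_restrict_Ioc]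
    refine (setLIntegral_congr_fun measurableSet_Ioo (g := 0) fun r hr => ?_).trans (by simp)
    simp only [Pi.zero_apply, ENNReal.ofReal_eq_zero]
    refine (hsupp r ?_).le
    rintro ⟨h0, h1⟩
    rcases h with h | h <;> linarith [hr.1, hr.2]
  -- The support of `w` lies in `[0, 1]`, so all mass is seen there and distribution functions can
  -- be compared.
  have hnull : ν (Iic 0) = 0 ∧ ν (Ioi 1) = 0 := by
    have key : ∀ S : Set ℝ, MeasurableSet S → (∀ r ∈ S, r ≠ 0 → r ∉ Icc (0 : ℝ) 1) → ν S = 0 := by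
      intro S hS h
      rw [hν, withDensity_apply _ hS, lintegral_eq_zero_iff'
        hw.aestronglyMeasurable.aemeasurable.ennreal_ofReal.restrict]
      have h0 : ∀ᵐ r ∂(volume.restrict S), r ≠ 0 := ae_restrict_of_ae (by simp [ae_iff])
      filter_upwards [h0, ae_restrict_mem hS] with r hr hrS
      simp [hsupp r (h r hrS hr)]
    constructor
    · exact key _ measurableSet_Iic fun r hr h0 h => h0 (le_antisymm hr h.1)
    · exact key _ measurableSet_Ioi fun r hr h0 h => not_lt_of_ge h.2 hr
  have hIic : ∀ t ∈ Icc (0 : ℝ) 1, ν (Iic t) = ENNReal.ofReal (L t) := by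
    intro t ht
    rw [← Iic_union_Ioc_eq_Iic ht.1, measure_union (Set.Iic_disjoint_Ioc le_rfl) measurableSet_Ioc,
      hnull.1, zero_add, hν, lintegral_Ioc_withDensity_of_integrable hw hw0 ht.1]
  have huniv : ν univ = ENNReal.ofReal ℓ := by
    rw [← Iic_union_Ioi (a := (1 : ℝ)), measure_union (Iic_disjoint_Ioi le_rfl) measurableSet_Ioi,
      hnull.2, add_zero, hIic 1 (by simp)]
  have hfin : IsFiniteMeasure ν := ⟨by rw [huniv]; exact ENNReal.ofReal_lt_top⟩
  have hℓ0 : 0 ≤ ℓ := by rw [← hL1, ← hL0]; exact hLmono zero_le_one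
  have hsurj : ∀ a ∈ Icc 0 ℓ, ∃ t ∈ Icc (0 : ℝ) 1, L t = a := by
    intro a ha
    have := intermediate_value_Icc zero_le_one hLcont.continuousOn (a := (0 : ℝ)) (b := 1)
    rw [hL0, hL1] at this
    exact this ha
  refine Measure.ext_of_Iic _ _ fun a => ?_
  rw [Measure.map_apply hLcont.measurable measurableSet_Iic,
    Measure.restrict_apply measurableSet_Iic]
  have hL0' : ∀ t, 0 ≤ L t := by
    intro t
    rcases le_total 0 t with h | h
    · rw [← hL0]; exact hLmono h
    · refine le_of_eq ?_
      have h1 := lintegral_Ioc_withDensity_of_integrable hw hw0 h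
      have h2 : 0 ≤ ∫ r in t..0, w r := intervalIntegral.integral_nonneg h fun r _ => hw0 r
      rw [← hν, hout t 0 h (Or.inl le_rfl)] at h1
      have h3 := ENNReal.ofReal_eq_zero.1 h1.symm
      rw [← hLsub, hL0] at h2 h3
      linarith
  -- `L` may be constant on intervals, so `L ⁻¹' Iic a` can reach past a chosen point of the level
  -- `a`. It lies below any point of a higher level `b`, and `b` then decreases to `a`.
  have hup : ∀ b ∈ Icc 0 ℓ, a < b → ν (L ⁻¹' Iic a) ≤ ENNReal.ofReal b := by
    intro b hb hab
    obtain ⟨t, ht, htb⟩ := hsurj b hb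
    rw [← htb, ← hIic t ht]
    refine measure_mono fun s hs => ?_
    by_contra! hlt
    have h1 := hLmono (le_of_lt (not_le.1 hlt))
    rw [htb] at h1
    exact not_lt_of_ge (h1.trans hs) hab
  rcases lt_or_ge a 0 with ha | ha
  · have h1 : L ⁻¹' Iic a = ∅ := by
      ext t; simp only [mem_preimage, mem_Iic, mem_empty_iff_false, iff_false, not_le]
      exact ha.trans_le (hL0' t)
    have h2 : Iic a ∩ Ioc 0 ℓ = ∅ := by
      ext t; simp only [mem_inter_iff, mem_Iic, mem_Ioc, mem_empty_iff_false, iff_false]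
      rintro ⟨h, h', -⟩; linarith
    rw [h1, h2]; simp
  rcases le_or_gt ℓ a with ha' | ha'
  · have h2 : Iic a ∩ Ioc 0 ℓ = Ioc 0 ℓ := by
      ext t; simp only [mem_inter_iff, mem_Iic, mem_Ioc]
      exact ⟨fun h => h.2, fun h => ⟨h.2.trans ha', h⟩⟩
    rw [h2, Real.volume_Ioc, sub_zero, ← huniv]
    refine le_antisymm (measure_mono (subset_univ _)) ?_
    rw [huniv, ← hL1, ← hIic 1 (by simp)]
    exact measure_mono fun t ht => (hLmono ht).trans ha'
  · have h2 : Iic a ∩ Ioc 0 ℓ = Ioc 0 a := by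
      ext t; simp only [mem_inter_iff, mem_Iic, mem_Ioc]
      exact ⟨fun h => ⟨h.2.1, h.1⟩, fun h => ⟨h.2, h.1, h.2.trans ha'.le⟩⟩
    rw [h2, Real.volume_Ioc, sub_zero]
    refine le_antisymm ?_ ?_
    · have hlim : Tendsto ENNReal.ofReal (𝓝[>] a) (𝓝 (ENNReal.ofReal a)) :=
        (ENNReal.continuous_ofReal.tendsto a).mono_left nhdsWithin_le_nhds
      refine ge_of_tendsto hlim ?_
      filter_upwards [Ioc_mem_nhdsGT ha'] with b hb
      exact hup b ⟨ha.trans hb.1.le, hb.2⟩ hb.1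
    · obtain ⟨t, ht, hta⟩ := hsurj a ⟨ha, ha'.le⟩
      rw [← hta, ← hIic t ht]
      exact measure_mono fun s hs => hLmono hs

/-! ### Reparametrization by arc length -/

section Curve

variable {X : Type*} [PseudoMetricSpace X]

/-- Along a curve with speed `v`, a function whose decrease is controlled by `G` times the distance
drops by at most `∫ G v`. -/
lemma ofReal_sub_le_lintegral_mul_speed {γ : ℝ → X} {v G : ℝ → ℝ≥0∞} {u : ℝ → ℝ}
    (hv : AEMeasurable v (volume.restrict (Icc (0 : ℝ) 1)))
    (hvfin : ∫⁻ r in Icc (0 : ℝ) 1, v r ≠ ⊤)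
    (hγ : ∀ s ∈ Icc (0 : ℝ) 1, ∀ t ∈ Icc (0 : ℝ) 1, s ≤ t →
      edist (γ s) (γ t) ≤ ∫⁻ r in Icc s t, v r)
    (hG : Measurable G)
    (hu : ∀ s ∈ Icc (0 : ℝ) 1, ∀ t ∈ Icc (0 : ℝ) 1,
      ENNReal.ofReal (u s - u t) ≤ G s * edist (γ s) (γ t))
    (hG0 : ∀ s ∈ Icc (0 : ℝ) 1, ∀ t ∈ Icc (0 : ℝ) 1, edist (γ s) (γ t) = 0 → G s = G t)
    (hlsc : ∀ ε > 0, ∃ δ > 0, ∀ t ∈ Icc (0 : ℝ) 1,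
      edist (γ 0) (γ t) < ENNReal.ofReal δ → u 0 ≤ u t + ε) :
    ENNReal.ofReal (u 0 - u 1) ≤ ∫⁻ t in Icc (0 : ℝ) 1, G t * v t := by
  -- A real density: `v` is finite almost everywhere on `[0, 1]` because its integral is finite.
  set w : ℝ → ℝ := (Icc (0 : ℝ) 1).indicator fun r => (v r).toReal with hwdef
  have hvtop : ∀ᵐ r ∂(volume.restrict (Icc (0 : ℝ) 1)), v r < ⊤ := ae_lt_top' hv hvfin
  have hw : Integrable w := by
    rw [hwdef, integrable_indicator_iff measurableSet_Icc]
    exact integrable_toReal_of_lintegral_ne_top hv hvfin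
  have hw0 : 0 ≤ w := fun r => indicator_nonneg (fun _ _ => ENNReal.toReal_nonneg) r
  have hsupp : ∀ r, r ∉ Icc (0 : ℝ) 1 → w r = 0 := fun r hr => indicator_of_notMem hr _
  have hwv : ∀ᵐ r ∂(volume.restrict (Icc (0 : ℝ) 1)), ENNReal.ofReal (w r) = v r := by
    filter_upwards [hvtop, ae_restrict_mem measurableSet_Icc] with r hr hmem
    rw [hwdef, indicator_of_mem hmem, ENNReal.ofReal_toReal hr.ne]
  have hpush := map_primitive_withDensity hw hw0 hsupp
  set L : ℝ → ℝ := fun t => ∫ r in (0 : ℝ)..t, w r with hL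
  set ℓ := ∫ r in (0 : ℝ)..1, w r with hℓ
  have hLcont : Continuous L := intervalIntegral.continuous_primitive
    (fun a b => hw.intervalIntegrable) 0
  have hL0 : L 0 = 0 := by simp [hL]
  have hL1 : L 1 = ℓ := rfl
  have hdist : ∀ s ∈ Icc (0 : ℝ) 1, ∀ t ∈ Icc (0 : ℝ) 1, s ≤ t →
      edist (γ s) (γ t) ≤ ENNReal.ofReal (L t - L s) := by
    intro s hs t ht hst
    have hLst : L t - L s = ∫ r in s..t, w r :=
      intervalIntegral.integral_interval_sub_left hw.intervalIntegrable hw.intervalIntegrable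
    rw [hLst, ← lintegral_Ioc_withDensity_of_integrable hw hw0 hst,
      withDensity_apply _ measurableSet_Ioc, restrict_Ioc_eq_restrict_Icc]
    refine (hγ s hs t ht hst).trans_eq (lintegral_congr_ae ?_)
    exact (ae_restrict_of_ae_restrict_of_subset (Icc_subset_Icc hs.1 ht.2) hwv).mono
      fun r hr => hr.symm
  have hdist' : ∀ s ∈ Icc (0 : ℝ) 1, ∀ t ∈ Icc (0 : ℝ) 1,
      edist (γ s) (γ t) ≤ ENNReal.ofReal |L t - L s| := by
    intro s hs t ht
    rcases le_total s t with h | h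
    · exact (hdist s hs t ht h).trans (ENNReal.ofReal_le_ofReal (le_abs_self _))
    · rw [edist_comm, abs_sub_comm]
      exact (hdist t ht s hs h).trans (ENNReal.ofReal_le_ofReal (le_abs_self _))
  have hLmono : Monotone L := fun s t hst => by
    have h0 : 0 ≤ ∫ r in s..t, w r := intervalIntegral.integral_nonneg hst fun r _ => hw0 r
    have hLst : L t - L s = ∫ r in s..t, w r :=
      intervalIntegral.integral_interval_sub_left hw.intervalIntegrable hw.intervalIntegrable
    linarith
  have hℓ0 : 0 ≤ ℓ := by rw [← hL1, ← hL0]; exact hLmono zero_le_one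
  -- If the total length vanishes, the end points are at distance zero and `hu` excludes a drop.
  rcases hℓ0.eq_or_lt with hℓz | hℓpos
  · have h01 : edist (γ 0) (γ 1) = 0 := by
      have := hdist 0 (by simp) 1 (by simp) zero_le_one
      rw [hL1, hL0, ← hℓz] at this
      simpa using this
    have := hu 0 (by simp) 1 (by simp)
    rw [h01, mul_zero] at this
    exact this.trans zero_le
  have hsurj : ∀ a : Icc 0 ℓ, ∃ t ∈ Icc (0 : ℝ) 1, L t = a := by
    intro a
    have := intermediate_value_Icc zero_le_one hLcont.continuousOn (a := (0 : ℝ)) (b := 1)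
    rw [hL0, hL1] at this
    exact this a.2
  choose T₀ hT₀ hLT₀ using hsurj
  -- `T` is a right inverse of the length function `L` on `[0, ℓ]`, monotone and hence measurable.
  -- `γ ∘ T` has speed at most one, so `hu` becomes a bound by difference quotients.
  set T : ℝ → ℝ := fun s => T₀ (projIcc 0 ℓ hℓ0 s) with hT
  have hTmem : ∀ s, T s ∈ Icc (0 : ℝ) 1 := fun s => hT₀ _
  have hLT : ∀ s ∈ Icc 0 ℓ, L (T s) = s := fun s hs => by
    rw [hT]
    simp only [hLT₀, projIcc_of_mem hℓ0 hs]
  have hTmono : Monotone T := by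
    intro s t hst
    have hle := monotone_projIcc hℓ0 hst
    rcases hle.eq_or_lt with h | h
    · simp only [hT, h, le_refl]
    · by_contra! hlt
      have h1 := hLmono hlt.le
      simp only [hT, hLT₀] at h1
      exact not_lt_of_ge h1 h
  have hdrop := ofReal_sub_le_lintegral_of_lsc hℓpos (u := fun s => u (T s))
    (F := fun s => G (T s)) (hG.comp hTmono.measurable) ?_ ?_
  · have hzero : ∀ t ∈ Icc (0 : ℝ) 1, edist (γ (T (L t))) (γ t) = 0 := by
      intro t ht
      have hLt : L t ∈ Icc 0 ℓ := by
        constructor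
        · rw [← hL0]; exact hLmono ht.1
        · rw [← hL1]; exact hLmono ht.2
      have := hdist' _ (hTmem (L t)) t ht
      rw [hLT _ hLt] at this
      simpa using this
    have hu0 : ∀ t ∈ Icc (0 : ℝ) 1, u (T (L t)) = u t := by
      intro t ht
      have h1 := hu _ (hTmem (L t)) t ht
      have h2 := hu t ht _ (hTmem (L t))
      rw [edist_comm, hzero t ht, mul_zero] at h2
      rw [hzero t ht, mul_zero] at h1
      have h1' := ENNReal.ofReal_eq_zero.1 (le_antisymm h1 zero_le)
      have h2' := ENNReal.ofReal_eq_zero.1 (le_antisymm h2 zero_le)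
      linarith
    have e0 := hu0 0 (by simp)
    have e1 := hu0 1 (by simp)
    rw [hL0] at e0
    rw [hL1] at e1
    simp only [e0, e1] at hdrop
    refine hdrop.trans_eq ?_
    have hGT : Measurable fun s => G (T s) := hG.comp hTmono.measurable
    have hGTL : Measurable fun t => G (T (L t)) := hGT.comp hLcont.measurable
    rw [← hpush, lintegral_map hGT hLcont.measurable,
      lintegral_withDensity_eq_lintegral_mul₀
        hw.aestronglyMeasurable.aemeasurable.ennreal_ofReal hGTL.aemeasurable,
      ← lintegral_indicator measurableSet_Icc]
    have hwv' := (ae_restrict_iff' measurableSet_Icc).1 hwv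
    refine lintegral_congr_ae (hwv'.mono fun t ht => ?_)
    by_cases hmem : t ∈ Icc (0 : ℝ) 1
    · simp only [Pi.mul_apply, indicator_of_mem hmem]
      rw [ht hmem, mul_comm, hG0 _ (hTmem _) t hmem (hzero t hmem)]
    · simp [indicator_of_notMem hmem, hsupp t hmem]
  · intro s hs t ht hst
    refine (hu _ (hTmem s) _ (hTmem t)).trans ?_
    gcongr
    refine (hdist' _ (hTmem s) _ (hTmem t)).trans_eq ?_
    rw [hLT s hs, hLT t ht, abs_of_nonneg (by linarith)]
  · intro ε hε
    obtain ⟨δ, hδ, H⟩ := hlsc ε hε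
    refine ⟨δ, hδ, fun s hs hsδ => ?_⟩
    have h00 : (0 : ℝ) ∈ Icc 0 ℓ := ⟨le_rfl, hℓ0⟩
    -- `T 0` need not be `0`, so the hypothesis at time `0` is transferred along a piece of length
    -- zero.
    have hz : edist (γ (T 0)) (γ 0) = 0 := by
      have := hdist' _ (hTmem 0) 0 (by simp)
      rw [hLT 0 h00, hL0] at this
      simpa using this
    have hle : u (T 0) ≤ u 0 := by
      have := hu _ (hTmem 0) 0 (by simp)
      rw [hz, mul_zero] at this
      have := ENNReal.ofReal_eq_zero.1 (le_antisymm this zero_le)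
      linarith
    refine hle.trans (H _ (hTmem s) ?_)
    refine (hdist' 0 (by simp) _ (hTmem s)).trans_lt ?_
    rw [hLT s hs, hL0, sub_zero, abs_of_nonneg hs.1]
    exact (ENNReal.ofReal_lt_ofReal_iff hδ).2 hsδ

end Curve

/-! ### The metric derivative of an absolutely continuous curve -/

section MetricDerivative

variable {X : Type*} [PseudoMetricSpace X] {γ : ℝ → X}

lemma metricDeriv_congr {γ' : ℝ → X} (h : ∀ t ∈ Icc (0 : ℝ) 1, γ t = γ' t) {t : ℝ}
    (ht : t ∈ Icc (0 : ℝ) 1) : metricDeriv edist γ t = metricDeriv edist γ' t := by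
  refine limsup_congr ?_
  filter_upwards [self_mem_nhdsWithin] with s hs
  rw [h s hs.1, h t ht]

/-- The metric derivative of a continuous curve as a countable infimum of countable suprema. -/
lemma metricDeriv_eq_iInf_iSup (hγ : Continuous γ) (t : ℝ) :
    metricDeriv edist γ t = ⨅ n : ℕ, ⨆ q : {q : ℚ // (q : ℝ) ∈ Icc (0 : ℝ) 1},
      {t | (q : ℝ) ≠ t ∧ |(q : ℝ) - t| < 1 / (n + 1)}.indicator
        (fun t => edist (γ q) (γ t) / ENNReal.ofReal |(q : ℝ) - t|) t := by
  have hbasis : (𝓝[Icc (0 : ℝ) 1 \ {t}] t).HasBasis (fun _ : ℕ => True)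
      (fun n => Metric.ball t (1 / ((n : ℝ) + 1)) ∩ (Icc (0 : ℝ) 1 \ {t})) :=
    nhdsWithin_hasBasis Metric.nhds_basis_ball_inv_nat_succ _
  rw [metricDeriv, hbasis.limsup_eq_iInf_iSup]
  simp only [iInf_true]
  refine iInf_congr fun n => le_antisymm ?_ ?_
  · refine iSup₂_le fun s hs => ?_
    obtain ⟨hball, hsI, hst⟩ := hs
    refine le_of_forall_lt fun c hc => ?_
    have hst' : s ≠ t := hst
    -- The quotient is continuous in `s ≠ t`, so rational times approximate the supremum.
    have hcont : ContinuousAt (fun s => edist (γ s) (γ t) / ENNReal.ofReal |s - t|) s := by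
      refine ENNReal.Tendsto.div ?_ (Or.inr ?_) ?_ (Or.inl ENNReal.ofReal_ne_top)
      · exact (hγ.edist continuous_const).continuousAt
      · simpa [sub_eq_zero] using hst'
      · exact (ENNReal.continuous_ofReal.comp
          (continuous_abs.comp (continuous_id.sub continuous_const))).continuousAt
    have hev : ∀ᶠ r in 𝓝 s, c < edist (γ r) (γ t) / ENNReal.ofReal |r - t| ∧ r ≠ t ∧
        |r - t| < 1 / ((n : ℝ) + 1) := by
      refine (hcont.eventually (lt_mem_nhds hc)).and ((eventually_ne_nhds hst').and ?_)
      have : |s - t| < 1 / ((n : ℝ) + 1) := by simpa [Real.dist_eq] using hball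
      exact (continuous_abs.comp
        (continuous_id.sub continuous_const)).continuousAt.eventually (gt_mem_nhds this)
    obtain ⟨O, hO, hOopen, hsO⟩ := eventually_nhds_iff.1 hev
    -- `s` may be `0` or `1`; the nearby rational is sought in the open interval so that it stays in
    -- `[0, 1]`.
    have hcl : s ∈ closure (Ioo (0 : ℝ) 1) := by
      rw [closure_Ioo zero_ne_one]; exact hsI
    obtain ⟨q, hq⟩ := Rat.denseRange_cast.exists_mem_open (hOopen.inter isOpen_Ioo)
      (mem_closure_iff.1 hcl O hOopen hsO)
    obtain ⟨h1, h2, h3⟩ := hO q hq.1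
    refine h1.trans_le (le_trans ?_ (le_iSup _ ⟨q, Ioo_subset_Icc_self hq.2⟩))
    rw [indicator_of_mem (show t ∈ {t | (q : ℝ) ≠ t ∧ |(q : ℝ) - t| < 1 / ((n : ℝ) + 1)} from
      ⟨h2, h3⟩)]
  · refine iSup_le fun q => ?_
    by_cases hq : t ∈ {t | (q : ℝ) ≠ t ∧ |(q : ℝ) - t| < 1 / ((n : ℝ) + 1)}
    · rw [indicator_of_mem hq]
      refine le_iSup₂ (f := fun s (_ : s ∈ Metric.ball t (1 / ((n : ℝ) + 1)) ∩
        (Icc (0 : ℝ) 1 \ {t})) => edist (γ s) (γ t) / ENNReal.ofReal |s - t|) (q : ℝ)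
        ⟨by simpa [Real.dist_eq] using hq.2, q.2, hq.1⟩
    · rw [indicator_of_notMem hq]
      exact zero_le

lemma aemeasurable_metricDeriv (hγ : Continuous γ) :
    AEMeasurable (metricDeriv edist γ) (volume.restrict (Icc (0 : ℝ) 1)) := by
  refine ⟨_, ?_, ae_of_all _ (metricDeriv_eq_iInf_iSup hγ)⟩
  refine Measurable.iInf fun n => Measurable.iSup fun q => Measurable.indicator ?_ ?_
  · exact ((continuous_const.edist hγ).measurable).div
      (ENNReal.measurable_ofReal.comp ((continuous_const.sub continuous_id).abs.measurable))
  · refine MeasurableSet.inter ?_ (measurableSet_lt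
      ((continuous_const.sub continuous_id).abs.measurable) measurable_const)
    exact (isOpen_ne_fun continuous_const continuous_id).measurableSet

/-- An absolutely continuous curve is controlled by the primitive of an integrable function. -/
lemma IsAbsCont.exists_integrable (hγ : IsAbsCont edist γ) :
    ∃ w : ℝ → ℝ, Integrable w ∧ 0 ≤ w ∧ ∀ s ∈ Icc (0 : ℝ) 1, ∀ t ∈ Icc (0 : ℝ) 1,
      dist (γ s) (γ t) ≤ |∫ r in s..t, w r| := by
  obtain ⟨g, hg, hgfin, H⟩ := hγ
  set w : ℝ → ℝ := (Icc (0 : ℝ) 1).indicator fun r => (g r).toReal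
  have hw : Integrable w := by
    rw [integrable_indicator_iff measurableSet_Icc]
    exact integrable_toReal_of_lintegral_ne_top hg.aemeasurable hgfin
  have hw0 : 0 ≤ w := fun r => indicator_nonneg (fun _ _ => ENNReal.toReal_nonneg) r
  have key : ∀ s ∈ Icc (0 : ℝ) 1, ∀ t ∈ Icc (0 : ℝ) 1, s ≤ t →
      dist (γ s) (γ t) ≤ |∫ r in s..t, w r| := by
    intro s hs t ht hst
    have h1 := H s hs t ht hst
    have hsub : Icc s t ⊆ Icc (0 : ℝ) 1 := Icc_subset_Icc hs.1 ht.2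
    have hfin : ∫⁻ r in Icc s t, g r ≠ ⊤ := ne_top_of_le_ne_top hgfin (lintegral_mono_set hsub)
    have h2 : ∫ r in s..t, w r = (∫⁻ r in Icc s t, g r).toReal := by
      rw [intervalIntegral.integral_of_le hst, ← integral_Icc_eq_integral_Ioc,
        ← integral_toReal hg.aemeasurable (ae_lt_top' hg.aemeasurable hfin)]
      exact setIntegral_congr_fun measurableSet_Icc fun r hr => indicator_of_mem (hsub hr) _
    rw [h2, abs_of_nonneg ENNReal.toReal_nonneg, dist_edist]
    exact ENNReal.toReal_mono hfin h1
  refine ⟨w, hw, hw0, fun s hs t ht => ?_⟩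
  rcases le_total s t with h | h
  · exact key s hs t ht h
  · rw [dist_comm, intervalIntegral.integral_symm, abs_neg]
    exact key t ht s hs h

lemma IsAbsCont.continuousOn (hγ : IsAbsCont edist γ) : ContinuousOn γ (Icc (0 : ℝ) 1) := by
  obtain ⟨w, hw, -, H⟩ := hγ.exists_integrable
  intro t ht
  have hcont : Continuous fun s => |∫ r in s..t, w r| := by
    have : (fun s => |∫ r in s..t, w r|) = fun s => |∫ r in t..s, w r| := by
      ext s; rw [intervalIntegral.integral_symm, abs_neg]
    rw [this]
    exact continuous_abs.comp
      (intervalIntegral.continuous_primitive (fun a b => hw.intervalIntegrable) t)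
  have hlim : Tendsto (fun s => |∫ r in s..t, w r|) (𝓝[Icc 0 1] t) (𝓝 0) := by
    have := (hcont.tendsto t).mono_left (nhdsWithin_le_nhds (s := Icc 0 1))
    simpa using this
  refine tendsto_iff_dist_tendsto_zero.2 (squeeze_zero' ?_ ?_ hlim)
  · exact Eventually.of_forall fun _ => dist_nonneg
  · filter_upwards [self_mem_nhdsWithin] with s hs using H s hs t ht

/-- The quotients of `γ` are dominated by those of the primitive of `w`, which converge to `w t` for
almost every `t` by Lebesgue differentiation. -/
lemma IsAbsCont.lintegral_metricDeriv_ne_top (hγ : IsAbsCont edist γ) :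
    ∫⁻ t in Icc (0 : ℝ) 1, metricDeriv edist γ t ≠ ⊤ := by
  obtain ⟨w, hw, hw0, H⟩ := hγ.exists_integrable
  have hder : ∀ᵐ t ∂(volume.restrict (Icc (0 : ℝ) 1)),
      metricDeriv edist γ t ≤ ENNReal.ofReal (w t) := by
    have h := hw.intervalIntegrable (a := 0) (b := 1)
    have h' := h.ae_hasDerivAt_integral
    refine (ae_restrict_iff' measurableSet_Icc).2 (h'.mono fun t ht htI => ?_)
    have hd := ht (by rwa [uIcc_of_le zero_le_one]) 0 (by simp)
    have hslope := (hasDerivAt_iff_tendsto_slope.1 hd)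
    have hlim : Tendsto (fun s => ENNReal.ofReal |slope (fun x => ∫ r in (0 : ℝ)..x, w r) t s|)
        (𝓝[Icc (0 : ℝ) 1 \ {t}] t) (𝓝 (ENNReal.ofReal |w t|)) :=
      ((ENNReal.continuous_ofReal.comp continuous_abs).tendsto (w t)).comp
        (hslope.mono_left (nhdsWithin_mono _ fun s hs => hs.2))
    rw [abs_of_nonneg (hw0 t)] at hlim
    have hne : (𝓝[Icc (0 : ℝ) 1 \ {t}] t).NeBot ∨ 𝓝[Icc (0 : ℝ) 1 \ {t}] t = ⊥ := by
      rcases eq_or_neBot (𝓝[Icc (0 : ℝ) 1 \ {t}] t) with h | h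
      · exact Or.inr h
      · exact Or.inl h
    rcases hne with hne | hne
    · rw [metricDeriv, ← hlim.limsup_eq]
      refine limsup_le_limsup ?_
      filter_upwards [self_mem_nhdsWithin] with s hs
      have hst : s ≠ t := hs.2
      have hpos : 0 < |s - t| := abs_pos.2 (sub_ne_zero.2 hst)
      rw [edist_dist, ← ENNReal.ofReal_div_of_pos hpos]
      refine ENNReal.ofReal_le_ofReal ?_
      rw [slope_def_field, abs_div, intervalIntegral.integral_interval_sub_left
        hw.intervalIntegrable hw.intervalIntegrable, dist_comm]
      gcongr
      exact H t htI s hs.1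
    · rw [metricDeriv, hne]; simp
  refine ne_top_of_le_ne_top ?_ (lintegral_mono_ae hder)
  exact (hw.integrableOn.lintegral_lt_top).ne

/-- The real function `r ↦ d(γ s, γ r)` is absolutely continuous, and by the triangle inequality its
derivative is at most the metric derivative; integrating the derivative gives the distance. -/
lemma IsAbsCont.edist_le_lintegral_metricDeriv (hγ : IsAbsCont edist γ) {s t : ℝ}
    (hs : s ∈ Icc (0 : ℝ) 1) (ht : t ∈ Icc (0 : ℝ) 1) (hst : s ≤ t) :
    edist (γ s) (γ t) ≤ ∫⁻ r in Icc s t, metricDeriv edist γ r := by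
  obtain ⟨w, hw, hw0, H⟩ := hγ.exists_integrable
  set φ : ℝ → ℝ := fun r => dist (γ s) (γ r) with hφ
  have hsub : Icc s t ⊆ Icc (0 : ℝ) 1 := Icc_subset_Icc hs.1 ht.2
  have hlip : ∀ a b, |φ a - φ b| ≤ dist (γ a) (γ b) := fun a b => by
    simp only [hφ]
    rw [dist_comm (γ s) (γ a), dist_comm (γ s) (γ b)]
    exact abs_dist_sub_le _ _ _
  have hac : AbsolutelyContinuousOnInterval φ s t := by
    have hprim := (hw.intervalIntegrable (a := s) (b := t)
      ).absolutelyContinuousOnInterval_intervalIntegral (c := s) (by simp)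
    refine squeeze_zero' (Eventually.of_forall fun E => Finset.sum_nonneg fun _ _ => dist_nonneg)
      ?_ hprim
    filter_upwards [mem_inf_of_right (mem_principal_self _)] with E hE
    refine Finset.sum_le_sum fun i hi => ?_
    have h1 := hE.1 i hi
    rw [uIcc_of_le hst] at h1
    rw [Real.dist_eq, Real.dist_eq, abs_sub_comm (∫ r in s..(E.2 i).1, w r),
      intervalIntegral.integral_interval_sub_left hw.intervalIntegrable hw.intervalIntegrable]
    exact (hlip _ _).trans (H _ (hsub h1.1) _ (hsub h1.2))
  have hftc := hac.integral_deriv_eq_sub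
  have hφs : φ s = 0 := dist_self _
  rw [hφs, sub_zero, intervalIntegral.integral_of_le hst] at hftc
  have hderiv : ∀ r ∈ Ioo s t, ‖deriv φ r‖ₑ ≤ metricDeriv edist γ r := by
    intro r hr
    by_cases hd : DifferentiableAt ℝ φ r
    · have hslope := hasDerivAt_iff_tendsto_slope.1 hd.hasDerivAt
      have hIcc : Icc (0 : ℝ) 1 ∈ 𝓝 r := mem_of_superset (Icc_mem_nhds hr.1 hr.2) hsub
      have hfil : 𝓝[Icc (0 : ℝ) 1 \ {r}] r = 𝓝[≠] r := by
        rw [sdiff_eq, inter_comm]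
        exact nhdsWithin_inter_of_mem' (nhdsWithin_le_nhds hIcc)
      have hlim := (continuous_enorm.tendsto (deriv φ r)).comp hslope
      rw [metricDeriv, hfil, ← hlim.limsup_eq]
      refine limsup_le_limsup ?_
      filter_upwards [self_mem_nhdsWithin] with x hx
      have hpos : 0 < |x - r| := abs_pos.2 (sub_ne_zero.2 hx)
      rw [edist_dist, ← ENNReal.ofReal_div_of_pos hpos, Function.comp_apply, slope_def_field,
        Real.enorm_eq_ofReal_abs, abs_div]
      exact ENNReal.ofReal_le_ofReal (by gcongr; exact hlip x r)
    -- Where `φ` is not differentiable, `deriv` has the default value zero.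
    · rw [deriv_zero_of_not_differentiableAt hd]; simp
  calc edist (γ s) (γ t) = ‖∫ r in Ioc s t, deriv φ r‖ₑ := by
        rw [hftc, Real.enorm_eq_ofReal dist_nonneg, edist_dist]
    _ ≤ ∫⁻ r in Ioc s t, ‖deriv φ r‖ₑ := enorm_integral_le_lintegral_enorm _
    _ = ∫⁻ r in Ioo s t, ‖deriv φ r‖ₑ := by rw [restrict_Ioo_eq_restrict_Ioc]
    _ ≤ ∫⁻ r in Ioo s t, metricDeriv edist γ r := setLIntegral_mono' measurableSet_Ioo hderiv
    _ ≤ _ := lintegral_mono_set Ioo_subset_Icc_self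

end MetricDerivative

/-! ### The slope as an upper gradient -/

section UpperGradient

variable {X : Type*} [PseudoMetricSpace X] {f : X → EReal}

/-- The drop of `f` along an absolutely continuous curve which is parametrized on the whole line. -/
lemma ofReal_sub_le_lintegral_slope (hf : LowerSemicontinuous f) (hbot : ∀ x, f x ≠ ⊥)
    (hc : ApproxConvex f) {γ : ℝ → X} (hγc : Continuous γ)
    (hdom : ∀ t ∈ Icc (0 : ℝ) 1, γ t ∈ finiteDomain f) {v : ℝ → ℝ≥0∞}
    (hv : AEMeasurable v (volume.restrict (Icc (0 : ℝ) 1)))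
    (hvfin : ∫⁻ r in Icc (0 : ℝ) 1, v r ≠ ⊤)
    (hγv : ∀ s ∈ Icc (0 : ℝ) 1, ∀ t ∈ Icc (0 : ℝ) 1, s ≤ t →
      edist (γ s) (γ t) ≤ ∫⁻ r in Icc s t, v r) :
    ENNReal.ofReal ((f (γ 0)).toReal - (f (γ 1)).toReal) ≤
      ∫⁻ t in Icc (0 : ℝ) 1, descendingSlope edist f (γ t) * v t := by
  have hslsc := lowerSemicontinuous_descendingSlope hf hbot hc
  refine ofReal_sub_le_lintegral_mul_speed (G := fun t => descendingSlope edist f (γ t))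
    (u := fun t => (f (γ t)).toReal) hv hvfin hγv ?_ ?_ ?_ ?_
  · exact (hslsc.comp hγc).measurable
  · exact fun s hs t ht => ofReal_sub_le_slope_mul hf hbot hc (hdom s hs) (hdom t ht)
  · intro s hs t ht h
    have hins : Inseparable (γ s) (γ t) := EMetric.inseparable_iff.2 h
    have key : ∀ x y : X, Inseparable x y →
        descendingSlope edist f x ≤ descendingSlope edist f y := by
      intro x y hxy
      by_contra! hlt
      have := hslsc x _ hlt
      rw [hxy.nhds_eq] at this
      exact lt_irrefl _ this.self_of_nhds
    exact le_antisymm (key _ _ hins) (key _ _ hins.symm)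
  · intro ε hε
    have h0 := hdom 0 (by simp)
    have hlt : (((f (γ 0)).toReal - ε : ℝ) : EReal) < f (γ 0) := by
      conv_rhs => rw [← finiteDomain_coe h0]
      exact_mod_cast sub_lt_self _ hε
    obtain ⟨δ, hδ, hball⟩ := Metric.eventually_nhds_iff.1 (hf (γ 0) _ hlt)
    refine ⟨δ, hδ, fun t ht htδ => ?_⟩
    have : _ < f (γ t) := hball (y := γ t) (by
      rw [dist_comm]
      rw [edist_dist] at htδ
      exact (ENNReal.ofReal_lt_ofReal_iff hδ).1 htδ)
    rw [← finiteDomain_coe (hdom t ht), EReal.coe_lt_coe_iff] at this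
    linarith

lemma lintegral_Icc_one_sub (F : ℝ → ℝ≥0∞) (s t : ℝ) :
    ∫⁻ r in Icc s t, F (1 - r) = ∫⁻ r in Icc (1 - t) (1 - s), F r := by
  have hpre : (fun r : ℝ => 1 - r) ⁻¹' Icc (1 - t) (1 - s) = Icc s t := by
    ext r; simp only [mem_preimage, mem_Icc]; constructor <;> rintro ⟨h1, h2⟩ <;>
      constructor <;> linarith
  rw [← hpre]
  exact (Measure.measurePreserving_sub_left volume 1).setLIntegral_comp_preimage_emb
    (MeasurableEquiv.subLeft 1).measurableEmbedding F _

/-- The descending slope of a lower semicontinuous, approximately convex function is an upper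
gradient. -/
theorem isUpperGradient_descendingSlope (hf : LowerSemicontinuous f) (hbot : ∀ x, f x ≠ ⊥)
    (hc : ApproxConvex f) : IsUpperGradient edist (descendingSlope edist f) f := by
  intro γ₀ hγ₀ hdom₀
  -- Only times in `[0, 1]` matter. The extension by constants is continuous on the line, which
  -- makes the slope along it measurable.
  set γ : ℝ → X := fun t => γ₀ (projIcc 0 1 zero_le_one t) with hγdef
  have hγeq : ∀ t ∈ Icc (0 : ℝ) 1, γ₀ t = γ t := fun t ht => by
    simp only [hγdef, projIcc_of_mem zero_le_one ht]
  have hγc : Continuous γ :=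
    hγ₀.continuousOn.comp_continuous (continuous_subtype_val.comp continuous_projIcc)
      fun t => (projIcc 0 1 zero_le_one t).2
  have hγ : IsAbsCont edist γ := by
    obtain ⟨g, h1, h2, h3⟩ := hγ₀
    refine ⟨g, h1, h2, fun s hs t ht hst => ?_⟩
    rw [← hγeq s hs, ← hγeq t ht]
    exact h3 s hs t ht hst
  have hdom : ∀ t ∈ Icc (0 : ℝ) 1, γ t ∈ finiteDomain f := fun t ht => by
    rw [← hγeq t ht]; exact hdom₀ t ht
  have hslsc := lowerSemicontinuous_descendingSlope hf hbot hc
  have hv := aemeasurable_metricDeriv hγc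
  have hvfin := hγ.lintegral_metricDeriv_ne_top
  have hγv := fun s hs t ht hst => hγ.edist_le_lintegral_metricDeriv (s := s) (t := t) hs ht hst
  have hmeas : Measurable fun t => descendingSlope edist f (γ t) := (hslsc.comp hγc).measurable
  have hcongr : ∀ t ∈ Icc (0 : ℝ) 1, descendingSlope edist f (γ₀ t) * metricDeriv edist γ₀ t =
      descendingSlope edist f (γ t) * metricDeriv edist γ t := fun t ht => by
    rw [metricDeriv_congr hγeq ht, hγeq t ht]
  refine ⟨?_, ?_⟩
  · exact (hmeas.aemeasurable.mul hv).congr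
      ((ae_restrict_mem measurableSet_Icc).mono fun t ht => (hcongr t ht).symm)
  · rw [setLIntegral_congr_fun measurableSet_Icc hcongr, hγeq 0 (by simp), hγeq 1 (by simp)]
    rcases le_total ((f (γ 1)).toReal) ((f (γ 0)).toReal) with hle | hle
    · rw [abs_sub_comm, abs_of_nonneg (by linarith)]
      exact ofReal_sub_le_lintegral_slope hf hbot hc hγc hdom hv hvfin hγv
    · rw [abs_of_nonneg (by linarith)]
      -- An increase of `f` is a drop along the time-reversed curve.
      have hflip : ∀ t ∈ Icc (0 : ℝ) 1, 1 - t ∈ Icc (0 : ℝ) 1 := fun t ht =>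
        ⟨by linarith [ht.2], by linarith [ht.1]⟩
      have hmp : MeasurePreserving (fun r : ℝ => 1 - r) (volume.restrict (Icc (0 : ℝ) 1))
          (volume.restrict (Icc (0 : ℝ) 1)) := by
        have := (Measure.measurePreserving_sub_left volume (1 : ℝ)).restrict_preimage
          (measurableSet_Icc (a := (0 : ℝ)) (b := 1))
        simpa using this
      have hγv' : ∀ s ∈ Icc (0 : ℝ) 1, ∀ t ∈ Icc (0 : ℝ) 1, s ≤ t →
          edist (γ (1 - s)) (γ (1 - t)) ≤ ∫⁻ r in Icc s t, metricDeriv edist γ (1 - r) := by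
        intro s hs t ht hst
        rw [lintegral_Icc_one_sub, edist_comm]
        exact hγv _ (hflip t ht) _ (hflip s hs) (by linarith)
      have := ofReal_sub_le_lintegral_slope hf hbot hc (γ := fun t => γ (1 - t))
        (hγc.comp (by fun_prop)) (fun t ht => hdom _ (hflip t ht))
        (v := fun r => metricDeriv edist γ (1 - r))
        (hv.comp_quasiMeasurePreserving hmp.quasiMeasurePreserving)
        (by rw [lintegral_Icc_one_sub]; simpa using hvfin) hγv'
      rw [lintegral_Icc_one_sub (fun r => descendingSlope edist f (γ r) * metricDeriv edist γ r)]
        at this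
      simpa using this

end UpperGradient

/-! ### Couplings and the Wasserstein pseudometric -/

section Coupling

variable {M : Type*} [MeasurableSpace M]

lemma IsCoupling.isProbabilityMeasure {π : Measure (M × M)} {ν₀ ν₁ : Measure M}
    [IsProbabilityMeasure ν₀] (h : IsCoupling π ν₀ ν₁) : IsProbabilityMeasure π := by
  refine ⟨?_⟩
  have : π.map Prod.fst univ = 1 := by rw [h.1]; exact measure_univ
  rwa [Measure.map_apply measurable_fst MeasurableSet.univ, preimage_univ] at this

lemma IsCoupling.lintegral_fst {π : Measure (M × M)} {ν₀ ν₁ : Measure M} (h : IsCoupling π ν₀ ν₁)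
    {f : M → ℝ≥0∞} (hf : Measurable f) : ∫⁻ z, f z.1 ∂π = ∫⁻ x, f x ∂ν₀ := by
  rw [← h.1, lintegral_map hf measurable_fst]

lemma IsCoupling.lintegral_snd {π : Measure (M × M)} {ν₀ ν₁ : Measure M} (h : IsCoupling π ν₀ ν₁)
    {f : M → ℝ≥0∞} (hf : Measurable f) : ∫⁻ z, f z.2 ∂π = ∫⁻ x, f x ∂ν₁ := by
  rw [← h.2, lintegral_map hf measurable_snd]

lemma IsCoupling.swap {π : Measure (M × M)} {ν₀ ν₁ : Measure M} (h : IsCoupling π ν₀ ν₁) :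
    IsCoupling (π.map Prod.swap) ν₁ ν₀ := by
  constructor
  · rw [Measure.map_map measurable_fst measurable_swap]; exact h.2
  · rw [Measure.map_map measurable_snd measurable_swap]; exact h.1

variable [MetricSpace M]

instance {p : ℝ} (ν : WassersteinSpace p M) : IsProbabilityMeasure ν.toMeasure :=
  inferInstanceAs (IsProbabilityMeasure (ν.1 : Measure M))

lemma wDist_le_of_isCoupling {p : ℝ} (hp : 0 < p) {ν₀ ν₁ : WassersteinSpace p M}
    {π : Measure (M × M)} (h : IsCoupling π ν₀.toMeasure ν₁.toMeasure) :
    wDist p ν₀ ν₁ ≤ transportCost p π ^ (1 / p) :=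
  ENNReal.rpow_le_rpow (iInf₂_le π h) (by positivity)

lemma exists_isCoupling_of_wDist_lt {p : ℝ} (hp : 0 < p) {ν₀ ν₁ : WassersteinSpace p M}
    {r : ℝ≥0∞} (h : wDist p ν₀ ν₁ < r) :
    ∃ π, IsCoupling π ν₀.toMeasure ν₁.toMeasure ∧ transportCost p π < r ^ p := by
  have h1 : (wDist p ν₀ ν₁) ^ p < r ^ p := ENNReal.rpow_lt_rpow h hp
  rw [wDist, ← ENNReal.rpow_mul, one_div_mul_cancel hp.ne', ENNReal.rpow_one] at h1
  simpa [iInf_lt_iff] using h1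

lemma WassersteinSpace.nonempty {p : ℝ} (ν : WassersteinSpace p M) : Nonempty M :=
  ⟨ν.2.choose⟩

variable [ProperSpace M] [BorelSpace M]

lemma measurable_edist_rpow (p : ℝ) : Measurable fun z : M × M => edist z.1 z.2 ^ p :=
  (measurable_fst.edist measurable_snd).pow_const p

lemma wDist_self {p : ℝ} (hp : 0 < p) (ν : WassersteinSpace p M) : wDist p ν ν = 0 := by
  have hdiag : Measurable fun x : M => (x, x) := measurable_id.prodMk measurable_id
  have hc : IsCoupling (ν.toMeasure.map fun x => (x, x)) ν.toMeasure ν.toMeasure := by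
    constructor
    · rw [Measure.map_map measurable_fst hdiag]; exact Measure.map_id
    · rw [Measure.map_map measurable_snd hdiag]; exact Measure.map_id
  refine le_antisymm ((wDist_le_of_isCoupling hp hc).trans ?_) zero_le
  rw [transportCost, lintegral_map (measurable_edist_rpow p) hdiag]
  simp [hp]

lemma transportCost_swap (p : ℝ) (π : Measure (M × M)) :
    transportCost p (π.map Prod.swap) = transportCost p π := by
  rw [transportCost, transportCost, lintegral_map (measurable_edist_rpow p) measurable_swap]
  simp [edist_comm]

lemma wDist_comm (p : ℝ) (ν₀ ν₁ : WassersteinSpace p M) : wDist p ν₀ ν₁ = wDist p ν₁ ν₀ := by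
  have key : ∀ ν₀ ν₁ : WassersteinSpace p M,
      (⨅ (π : Measure (M × M)) (_ : IsCoupling π ν₀.toMeasure ν₁.toMeasure), transportCost p π) ≤
      ⨅ (π : Measure (M × M)) (_ : IsCoupling π ν₁.toMeasure ν₀.toMeasure), transportCost p π :=
    fun ν₀ ν₁ => le_iInf₂ fun π hπ =>
      (iInf₂_le (π.map Prod.swap) hπ.swap).trans_eq (transportCost_swap p π)
  rw [wDist, wDist, le_antisymm (key ν₀ ν₁) (key ν₁ ν₀)]

lemma lintegral_edist_rpow_ne_top {p : ℝ} (hp : 1 ≤ p) (ν : WassersteinSpace p M) (x : M) :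
    ∫⁻ y, edist y x ^ p ∂ν.toMeasure ≠ ⊤ := by
  obtain ⟨x₀, hx₀⟩ := ν.2
  have hle : ∀ y, edist y x ^ p ≤ 2 ^ (p - 1) * (edist y x₀ ^ p + edist x₀ x ^ p) := fun y =>
    (ENNReal.rpow_le_rpow (edist_triangle y x₀ x) (by linarith)).trans
      (ENNReal.rpow_add_le_mul_rpow_add_rpow _ _ hp)
  refine ne_top_of_le_ne_top ?_ (lintegral_mono hle)
  have hm : Measurable fun y : M => edist y x₀ ^ p :=
    (measurable_id.edist measurable_const).pow_const p
  rw [lintegral_const_mul _ (hm.add_const _), lintegral_add_left hm, lintegral_const, measure_univ,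
    mul_one]
  refine ENNReal.mul_ne_top (ENNReal.rpow_ne_top_of_nonneg (by linarith) (by simp))
    (ENNReal.add_ne_top.2 ⟨hx₀, ENNReal.rpow_ne_top_of_nonneg (by linarith) (edist_ne_top _ _)⟩)

lemma wDist_ne_top {p : ℝ} (hp : 1 ≤ p) (ν₀ ν₁ : WassersteinSpace p M) : wDist p ν₀ ν₁ ≠ ⊤ := by
  have hp0 : 0 < p := by linarith
  have hc : IsCoupling (ν₀.toMeasure.prod ν₁.toMeasure) ν₀.toMeasure ν₁.toMeasure :=
    ⟨by simp, by simp⟩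
  refine ne_top_of_le_ne_top (ENNReal.rpow_ne_top_of_nonneg (by positivity) ?_)
    (wDist_le_of_isCoupling hp0 hc)
  obtain ⟨x, hx⟩ := ν₁.2
  refine ENNReal.mul_ne_top ENNReal.ofReal_ne_top ?_
  have hle : ∀ z : M × M, edist z.1 z.2 ^ p ≤ 2 ^ (p - 1) * (edist z.1 x ^ p + edist z.2 x ^ p) :=
    fun z => (ENNReal.rpow_le_rpow (edist_triangle_right z.1 z.2 x) (by linarith)).trans
      (ENNReal.rpow_add_le_mul_rpow_add_rpow _ _ hp)
  refine ne_top_of_le_ne_top ?_ (lintegral_mono hle)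
  have hm : Measurable fun y : M => edist y x ^ p :=
    (measurable_id.edist measurable_const).pow_const p
  have hm₁ : Measurable fun z : M × M => edist z.1 x ^ p := hm.comp measurable_fst
  have hm₂ : Measurable fun z : M × M => edist z.2 x ^ p := hm.comp measurable_snd
  have hm₁₂ : Measurable fun z : M × M => edist z.1 x ^ p + edist z.2 x ^ p := hm₁.add hm₂
  rw [lintegral_const_mul _ hm₁₂, lintegral_add_left hm₁, hc.lintegral_fst hm, hc.lintegral_snd hm]
  exact ENNReal.mul_ne_top (ENNReal.rpow_ne_top_of_nonneg (by linarith) (by simp))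
    (ENNReal.add_ne_top.2 ⟨lintegral_edist_rpow_ne_top hp ν₀ x,
      lintegral_edist_rpow_ne_top hp ν₁ x⟩)

/-- Two couplings with a common marginal can be glued along it. -/
lemma exists_gluing [Nonempty M] {π₁ π₂ : Measure (M × M)} {ν₀ ν₁ ν₂ : Measure M}
    [IsProbabilityMeasure ν₀] [IsProbabilityMeasure ν₁]
    (h₁ : IsCoupling π₁ ν₀ ν₁) (h₂ : IsCoupling π₂ ν₁ ν₂) :
    ∃ G : Measure (M × M × M), G.map (fun g => (g.2.1, g.1)) = π₁ ∧
      G.map (fun g => (g.1, g.2.2)) = π₂ := by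
  have := h₁.isProbabilityMeasure
  have := h₂.isProbabilityMeasure
  set π₁' := π₁.map Prod.swap with hπ₁'
  have hs := h₁.swap
  have := hs.isProbabilityMeasure
  have hfst₁ : π₁'.fst = ν₁ := hs.1
  have hfst₂ : π₂.fst = ν₁ := h₂.1
  have e₁ : ν₁.compProd π₁'.condKernel = π₁' := by
    rw [← hfst₁]; exact π₁'.disintegrate π₁'.condKernel
  have e₂ : ν₁.compProd π₂.condKernel = π₂ := by
    rw [← hfst₂]; exact π₂.disintegrate π₂.condKernel
  -- Given the common point, the other two are drawn independently from the two disintegrations. The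
  -- coordinates are ordered as common point, `ν₀` point, `ν₂` point.
  refine ⟨ν₁.compProd (ProbabilityTheory.Kernel.prod π₁'.condKernel π₂.condKernel), ?_, ?_⟩
  · have : (ν₁.compProd (ProbabilityTheory.Kernel.prod π₁'.condKernel π₂.condKernel)).map
        (fun g => (g.1, g.2.1)) = π₁' := by
      conv_rhs => rw [← e₁]
      refine Measure.ext_of_lintegral _ fun f hf => ?_
      rw [lintegral_map hf (by fun_prop), Measure.lintegral_compProd (by fun_prop),
        Measure.lintegral_compProd hf]
      refine lintegral_congr fun y => ?_
      rw [ProbabilityTheory.Kernel.prod_apply, lintegral_prod _ (by fun_prop)]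
      simp
    have h2 := congrArg (Measure.map Prod.swap) this
    have h3 : π₁'.map Prod.swap = π₁ := by
      rw [hπ₁', Measure.map_map measurable_swap measurable_swap]; simp
    rwa [Measure.map_map measurable_swap (by fun_prop), h3] at h2
  · conv_rhs => rw [← e₂]
    refine Measure.ext_of_lintegral _ fun f hf => ?_
    rw [lintegral_map hf (by fun_prop), Measure.lintegral_compProd (by fun_prop),
      Measure.lintegral_compProd hf]
    refine lintegral_congr fun y => ?_
    rw [ProbabilityTheory.Kernel.prod_apply, lintegral_prod _ (by fun_prop)]
    simp

/-- Glue two almost optimal couplings and apply Minkowski's inequality under the glued measure;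
existence of optimal couplings is not needed. -/
lemma wDist_triangle {p : ℝ} (hp : 1 ≤ p) (ν₀ ν₁ ν₂ : WassersteinSpace p M) :
    wDist p ν₀ ν₂ ≤ wDist p ν₀ ν₁ + wDist p ν₁ ν₂ := by
  have hp0 : 0 < p := by linarith
  have := ν₀.nonempty
  refine ENNReal.le_of_forall_pos_le_add fun ε hε _ => ?_
  have hε2 : (ε / 2 : ℝ≥0∞) ≠ 0 := by simpa using hε.ne'
  obtain ⟨π₁, hπ₁, hc₁⟩ := exists_isCoupling_of_wDist_lt hp0
    (ENNReal.lt_add_right (wDist_ne_top hp ν₀ ν₁) hε2)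
  obtain ⟨π₂, hπ₂, hc₂⟩ := exists_isCoupling_of_wDist_lt hp0
    (ENNReal.lt_add_right (wDist_ne_top hp ν₁ ν₂) hε2)
  obtain ⟨G, hG₁, hG₂⟩ := exists_gluing hπ₁ hπ₂
  have m₁ : Measurable fun g : M × M × M => (g.2.1, g.1) := by fun_prop
  have m₂ : Measurable fun g : M × M × M => (g.1, g.2.2) := by fun_prop
  have m₃ : Measurable fun g : M × M × M => (g.2.1, g.2.2) := by fun_prop
  have hc : IsCoupling (G.map fun g => (g.2.1, g.2.2)) ν₀.toMeasure ν₂.toMeasure := by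
    constructor
    · rw [Measure.map_map measurable_fst m₃, ← hπ₁.1, ← hG₁, Measure.map_map measurable_fst m₁]
      rfl
    · rw [Measure.map_map measurable_snd m₃, ← hπ₂.2, ← hG₂, Measure.map_map measurable_snd m₂]
      rfl
  refine (wDist_le_of_isCoupling hp0 hc).trans ?_
  have hroot : ∀ (π : Measure (M × M)) (r : ℝ≥0∞), transportCost p π < r ^ p →
      transportCost p π ^ (1 / p) ≤ r := by
    intro π r h
    calc transportCost p π ^ (1 / p) ≤ (r ^ p) ^ (1 / p) :=
          ENNReal.rpow_le_rpow h.le (by positivity)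
      _ = r := by rw [← ENNReal.rpow_mul, mul_one_div_cancel hp0.ne', ENNReal.rpow_one]
  calc transportCost p (G.map fun g => (g.2.1, g.2.2)) ^ (1 / p)
      ≤ transportCost p π₁ ^ (1 / p) + transportCost p π₂ ^ (1 / p) := by
        rw [← hG₁, ← hG₂]
        simp only [transportCost]
        rw [lintegral_map (measurable_edist_rpow p) m₁, lintegral_map (measurable_edist_rpow p) m₂,
          lintegral_map (measurable_edist_rpow p) m₃]
        simp only [ENNReal.mul_rpow_of_nonneg _ _ (one_div_nonneg.2 hp0.le)]
        rw [← mul_add]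
        gcongr
        refine le_trans ?_ (ENNReal.lintegral_Lp_add_le
          (m₁.fst.edist m₁.snd).aemeasurable (m₂.fst.edist m₂.snd).aemeasurable hp)
        gcongr with g
        exact edist_triangle _ _ _
    _ ≤ (wDist p ν₀ ν₁ + ε / 2) + (wDist p ν₁ ν₂ + ε / 2) :=
        add_le_add (hroot _ _ hc₁) (hroot _ _ hc₂)
    _ = _ := by rw [add_add_add_comm, ENNReal.add_halves]

/-- The Wasserstein distance as a pseudometric. -/
@[reducible] noncomputable def wassersteinPseudoMetric {p : ℝ} (hp : 1 ≤ p) :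
    PseudoMetricSpace (WassersteinSpace p M) :=
  letI : PseudoEMetricSpace (WassersteinSpace p M) :=
    { edist := wDist p
      edist_self := wDist_self (by linarith)
      edist_comm := wDist_comm p
      edist_triangle := wDist_triangle hp }
  PseudoEMetricSpace.toPseudoMetricSpace (wDist_ne_top hp)

end Coupling

/-! ### Neighbourhoods expressed through the distance -/

lemma comap_edist_nhds_zero {X : Type*} [PseudoMetricSpace X] (x : X) :
    comap (edist x) (𝓝 0) = 𝓝 x := by
  refine (ENNReal.nhds_zero_basis.comap (edist x)).eq_of_same_basis ?_
  convert Metric.nhds_basis_eball (x := x) using 2 with ε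
  ext y
  simp [edist_comm]

lemma isLSC_of_lowerSemicontinuous {X : Type*} [PseudoMetricSpace X] {g : X → ℝ≥0∞}
    (hg : LowerSemicontinuous g) : IsLSC edist g := by
  intro x c hc
  rw [comap_edist_nhds_zero]
  exact hg x c hc

/-! ### The weight governing `p`-growth -/

section MomentWeight

variable {M : Type*} [MetricSpace M]

/-- The weight `(1 + d(x, x₀))^p`. -/
noncomputable def momentWeight (p : ℝ) (x₀ x : M) : ℝ := (1 + dist x x₀) ^ p

lemma continuous_momentWeight (p : ℝ) (x₀ : M) : Continuous (momentWeight p x₀) :=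
  (continuous_const.add (continuous_id.dist continuous_const)).rpow_const fun _ =>
    Or.inl ((add_pos_of_pos_of_nonneg one_pos dist_nonneg).ne')

lemma one_le_momentWeight {p : ℝ} (hp : 0 ≤ p) (x₀ x : M) : 1 ≤ momentWeight p x₀ x :=
  Real.one_le_rpow (by linarith [dist_nonneg (x := x) (y := x₀)]) hp

lemma ofReal_momentWeight {p : ℝ} (hp : 0 ≤ p) (x₀ x : M) :
    ENNReal.ofReal (momentWeight p x₀ x) = (1 + edist x x₀) ^ p := by
  have := dist_nonneg (x := x) (y := x₀)
  rw [momentWeight, ← ENNReal.ofReal_rpow_of_nonneg (by positivity) hp,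
    ENNReal.ofReal_add zero_le_one this, ENNReal.ofReal_one, edist_dist]

end MomentWeight

/-! ### Wasserstein convergence and affine minorants -/

section Convergence

variable {M : Type*} [MeasurableSpace M] [MetricSpace M]

lemma lintegral_edist_rpow_eq {p : ℝ} (hp : 0 < p) (π : Measure (M × M)) :
    ∫⁻ z, edist z.1 z.2 ^ p ∂π = ENNReal.ofReal p * transportCost p π := by
  rw [transportCost, ← mul_assoc, ← ENNReal.ofReal_mul hp.le, mul_one_div_cancel hp.ne',
    ENNReal.ofReal_one, one_mul]

variable [ProperSpace M] [BorelSpace M]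

/-- Convergence in the Wasserstein distance is realized by couplings with vanishing cost. -/
lemma exists_couplings_tendsto {p : ℝ} (hp : 1 ≤ p) {ν : WassersteinSpace p M}
    {νs : ℕ → WassersteinSpace p M} (h : Tendsto (fun n => wDist p ν (νs n)) atTop (𝓝 0)) :
    ∃ π : ℕ → Measure (M × M), (∀ n, IsCoupling (π n) ν.toMeasure (νs n).toMeasure) ∧
      Tendsto (fun n => ∫⁻ z, edist z.1 z.2 ^ p ∂(π n)) atTop (𝓝 0) := by
  have hp0 : 0 < p := by linarith
  have hlt : ∀ n, wDist p ν (νs n) < wDist p ν (νs n) + ((n : ℝ≥0∞) + 1)⁻¹ := fun n =>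
    ENNReal.lt_add_right (wDist_ne_top hp _ _) (by simp)
  choose π hπ hcost using fun n => exists_isCoupling_of_wDist_lt hp0 (hlt n)
  refine ⟨π, hπ, ?_⟩
  have hinv : Tendsto (fun n : ℕ => ((n : ℝ≥0∞) + 1)⁻¹) atTop (𝓝 0) := by
    have := (tendsto_add_atTop_iff_nat 1).2 ENNReal.tendsto_inv_nat_nhds_zero
    simpa using this
  have hlim : Tendsto (fun n => ENNReal.ofReal p *
      (wDist p ν (νs n) + ((n : ℝ≥0∞) + 1)⁻¹) ^ p) atTop (𝓝 0) := by
    have h1 := (h.add hinv).ennrpow_const p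
    have h2 := ENNReal.Tendsto.const_mul h1 (Or.inr (ENNReal.ofReal_ne_top (r := p)))
    simpa [hp0] using h2
  refine tendsto_of_tendsto_of_tendsto_of_le_of_le tendsto_const_nhds hlim (fun _ => zero_le) ?_
  intro n
  simp only [lintegral_edist_rpow_eq hp0]
  gcongr
  exact (hcost n).le

/-- Mass at depth at least `δ` inside `G` leaves `G` only by travelling at least `δ`, and Markov's
inequality bounds such mass by cost over `δ ^ p`. The sets of positive depth exhaust `G`. -/
lemma measure_le_liminf_of_couplings {p : ℝ} (hp : 1 ≤ p) {ν : Measure M} {νs : ℕ → Measure M}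
    {π : ℕ → Measure (M × M)} (hπ : ∀ n, IsCoupling (π n) ν (νs n))
    (h : Tendsto (fun n => ∫⁻ z, edist z.1 z.2 ^ p ∂(π n)) atTop (𝓝 0)) {G : Set M}
    (hG : IsOpen G) : ν G ≤ liminf (fun n => νs n G) atTop := by
  have hp0 : 0 < p := by linarith
  set A : ℕ → Set M := fun k => {x | ((k : ℝ≥0∞) + 1)⁻¹ ≤ Metric.infEDist x Gᶜ} with hA
  have hAmeas : ∀ k, MeasurableSet (A k) := fun k =>
    measurableSet_le measurable_const Metric.continuous_infEDist.measurable
  have hAmono : Monotone A := fun k l hkl x hx => by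
    refine le_trans (ENNReal.inv_le_inv.2 ?_) hx
    gcongr
  have hAU : ⋃ k, A k = G := by
    ext x
    simp only [mem_iUnion, hA, mem_ofPred_eq]
    constructor
    · rintro ⟨k, hk⟩
      by_contra hx
      rw [Metric.infEDist_zero_of_mem (mem_compl hx)] at hk
      simp at hk
    · intro hx
      have hpos : 0 < Metric.infEDist x Gᶜ := by
        rw [Metric.infEDist_pos_iff_notMem_closure, hG.isClosed_compl.closure_eq]
        simpa using hx
      obtain ⟨k, hk⟩ := ENNReal.exists_inv_nat_lt hpos.ne'
      refine ⟨k, le_trans (ENNReal.inv_le_inv.2 ?_) hk.le⟩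
      exact le_self_add
  have key : ∀ k, ν (A k) ≤ liminf (fun n => νs n G) atTop := by
    intro k
    set δ : ℝ≥0∞ := ((k : ℝ≥0∞) + 1)⁻¹ with hδ
    have hδ0 : δ ^ p ≠ 0 := by
      rw [Ne, ENNReal.rpow_eq_zero_iff_of_pos hp0, hδ]; simp
    have hδt : δ ^ p ≠ ⊤ := ENNReal.rpow_ne_top_of_nonneg hp0.le (by rw [hδ]; simp)
    have hle : ∀ n, ν (A k) - (∫⁻ z, edist z.1 z.2 ^ p ∂(π n)) / δ ^ p ≤ νs n G := by
      intro n
      rw [tsub_le_iff_right]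
      have hsub : Prod.fst ⁻¹' A k ⊆ (Prod.snd ⁻¹' G : Set (M × M)) ∪
          {z | δ ^ p ≤ edist z.1 z.2 ^ p} := by
        rintro ⟨x, y⟩ hx
        by_cases hy : y ∈ G
        · exact Or.inl hy
        · refine Or.inr (ENNReal.rpow_le_rpow (le_trans hx ?_) hp0.le)
          exact Metric.infEDist_le_edist_of_mem hy
      calc ν (A k) = π n (Prod.fst ⁻¹' A k) := by
            rw [← (hπ n).1, Measure.map_apply measurable_fst (hAmeas k)]
        _ ≤ π n (Prod.snd ⁻¹' G) + π n {z | δ ^ p ≤ edist z.1 z.2 ^ p} :=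
            (measure_mono hsub).trans (measure_union_le _ _)
        _ ≤ νs n G + (∫⁻ z, edist z.1 z.2 ^ p ∂(π n)) / δ ^ p := by
            gcongr
            · rw [← (hπ n).2, Measure.map_apply measurable_snd hG.measurableSet]
            · exact meas_ge_le_lintegral_div (measurable_edist_rpow p).aemeasurable hδ0 hδt
    have hlim : Tendsto (fun n => ν (A k) - (∫⁻ z, edist z.1 z.2 ^ p ∂(π n)) / δ ^ p) atTop
        (𝓝 (ν (A k))) := by
      have h1 : Tendsto (fun n => (∫⁻ z, edist z.1 z.2 ^ p ∂(π n)) / δ ^ p) atTop (𝓝 0) := by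
        have := ENNReal.Tendsto.div_const h (Or.inr hδ0)
        simpa using this
      have := ENNReal.Tendsto.sub (tendsto_const_nhds (x := ν (A k)) (f := atTop)) h1
        (Or.inr ENNReal.zero_ne_top)
      simpa using this
    rw [← hlim.liminf_eq]
    exact liminf_le_liminf (Eventually.of_forall hle)
  rw [← hAU, hAmono.measure_iUnion, hAU]
  exact iSup_le key

lemma integrable_momentWeight {p : ℝ} (hp : 1 ≤ p) (ν : WassersteinSpace p M) (x₀ : M) :
    Integrable (momentWeight p x₀) ν.toMeasure := by
  refine ⟨(continuous_momentWeight p x₀).aestronglyMeasurable, ?_⟩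
  rw [hasFiniteIntegral_iff_ofReal (Eventually.of_forall fun x =>
    (zero_le_one.trans (one_le_momentWeight (by linarith) x₀ x)))]
  simp only [ofReal_momentWeight (show 0 ≤ p by linarith)]
  refine lt_of_le_of_lt (lintegral_mono fun x => ENNReal.rpow_add_le_mul_rpow_add_rpow _ _ hp) ?_
  have hm : Measurable fun y : M => edist y x₀ ^ p :=
    (measurable_id.edist measurable_const).pow_const p
  rw [lintegral_const_mul _ (hm.const_add _), lintegral_add_left measurable_const]
  simp only [lintegral_const, measure_univ]
  refine ENNReal.mul_lt_top (ENNReal.rpow_lt_top_of_nonneg (by linarith) (by simp))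
    (ENNReal.add_lt_top.2 ⟨by simp, (lintegral_edist_rpow_ne_top hp ν x₀).lt_top⟩)

/-- Integration of a continuous function of `p`-growth is lower semicontinuous. -/
lemma lowerSemicontinuous_integral {p : ℝ} (hp : 1 ≤ p) {x₀ : M} {ψ : M → ℝ} (hψ : Continuous ψ)
    {C : ℝ} (hC : ∀ x, |ψ x| ≤ C * momentWeight p x₀ x) :
    letI := wassersteinPseudoMetric (M := M) hp
    LowerSemicontinuous fun ν : WassersteinSpace p M => ∫ x, ψ x ∂ν.toMeasure := by
  let := wassersteinPseudoMetric (M := M) hp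
  intro ν c hc
  by_contra hcon
  obtain ⟨νs, hνs, hle⟩ := exists_seq_forall_of_frequently (not_eventually.1 hcon)
  have hp0 : 0 < p := by linarith
  have hdist : Tendsto (fun n => wDist p ν (νs n)) atTop (𝓝 0) := by
    have := (tendsto_iff_edist_tendsto_0.1 hνs)
    refine this.congr fun n => ?_
    exact wDist_comm p _ _
  obtain ⟨π, hπ, hcost⟩ := exists_couplings_tendsto hp hdist
  set w := momentWeight p x₀ with hw
  have hwc : Continuous w := continuous_momentWeight p x₀
  have hw1 : ∀ x, 1 ≤ w x := one_le_momentWeight hp0.le x₀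
  have hC0 : 0 ≤ C := by
    have := (abs_nonneg _).trans (hC x₀)
    nlinarith [hw1 x₀]
  have hwint : ∀ ν' : WassersteinSpace p M, Integrable w ν'.toMeasure := fun ν' =>
    integrable_momentWeight hp ν' x₀
  have hψint : ∀ ν' : WassersteinSpace p M, Integrable ψ ν'.toMeasure := fun ν' =>
    ((hwint ν').const_mul C).mono' hψ.aestronglyMeasurable (Eventually.of_forall hC)
  -- Adding `(C + 1) w` makes the function positive, so the liminf inequality for open sets applies.
  -- The added term is removed at the end by an upper bound on the weighted moments.
  set f : M → ℝ := fun x => ψ x + (C + 1) * w x with hf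
  have hfw : ∀ x, w x ≤ f x := fun x => by
    have := neg_abs_le (ψ x); simp only [hf]; linarith [hC x]
  have hf0 : 0 ≤ f := fun x => (zero_le_one.trans (hw1 x)).trans (hfw x)
  have hfc : Continuous f := hψ.add (continuous_const.mul hwc)
  have hfint : ∀ ν' : WassersteinSpace p M, ∫ x, f x ∂ν'.toMeasure =
      ∫ x, ψ x ∂ν'.toMeasure + (C + 1) * ∫ x, w x ∂ν'.toMeasure := fun ν' => by
    rw [integral_add (hψint ν') ((hwint ν').const_mul _), integral_const_mul]
  have hfI : ∀ ν' : WassersteinSpace p M, Integrable f ν'.toMeasure := fun ν' =>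
    (hψint ν').add ((hwint ν').const_mul _)
  have hlsc := lintegral_le_liminf_lintegral_of_forall_isOpen_measure_le_liminf_measure hfc hf0
    (fun G hG => measure_le_liminf_of_couplings hp hπ hcost hG)
  set W : WassersteinSpace p M → ℝ≥0∞ := fun ν' => ∫⁻ x, (1 + edist x x₀) ^ p ∂ν'.toMeasure
  have hWint : ∀ ν', ∫ x, w x ∂ν'.toMeasure = (W ν').toReal := fun ν' => by
    rw [integral_eq_lintegral_of_nonneg_ae
      (Eventually.of_forall fun x => zero_le_one.trans (hw1 x)) hwc.aestronglyMeasurable]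
    simp only [hw, ofReal_momentWeight hp0.le, W]
  have hWtop : ∀ ν', W ν' ≠ ⊤ := fun ν' => by
    have := (hasFiniteIntegral_iff_ofReal (Eventually.of_forall fun x =>
      zero_le_one.trans (hw1 x))).1 (hwint ν').2
    simp only [hw, ofReal_momentWeight hp0.le] at this
    exact this.ne
  have hm : Measurable fun x : M => 1 + edist x x₀ :=
    (measurable_id.edist measurable_const).const_add _
  set e : ℕ → ℝ≥0∞ := fun n => ∫⁻ z, edist z.1 z.2 ^ p ∂(π n)
  -- Minkowski's inequality for the couplings: the weighted moment of `νs n` exceeds that of `ν`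
  -- asymptotically by nothing.
  have hWle : ∀ n, W (νs n) ≤ (W ν ^ (1 / p) + e n ^ (1 / p)) ^ p := by
    intro n
    have h1 : W (νs n) ^ (1 / p) ≤ W ν ^ (1 / p) + e n ^ (1 / p) := by
      simp only [W, e]
      rw [← (hπ n).lintegral_fst (hm.pow_const p), ← (hπ n).lintegral_snd (hm.pow_const p)]
      refine le_trans ?_ (ENNReal.lintegral_Lp_add_le (hm.comp measurable_fst).aemeasurable
        (measurable_fst.edist measurable_snd).aemeasurable hp)
      gcongr with z
      simp only [Pi.add_apply]
      rw [add_assoc]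
      gcongr
      rw [add_comm]
      exact edist_triangle_left _ _ _ |>.trans_eq (by rw [edist_comm z.1 z.2, edist_comm z.2 z.1])
    calc W (νs n) = (W (νs n) ^ (1 / p)) ^ p := by
          rw [← ENNReal.rpow_mul, one_div_mul_cancel hp0.ne', ENNReal.rpow_one]
      _ ≤ _ := ENNReal.rpow_le_rpow h1 hp0.le
  have hWlim : Tendsto (fun n => (W ν ^ (1 / p) + e n ^ (1 / p)) ^ p) atTop (𝓝 (W ν)) := by
    have h1 := ((tendsto_const_nhds (x := W ν ^ (1 / p))).add
      (hcost.ennrpow_const (1 / p))).ennrpow_const p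
    rw [ENNReal.zero_rpow_of_pos (by positivity), add_zero, ← ENNReal.rpow_mul,
      one_div_mul_cancel hp0.ne', ENNReal.rpow_one] at h1
    exact h1
  have hbound : ∀ᶠ n in atTop, ∫⁻ x, ENNReal.ofReal (f x) ∂(νs n).toMeasure ≤
      ENNReal.ofReal (c + (C + 1) * ((W ν ^ (1 / p) + e n ^ (1 / p)) ^ p).toReal) := by
    filter_upwards [hWlim.eventually_ne (hWtop ν)] with n hn
    rw [← ofReal_integral_eq_lintegral_ofReal (hfI _) (Eventually.of_forall hf0), hfint, hWint]
    refine ENNReal.ofReal_le_ofReal ?_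
    have h1 : ∫ x, ψ x ∂(νs n).toMeasure ≤ c := not_lt.1 (hle n)
    have h2 := ENNReal.toReal_mono hn (hWle n)
    nlinarith
  have hlim : Tendsto (fun n => ENNReal.ofReal
      (c + (C + 1) * ((W ν ^ (1 / p) + e n ^ (1 / p)) ^ p).toReal)) atTop
      (𝓝 (ENNReal.ofReal (c + (C + 1) * (W ν).toReal))) :=
    ENNReal.tendsto_ofReal (tendsto_const_nhds.add (tendsto_const_nhds.mul
      ((ENNReal.tendsto_toReal (hWtop ν)).comp hWlim)))
  have hfinal := hlsc.trans ((liminf_le_liminf hbound).trans_eq hlim.liminf_eq)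
  rw [← ofReal_integral_eq_lintegral_ofReal (hfI _) (Eventually.of_forall hf0), hfint, hWint]
    at hfinal
  -- Excludes the case in which `ENNReal.ofReal` truncates the left side to zero.
  have hpos : 0 < ∫ x, ψ x ∂ν.toMeasure + (C + 1) * (W ν).toReal := by
    rw [← hWint, ← hfint]
    have : ∫ _, (1 : ℝ) ∂ν.toMeasure ≤ ∫ x, f x ∂ν.toMeasure :=
      integral_mono (integrable_const _) (hfI ν) fun x => (hw1 x).trans (hfw x)
    simp at this
    linarith
  rw [ENNReal.ofReal_le_ofReal_iff'] at hfinal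
  rcases hfinal with h | h <;> linarith

/-- A functional with sufficiently many minorants of the form `ν ↦ ∫ ψ dν + b` is lower
semicontinuous. -/
lemma lowerSemicontinuous_of_affine_minorants {p : ℝ} (hp : 1 ≤ p)
    {E : WassersteinSpace p M → EReal}
    (h : ∀ ν, ∀ r : ℝ, (r : EReal) < E ν → ∃ (x₀ : M) (ψ : M → ℝ) (C b : ℝ), Continuous ψ ∧
      (∀ x, |ψ x| ≤ C * momentWeight p x₀ x) ∧ r < ∫ x, ψ x ∂ν.toMeasure + b ∧
      ∀ ν' : WassersteinSpace p M, ((∫ x, ψ x ∂ν'.toMeasure + b : ℝ) : EReal) ≤ E ν') :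
    letI := wassersteinPseudoMetric (M := M) hp
    LowerSemicontinuous E := by
  let := wassersteinPseudoMetric (M := M) hp
  intro ν c hc
  obtain ⟨r, hcr, hr⟩ := EReal.lt_iff_exists_real_btwn.1 hc
  obtain ⟨x₀, ψ, C, b, hψ, hC, hlt, hle⟩ := h ν r hr
  have hev := lowerSemicontinuous_integral hp hψ hC ν (r - b) (by linarith)
  filter_upwards [hev] with ν' hν'
  have hν'' : r - b < ∫ x, ψ x ∂ν'.toMeasure := hν'
  refine hcr.trans_le (le_trans ?_ (hle ν'))
  exact_mod_cast (by linarith : r ≤ ∫ x, ψ x ∂ν'.toMeasure + b)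

/-- Weighted approximation of a bounded measurable function by continuous ones. -/
lemma exists_continuous_tendsto_integral {ν μ : Measure M} {k : M → ℝ} (hk : Continuous k)
    (hk0 : 0 ≤ k) {q : ℝ} (hkν : Integrable k ν) (hkμ : Integrable (fun x => k x ^ q) μ)
    {α β B : ℝ} (hα : 0 ≤ α) (hcont : ContinuousOn (fun t : ℝ => t ^ q) (Icc α β))
    (hB : ∀ t ∈ Icc α β, t ^ q ≤ B) {φ : M → ℝ} (hφ : Measurable φ)
    (hφI : ∀ x, φ x ∈ Icc α β) :
    ∃ φs : ℕ → M → ℝ, (∀ n, Continuous (φs n)) ∧ (∀ n x, φs n x ∈ Icc α β) ∧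
      Tendsto (fun n => ∫ x, k x * φs n x ∂ν) atTop (𝓝 (∫ x, k x * φ x ∂ν)) ∧
      Tendsto (fun n => ∫ x, (k x * φs n x) ^ q ∂μ) atTop (𝓝 (∫ x, (k x * φ x) ^ q ∂μ)) := by
  have hkq0 : ∀ x, 0 ≤ k x ^ q := fun x => Real.rpow_nonneg (hk0 x) q
  have hkm : Measurable k := hk.measurable
  have hkqm : Measurable fun x => k x ^ q := hkm.pow_const q
  -- A single finite measure dominating both weighted measures, so that one approximating sequence
  -- serves both integrals.
  set m := ν.withDensity (fun x => ENNReal.ofReal (k x)) +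
    μ.withDensity (fun x => ENNReal.ofReal (k x ^ q)) with hm
  have f1 : IsFiniteMeasure (ν.withDensity (fun x => ENNReal.ofReal (k x))) :=
    isFiniteMeasure_withDensity_ofReal hkν.2
  have f2 : IsFiniteMeasure (μ.withDensity (fun x => ENNReal.ofReal (k x ^ q))) :=
    isFiniteMeasure_withDensity_ofReal hkμ.2
  have hφint : Integrable φ m := by
    refine Integrable.of_bound hφ.aestronglyMeasurable β (Eventually.of_forall fun x => ?_)
    rw [Real.norm_of_nonneg (hα.trans (hφI x).1)]
    exact (hφI x).2
  choose g hg hgi using fun n : ℕ => hφint.exists_boundedContinuous_lintegral_sub_le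
    (ε := ((n : ℝ≥0∞) + 1)⁻¹) (by simp)
  have hlim : Tendsto (fun n => eLpNorm ((g n : M → ℝ) - φ) 1 m) atTop (𝓝 0) := by
    have hinv : Tendsto (fun n : ℕ => ((n : ℝ≥0∞) + 1)⁻¹) atTop (𝓝 0) := by
      have := (tendsto_add_atTop_iff_nat 1).2 ENNReal.tendsto_inv_nat_nhds_zero
      simpa using this
    refine tendsto_of_tendsto_of_tendsto_of_le_of_le tendsto_const_nhds hinv
      (fun _ => zero_le) fun n => ?_
    rw [eLpNorm_sub_comm]
    simp only
    rw [eLpNorm_one_eq_lintegral_enorm]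
    exact hg n
  obtain ⟨ns, -, hns⟩ := (tendstoInMeasure_of_tendsto_eLpNorm one_ne_zero
    (fun n => (g n).continuous.aestronglyMeasurable) hφ.aestronglyMeasurable
    hlim).exists_seq_tendsto_ae
  -- Clamping to `[α, β]` preserves continuity and the limit, and supplies the bounds for dominated
  -- convergence.
  set φs : ℕ → M → ℝ := fun n x => max α (min β (g (ns n) x)) with hφs
  have hαβ : ∀ x, α ≤ β ∧ max α (min β (φ x)) = φ x := fun x =>
    ⟨(hφI x).1.trans (hφI x).2, by rw [min_eq_right (hφI x).2, max_eq_right (hφI x).1]⟩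
  have hφsc : ∀ n, Continuous (φs n) := fun n =>
    continuous_const.max (continuous_const.min (g (ns n)).continuous)
  have hφsI : ∀ n x, φs n x ∈ Icc α β := fun n x =>
    ⟨le_max_left _ _, max_le (hαβ x).1 (min_le_left _ _)⟩
  have hae : ∀ᵐ x ∂m, Tendsto (fun n => φs n x) atTop (𝓝 (φ x)) := by
    filter_upwards [hns] with x hx
    have : Tendsto (fun n => φs n x) atTop (𝓝 (max α (min β (φ x)))) :=
      tendsto_const_nhds.max (tendsto_const_nhds.min hx)
    rwa [(hαβ x).2] at this
  rw [hm, ae_add_measure_iff, ae_withDensity_iff (by fun_prop), ae_withDensity_iff (by fun_prop)]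
    at hae
  refine ⟨φs, hφsc, hφsI, ?_, ?_⟩
  · refine tendsto_integral_of_dominated_convergence (fun x => k x * β)
      (fun n => (hk.mul (hφsc n)).aestronglyMeasurable) (hkν.mul_const β) ?_ ?_
    · refine fun n => Eventually.of_forall fun x => ?_
      rw [Real.norm_of_nonneg (mul_nonneg (hk0 x) (hα.trans (hφsI n x).1))]
      exact mul_le_mul_of_nonneg_left (hφsI n x).2 (hk0 x)
    · filter_upwards [hae.1] with x hx
      rcases (hk0 x).eq_or_lt with h | h
      · simp only [Pi.zero_apply] at h
        simp [← h]
      · exact tendsto_const_nhds.mul (hx (by simpa using h))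
  · refine tendsto_integral_of_dominated_convergence (fun x => k x ^ q * B)
      (fun n => ((hkm.mul (hφsc n).measurable).pow_const q).aestronglyMeasurable)
      (hkμ.mul_const B) ?_ ?_
    · refine fun n => Eventually.of_forall fun x => ?_
      have h0 := hα.trans (hφsI n x).1
      rw [Real.norm_of_nonneg (Real.rpow_nonneg (mul_nonneg (hk0 x) h0) q),
        Real.mul_rpow (hk0 x) h0]
      exact mul_le_mul_of_nonneg_left (hB _ (hφsI n x)) (hkq0 x)
    · filter_upwards [hae.2] with x hx
      rcases (hk0 x).eq_or_lt with h | h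
      · simp only [Pi.zero_apply] at h
        simp [← h]
      · have hpos : 0 < k x ^ q := Real.rpow_pos_of_pos h q
        have hx' := hx (by simpa using hpos)
        have hlim' : Tendsto (fun n => φs n x ^ q) atTop (𝓝 (φ x ^ q)) :=
          (hcont (φ x) (hφI x)).tendsto.comp (tendsto_nhdsWithin_iff.2
            ⟨hx', Eventually.of_forall fun n => hφsI n x⟩)
        have e1 : ∀ n, (k x * φs n x) ^ q = k x ^ q * φs n x ^ q := fun n =>
          Real.mul_rpow (hk0 x) (hα.trans (hφsI n x).1)
        simp only [e1, Real.mul_rpow (hk0 x) (hα.trans (hφI x).1)]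
        exact tendsto_const_nhds.mul hlim'

end Convergence

/-! ### Extended integrals of differences -/

section ExtIntegral

variable {Ω : Type*} [MeasurableSpace Ω] {μ : Measure Ω}

/-- With `F = A - B`, the identity `F⁺ + B = F⁻ + A` can be integrated without subtraction.
Finiteness of one of the two integrals then permits rearranging it. -/
lemma extIntegral_sub_of_nonneg {A B : Ω → ℝ} (hA : AEMeasurable A μ) (hB : AEMeasurable B μ)
    (hA0 : 0 ≤ A) (hB0 : 0 ≤ B)
    (h : ∫⁻ x, ENNReal.ofReal (A x) ∂μ ≠ ⊤ ∨ ∫⁻ x, ENNReal.ofReal (B x) ∂μ ≠ ⊤) :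
    extIntegral μ (fun x => A x - B x) = ((∫⁻ x, ENNReal.ofReal (A x) ∂μ : ℝ≥0∞) : EReal) -
      ((∫⁻ x, ENNReal.ofReal (B x) ∂μ : ℝ≥0∞) : EReal) := by
  have hsum : ∫⁻ x, ENNReal.ofReal (A x - B x) ∂μ + ∫⁻ x, ENNReal.ofReal (B x) ∂μ =
      ∫⁻ x, ENNReal.ofReal (-(A x - B x)) ∂μ + ∫⁻ x, ENNReal.ofReal (A x) ∂μ := by
    rw [← lintegral_add_right' _ hB.ennreal_ofReal, ← lintegral_add_right' _ hA.ennreal_ofReal]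
    refine lintegral_congr fun x => ?_
    have hAx := hA0 x
    have hBx := hB0 x
    simp only [Pi.zero_apply] at hAx hBx
    rcases le_total (A x) (B x) with hab | hab
    · rw [ENNReal.ofReal_of_nonpos (by linarith), zero_add,
        ← ENNReal.ofReal_add (by linarith) hAx]
      congr 1; ring
    · rw [ENNReal.ofReal_of_nonpos (by linarith : -(A x - B x) ≤ 0), zero_add,
        ← ENNReal.ofReal_add (by linarith) hBx]
      congr 1; ring
  have hPle : ∫⁻ x, ENNReal.ofReal (A x - B x) ∂μ ≤ ∫⁻ x, ENNReal.ofReal (A x) ∂μ :=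
    lintegral_mono fun x => ENNReal.ofReal_le_ofReal (by have := hB0 x; simp at this; linarith)
  have hNle : ∫⁻ x, ENNReal.ofReal (-(A x - B x)) ∂μ ≤ ∫⁻ x, ENNReal.ofReal (B x) ∂μ :=
    lintegral_mono fun x => ENNReal.ofReal_le_ofReal (by have := hA0 x; simp at this; linarith)
  rw [extIntegral]
  generalize ∫⁻ x, ENNReal.ofReal (A x - B x) ∂μ = P at *
  generalize ∫⁻ x, ENNReal.ofReal (-(A x - B x)) ∂μ = N at *
  generalize ∫⁻ x, ENNReal.ofReal (A x) ∂μ = a at *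
  generalize ∫⁻ x, ENNReal.ofReal (B x) ∂μ = b at *
  rcases eq_or_ne a ⊤ with rfl | ha
  · have hb : b ≠ ⊤ := by simpa using h
    have hN : N ≠ ⊤ := ne_top_of_le_ne_top hb hNle
    have hP : P = ⊤ := by
      by_contra hP
      rw [add_top] at hsum
      exact (ENNReal.add_ne_top.2 ⟨hP, hb⟩) hsum
    lift b to NNReal using hb
    lift N to NNReal using hN
    rw [hP]
    simp [EReal.coe_nnreal_eq_coe_real]
  · have hP : P ≠ ⊤ := ne_top_of_le_ne_top ha hPle
    rcases eq_or_ne b ⊤ with rfl | hb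
    · have hN : N = ⊤ := by
        by_contra hN
        rw [add_top] at hsum
        exact (ENNReal.add_ne_top.2 ⟨hN, ha⟩) hsum.symm
      rw [hN]
      simp
    · have hN : N ≠ ⊤ := ne_top_of_le_ne_top hb hNle
      lift a to NNReal using ha
      lift b to NNReal using hb
      lift P to NNReal using hP
      lift N to NNReal using hN
      have hreal : (P : ℝ) + b = N + a := by exact_mod_cast hsum
      simp only [EReal.coe_nnreal_eq_coe_real]
      rw [← EReal.coe_sub, ← EReal.coe_sub]
      congr 1
      linarith

lemma extIntegral_ne_bot_of_le {F : Ω → ℝ}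
    (h : ∫⁻ x, ENNReal.ofReal (-F x) ∂μ ≠ ⊤) : extIntegral μ F ≠ ⊥ := by
  rw [extIntegral]
  generalize ∫⁻ x, ENNReal.ofReal (-F x) ∂μ = N at *
  lift N to NNReal using h
  generalize ∫⁻ x, ENNReal.ofReal (F x) ∂μ = P
  rcases eq_or_ne P ⊤ with rfl | hP
  · simp [EReal.coe_nnreal_eq_coe_real]
  · lift P to NNReal using hP
    simp only [EReal.coe_nnreal_eq_coe_real]
    rw [← EReal.coe_sub]
    exact EReal.coe_ne_bot _

lemma extIntegral_mono {F G : Ω → ℝ} (h : F ≤ᵐ[μ] G) : extIntegral μ F ≤ extIntegral μ G := by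
  refine EReal.sub_le_sub ?_ ?_
  · exact EReal.coe_ennreal_le_coe_ennreal_iff.2
      (lintegral_mono_ae (h.mono fun x hx => ENNReal.ofReal_le_ofReal hx))
  · exact EReal.coe_ennreal_le_coe_ennreal_iff.2
      (lintegral_mono_ae (h.mono fun x hx => ENNReal.ofReal_le_ofReal (neg_le_neg hx)))

end ExtIntegral

/-! ### Growth of `U_p` at infinity -/

section Recession

/-- For `r > 0` the quotient `U_p(r) / r` is a constant times `r^(2-p) - 1`, so the sign of `2 - p`
decides whether singular mass has infinite or finite cost. -/
lemma recession_renyiU_of_lt_two {p : ℝ} (hp : p < 2) : recession (renyiU p) = ⊤ := by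
  have hc : 0 < 1 / ((3 - p) * (2 - p)) := by
    have h1 : 0 < 3 - p := by linarith
    have h2 : 0 < 2 - p := by linarith
    positivity
  have h1 : Tendsto (fun r : ℝ => 1 / ((3 - p) * (2 - p)) * (r ^ (2 - p) + (-1))) atTop atTop :=
    Tendsto.const_mul_atTop hc (tendsto_atTop_add_const_right _ _
      (tendsto_rpow_atTop (by linarith)))
  have h2 : Tendsto (fun r : ℝ => renyiU p r / r) atTop atTop := by
    refine h1.congr' ?_
    filter_upwards [eventually_gt_atTop 0] with r hr
    rw [renyiU, show (3 - p) = (2 - p) + 1 by ring, Real.rpow_add_one hr.ne']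
    field_simp
    ring
  exact (EReal.tendsto_coe_nhds_top_iff.2 h2).limsup_eq

lemma recession_renyiU_of_two_lt {p : ℝ} (hp : 2 < p) :
    recession (renyiU p) = ((1 / ((3 - p) * (p - 2)) : ℝ) : EReal) := by
  have h1 : Tendsto (fun r : ℝ => 1 / ((3 - p) * (2 - p)) * (r ^ (-(p - 2)) + (-1))) atTop
      (𝓝 (1 / ((3 - p) * (2 - p)) * (0 + (-1)))) :=
    ((tendsto_rpow_neg_atTop (by linarith)).add_const _).const_mul _
  have h2 : Tendsto (fun r : ℝ => renyiU p r / r) atTop (𝓝 (1 / ((3 - p) * (p - 2)))) := by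
    have e : 1 / ((3 - p) * (2 - p)) * (0 + (-1)) = 1 / ((3 - p) * (p - 2)) := by
      rw [show (3 - p) * (2 - p) = -((3 - p) * (p - 2)) by ring, one_div, inv_neg]
      ring
    rw [e] at h1
    refine h1.congr' ?_
    filter_upwards [eventually_gt_atTop 0] with r hr
    rw [renyiU, show (3 - p) = -(p - 2) + 1 by ring, Real.rpow_add_one hr.ne']
    field_simp
    ring
  exact ((continuous_coe_real_ereal.tendsto _).comp h2).limsup_eq

end Recession

/-! ### The entropy in terms of the power integral -/

section Energy

variable {M : Type*} [MeasurableSpace M]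

/-- `∫ ρ^(3-p) dμ` for the density `ρ` of the absolutely continuous part of `ν`. -/
noncomputable def powerIntegral (p : ℝ) (μ ν : Measure M) : ℝ≥0∞ :=
  ∫⁻ x, ν.rnDeriv μ x ^ (3 - p) ∂μ

lemma lintegral_ofReal_mul_rpow_rnDeriv {μ ν : Measure M} [SigmaFinite ν] {a c : ℝ} (hc : 0 ≤ c)
    (ha : 0 ≤ a) :
    ∫⁻ x, ENNReal.ofReal (c * (ν.rnDeriv μ x).toReal ^ a) ∂μ =
      ENNReal.ofReal c * ∫⁻ x, ν.rnDeriv μ x ^ a ∂μ := by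
  rw [← lintegral_const_mul _ ((Measure.measurable_rnDeriv ν μ).pow_const a)]
  refine lintegral_congr_ae ((Measure.rnDeriv_lt_top ν μ).mono fun x hx => ?_)
  simp only
  rw [ENNReal.ofReal_mul hc, ← ENNReal.ofReal_rpow_of_nonneg ENNReal.toReal_nonneg ha,
    ENNReal.ofReal_toReal hx.ne]

lemma lintegral_rnDeriv_add_singularPart {μ ν : Measure M} [SigmaFinite μ]
    [IsProbabilityMeasure ν] :
    ν.singularPart μ univ + ∫⁻ x, ν.rnDeriv μ x ∂μ = 1 := by
  have h := congrArg (fun m : Measure M => m univ) (ν.haveLebesgueDecomposition_add μ)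
  simpa using h.symm

lemma lintegral_ofReal_mul_rnDeriv {μ ν : Measure M} [SigmaFinite ν] {c : ℝ} (hc : 0 ≤ c) :
    ∫⁻ x, ENNReal.ofReal (c * (ν.rnDeriv μ x).toReal) ∂μ =
      ENNReal.ofReal c * ∫⁻ x, ν.rnDeriv μ x ∂μ := by
  have := lintegral_ofReal_mul_rpow_rnDeriv (μ := μ) (ν := ν) hc zero_le_one
  simpa using this

variable [MetricSpace M] {μ : Measure M} [SigmaFinite μ] {p : ℝ}

lemma renyiEntropy_of_lt_two (hp : p < 2) (ν : WassersteinSpace p M) (hν : ν.toMeasure ≪ μ) :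
    renyiEntropy p μ ν = ((ENNReal.ofReal (1 / ((3 - p) * (2 - p))) *
      powerIntegral p μ ν.toMeasure : ℝ≥0∞) : EReal) - ((1 / ((3 - p) * (2 - p)) : ℝ) : EReal) := by
  have h1 : 0 < 3 - p := by linarith
  have h2 : 0 < 2 - p := by linarith
  have hc : 0 < 1 / ((3 - p) * (2 - p)) := by positivity
  set c := 1 / ((3 - p) * (2 - p)) with hcdef
  have hs : ν.toMeasure.singularPart μ = 0 := (Measure.singularPart_eq_zero _ _).2 hν
  have hone := lintegral_rnDeriv_add_singularPart (μ := μ) (ν := ν.toMeasure)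
  rw [hs] at hone
  have hmeas : Measurable fun x => (ν.toMeasure.rnDeriv μ x).toReal :=
    (Measure.measurable_rnDeriv _ _).ennreal_toReal
  have hone' : ∫⁻ x, ν.toMeasure.rnDeriv μ x ∂μ = 1 := by simpa using hone
  have key := extIntegral_sub_of_nonneg (μ := μ)
    (A := fun x => c * (ν.toMeasure.rnDeriv μ x).toReal ^ (3 - p))
    (B := fun x => c * (ν.toMeasure.rnDeriv μ x).toReal)
    ((hmeas.pow_const _).const_mul c).aemeasurable (hmeas.const_mul c).aemeasurable
    (fun x => mul_nonneg hc.le (Real.rpow_nonneg ENNReal.toReal_nonneg _))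
    (fun x => mul_nonneg hc.le ENNReal.toReal_nonneg) (Or.inr (by
      rw [lintegral_ofReal_mul_rnDeriv hc.le, hone']; simp))
  rw [lintegral_ofReal_mul_rpow_rnDeriv hc.le h1.le, lintegral_ofReal_mul_rnDeriv hc.le, hone',
    mul_one] at key
  rw [renyiEntropy, energy, hs]
  simp only [Measure.coe_zero, Pi.zero_apply, EReal.coe_ennreal_zero, mul_zero, add_zero]
  have e : (fun x => renyiU p (ν.toMeasure.rnDeriv μ x).toReal) = fun x =>
      c * (ν.toMeasure.rnDeriv μ x).toReal ^ (3 - p) - c * (ν.toMeasure.rnDeriv μ x).toReal := by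
    ext x; rw [renyiU]; ring
  rw [e, key, powerIntegral, EReal.coe_ennreal_ofReal, max_eq_left hc.le]

/-- Singular mass has infinite cost, and the absolutely continuous part cannot compensate: the
negative part of `U_p(ρ)` is at most a multiple of `ρ`. -/
lemma renyiEntropy_eq_top_of_not_absolutelyContinuous (hp : p < 2) (ν : WassersteinSpace p M)
    (hν : ¬ ν.toMeasure ≪ μ) : renyiEntropy p μ ν = ⊤ := by
  have h1 : 0 < 3 - p := by linarith
  have h2 : 0 < 2 - p := by linarith
  have hc : 0 < 1 / ((3 - p) * (2 - p)) := by positivity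
  have hs : ν.toMeasure.singularPart μ univ ≠ 0 := by
    intro h
    exact hν ((Measure.singularPart_eq_zero _ _).1 (Measure.measure_univ_eq_zero.1 h))
  rw [renyiEntropy, energy, recession_renyiU_of_lt_two hp, EReal.top_mul_of_pos
    (EReal.coe_ennreal_pos.2 (pos_iff_ne_zero.2 hs))]
  refine EReal.add_top_of_ne_bot (extIntegral_ne_bot_of_le ?_)
  have hone := lintegral_rnDeriv_add_singularPart (μ := μ) (ν := ν.toMeasure)
  have hle : ∫⁻ x, ν.toMeasure.rnDeriv μ x ∂μ ≤ 1 := le_add_self.trans_eq hone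
  refine ne_top_of_le_ne_top ?_ (lintegral_mono (g := fun x => ENNReal.ofReal
    (1 / ((3 - p) * (2 - p)) * (ν.toMeasure.rnDeriv μ x).toReal)) fun x => ?_)
  · rw [lintegral_ofReal_mul_rnDeriv hc.le]
    exact ENNReal.mul_ne_top ENNReal.ofReal_ne_top (ne_top_of_le_ne_top ENNReal.one_ne_top hle)
  · refine ENNReal.ofReal_le_ofReal ?_
    rw [renyiU]
    have : 0 ≤ (ν.toMeasure.rnDeriv μ x).toReal ^ (3 - p) :=
      Real.rpow_nonneg ENNReal.toReal_nonneg _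
    nlinarith

/-- The linear term and the recession term carry the same constant, and together they see the total
mass one; hence no separate singular term remains. -/
lemma renyiEntropy_of_two_lt (hp : 2 < p) (hp3 : p < 3) (ν : WassersteinSpace p M) :
    renyiEntropy p μ ν = ((1 / ((3 - p) * (p - 2)) : ℝ) : EReal) -
      ((ENNReal.ofReal (1 / ((3 - p) * (p - 2))) * powerIntegral p μ ν.toMeasure : ℝ≥0∞) :
        EReal) := by
  have h1 : 0 < 3 - p := by linarith
  have h2 : 0 < p - 2 := by linarith
  have hc : 0 < 1 / ((3 - p) * (p - 2)) := by positivity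
  set c := 1 / ((3 - p) * (p - 2)) with hcdef
  have hone := lintegral_rnDeriv_add_singularPart (μ := μ) (ν := ν.toMeasure)
  have hmeas : Measurable fun x => (ν.toMeasure.rnDeriv μ x).toReal :=
    (Measure.measurable_rnDeriv _ _).ennreal_toReal
  have hle : ∫⁻ x, ν.toMeasure.rnDeriv μ x ∂μ ≠ ⊤ :=
    ne_top_of_le_ne_top ENNReal.one_ne_top (le_add_self.trans_eq hone)
  have hle' : ν.toMeasure.singularPart μ univ ≠ ⊤ :=
    ne_top_of_le_ne_top ENNReal.one_ne_top (le_self_add.trans_eq hone)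
  have key := extIntegral_sub_of_nonneg (μ := μ)
    (A := fun x => c * (ν.toMeasure.rnDeriv μ x).toReal)
    (B := fun x => c * (ν.toMeasure.rnDeriv μ x).toReal ^ (3 - p))
    (hmeas.const_mul c).aemeasurable ((hmeas.pow_const _).const_mul c).aemeasurable
    (fun x => mul_nonneg hc.le ENNReal.toReal_nonneg)
    (fun x => mul_nonneg hc.le (Real.rpow_nonneg ENNReal.toReal_nonneg _)) (Or.inl (by
      rw [lintegral_ofReal_mul_rnDeriv hc.le]
      exact ENNReal.mul_ne_top ENNReal.ofReal_ne_top hle))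
  rw [lintegral_ofReal_mul_rpow_rnDeriv hc.le h1.le, lintegral_ofReal_mul_rnDeriv hc.le] at key
  have e : (fun x => renyiU p (ν.toMeasure.rnDeriv μ x).toReal) = fun x =>
      c * (ν.toMeasure.rnDeriv μ x).toReal - c * (ν.toMeasure.rnDeriv μ x).toReal ^ (3 - p) := by
    ext x
    rw [renyiU, hcdef, show (3 - p) * (2 - p) = -((3 - p) * (p - 2)) by ring, one_div, inv_neg]
    ring
  rw [renyiEntropy, energy, e, key, recession_renyiU_of_two_lt hp, powerIntegral, ← hcdef]
  generalize ∫⁻ x, ν.toMeasure.rnDeriv μ x ∂μ = A at *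
  generalize ν.toMeasure.singularPart μ univ = S at *
  generalize ENNReal.ofReal c * ∫⁻ x, ν.toMeasure.rnDeriv μ x ^ (3 - p) ∂μ = J
  lift A to NNReal using hle
  lift S to NNReal using hle'
  have hr : (S : ℝ) + A = 1 := by exact_mod_cast hone
  rw [EReal.coe_ennreal_mul, EReal.coe_ennreal_ofReal, max_eq_left hc.le]
  simp only [EReal.coe_nnreal_eq_coe_real]
  have hcast : (c : EReal) = ((c * A + c * S : ℝ) : EReal) := by
    congr 1; rw [← mul_add, add_comm (A : ℝ), hr, mul_one]
  conv_rhs => rw [hcast]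
  rw [sub_eq_add_neg, sub_eq_add_neg, ← EReal.coe_mul, ← EReal.coe_mul, EReal.coe_add, add_assoc,
    add_assoc, add_comm (-(J : EReal))]

end Energy

lemma liminf_add_liminf_le (u v : ℕ → ℝ≥0∞) :
    liminf u atTop + liminf v atTop ≤ liminf (fun n => u n + v n) atTop := by
  simp only [liminf_eq_iSup_iInf_of_nat]
  rw [ENNReal.iSup_add_iSup_of_monotone]
  · exact iSup_mono fun n => le_iInf₂ fun i hi => add_le_add (iInf₂_le i hi) (iInf₂_le i hi)
  · exact fun a b hab => le_iInf₂ fun i hi => iInf₂_le i (hab.trans hi)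
  · exact fun a b hab => le_iInf₂ fun i hi => iInf₂_le i (hab.trans hi)

/-! ### Young inequalities behind the dual formulas -/

section Young

/-- Arithmetic-geometric mean with weights `a` and `1 - a`; the second factor is chosen so that `g`
cancels from the geometric mean. For `r > 0` equality holds at `g = r^(a-1)`. -/
lemma rpow_le_mul_add_rpow_neg {a g r : ℝ} (ha0 : 0 < a) (ha1 : a < 1) (hg : 0 < g) (hr : 0 ≤ r) :
    r ^ a ≤ a * (g * r) + (1 - a) * g ^ (-(a / (1 - a))) := by
  have h1 : 0 < 1 - a := by linarith
  have := Real.geom_mean_le_arith_mean2_weighted ha0.le h1.le (mul_nonneg hg.le hr)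
    (Real.rpow_nonneg hg.le (-(a / (1 - a)))) (by ring)
  rwa [← Real.rpow_mul hg.le, Real.mul_rpow hg.le hr, mul_right_comm, ← Real.rpow_add hg,
    show a + -(a / (1 - a)) * (1 - a) = 0 by field_simp; ring, Real.rpow_zero, one_mul] at this

lemma mul_le_rpow_add_rpow {a g r : ℝ} (ha : 1 < a) (hg : 0 ≤ g) (hr : 0 ≤ r) :
    a * (g * r) ≤ r ^ a + (a - 1) * g ^ (a / (a - 1)) := by
  have h1 : 0 < a - 1 := by linarith
  have h0 : 0 < a := by linarith
  have := Real.geom_mean_le_arith_mean2_weighted (w₁ := 1 / a) (w₂ := (a - 1) / a) (by positivity)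
    (by positivity) (Real.rpow_nonneg hr a) (Real.rpow_nonneg hg (a / (a - 1)))
    (by field_simp; ring)
  rw [← Real.rpow_mul hr, ← Real.rpow_mul hg, mul_one_div_cancel h0.ne', Real.rpow_one,
    show a / (a - 1) * ((a - 1) / a) = 1 by field_simp, Real.rpow_one] at this
  calc a * (g * r) = a * (r * g) := by ring
    _ ≤ a * (1 / a * r ^ a + (a - 1) / a * g ^ (a / (a - 1))) := by gcongr
    _ = _ := by field_simp

end Young

/-! ### Separating absolutely continuous and singular parts -/

section Decomposition

variable {M : Type*} [MeasurableSpace M] {μ ν : Measure M} [SigmaFinite μ] [IsFiniteMeasure ν]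

lemma lintegral_eq_singularPart_add_rnDeriv {f : M → ℝ≥0∞} (hf : Measurable f) :
    ∫⁻ x, f x ∂ν = ∫⁻ x, f x ∂(ν.singularPart μ) + ∫⁻ x, ν.rnDeriv μ x * f x ∂μ := by
  conv_lhs => rw [ν.haveLebesgueDecomposition_add μ]
  rw [lintegral_add_measure,
    lintegral_withDensity_eq_lintegral_mul _ (Measure.measurable_rnDeriv ν μ) hf]
  rfl

lemma exists_measurableSet_singularPart (μ ν : Measure M) :
    ∃ S : Set M, MeasurableSet S ∧ (∀ᵐ x ∂μ, x ∉ S) ∧ ∀ᵐ x ∂(ν.singularPart μ), x ∈ S := by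
  obtain ⟨S, hS, h1, h2⟩ := (Measure.mutuallySingular_singularPart ν μ).symm
  exact ⟨S, hS, measure_eq_zero_iff_ae_notMem.1 h1, by simpa [ae_iff] using! h2⟩

end Decomposition

/-! ### Cutoff functions -/

section Cutoff

variable {M : Type*} [MetricSpace M]

/-- A continuous cutoff function which tends to `1` as `R → ∞`. -/
noncomputable def cutoff (x₀ : M) (R : ℝ) (x : M) : ℝ := max 0 (min 1 (R - dist x x₀))

lemma continuous_cutoff (x₀ : M) (R : ℝ) : Continuous (cutoff x₀ R) :=
  continuous_const.max (continuous_const.min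
    (continuous_const.sub (continuous_id.dist continuous_const)))

lemma cutoff_mem_Icc (x₀ : M) (R : ℝ) (x : M) : cutoff x₀ R x ∈ Icc (0 : ℝ) 1 :=
  ⟨le_max_left _ _, max_le zero_le_one (min_le_left _ _)⟩

lemma cutoff_eq_zero {x₀ : M} {R : ℝ} {x : M} (h : x ∉ Metric.closedBall x₀ R) :
    cutoff x₀ R x = 0 := by
  rw [Metric.mem_closedBall, not_le] at h
  exact max_eq_left ((min_le_right _ _).trans (by linarith))

lemma eventually_cutoff_eq_one (x₀ x : M) : ∀ᶠ k : ℕ in atTop, cutoff x₀ k x = 1 := by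
  obtain ⟨m, hm⟩ := exists_nat_ge (dist x x₀ + 1)
  filter_upwards [eventually_ge_atTop m] with k hk
  have : (m : ℝ) ≤ k := by exact_mod_cast hk
  rw [cutoff, min_eq_left (by linarith), max_eq_right zero_le_one]

end Cutoff

/-! ### Truncated test functions for `p < 2` -/

section Truncation

variable {M : Type*} [MeasurableSpace M] {μ : Measure M} {p : ℝ}

open Classical in
/-- The truncated density to the power `2 - p`, modified on a null set `S`. -/
noncomputable def truncatedDual (p : ℝ) (μ ν : Measure M) (S : Set M) (k : ℕ) (x : M) : ℝ :=
  if x ∈ S then k else min (ν.rnDeriv μ x).toReal k ^ (2 - p)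

lemma measurable_truncatedDual (ν : Measure M) {S : Set M} (hS : MeasurableSet S) (k : ℕ) :
    Measurable (truncatedDual p μ ν S k) :=
  Measurable.ite hS measurable_const
    (((Measure.measurable_rnDeriv _ _).ennreal_toReal.min measurable_const).pow_const _)

lemma truncatedDual_mem_Icc (hp : p < 2) (ν : Measure M) (S : Set M) (k : ℕ) (x : M) :
    truncatedDual p μ ν S k x ∈ Icc (0 : ℝ) (max (k : ℝ) ((k : ℝ) ^ (2 - p))) := by
  have h0 : 0 ≤ min (ν.rnDeriv μ x).toReal k := le_min ENNReal.toReal_nonneg k.cast_nonneg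
  rw [truncatedDual]
  split_ifs
  · exact ⟨k.cast_nonneg, le_max_left _ _⟩
  · exact ⟨Real.rpow_nonneg h0 _, le_max_of_le_right
      (Real.rpow_le_rpow h0 (min_le_right _ _) (by linarith))⟩

lemma integrable_mul_rpow_of_mem_Icc {k φ : M → ℝ} {q β : ℝ} (hq : 0 ≤ q) (hk : 0 ≤ k)
    (hkm : Measurable k) (hφm : Measurable φ) (hφ : ∀ x, φ x ∈ Icc 0 β)
    (hkI : Integrable (fun x => k x ^ q) μ) : Integrable (fun x => (k x * φ x) ^ q) μ := by
  refine (hkI.mul_const (β ^ q)).mono' ((hkm.mul hφm).pow_const q).aestronglyMeasurable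
    (Eventually.of_forall fun x => ?_)
  rw [Real.norm_of_nonneg (Real.rpow_nonneg (mul_nonneg (hk x) (hφ x).1) q),
    Real.mul_rpow (hk x) (hφ x).1]
  exact mul_le_mul_of_nonneg_left (Real.rpow_le_rpow (hφ x).1 (hφ x).2 hq)
    (Real.rpow_nonneg (hk x) q)

end Truncation

/-! ### Lower semicontinuity for `p < 2` -/

section SmallExponent

variable {M : Type*} [MeasurableSpace M] [MetricSpace M] [ProperSpace M] [BorelSpace M]
  {μ : Measure M} {p : ℝ}

/-- A lower bound of `𝒰_p` (up to constants) by truncation of the density. -/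
noncomputable def truncatedPower (p : ℝ) (μ ν : Measure M) (x₀ : M) (k : ℕ) : ℝ≥0∞ :=
  ∫⁻ x, ENNReal.ofReal (cutoff x₀ k x * min (ν.rnDeriv μ x).toReal k ^ (3 - p)) ∂μ +
    ∫⁻ x, ENNReal.ofReal (k * cutoff x₀ k x) ∂(ν.singularPart μ)

/-- Fatou's lemma for each part separately; on the singular part the integrand tends to infinity,
which reproduces the infinite recession constant. -/
lemma le_liminf_truncatedPower (hp : p < 2) (ν : Measure M) [IsFiniteMeasure ν] (x₀ : M) :
    powerIntegral p μ ν + ⊤ * ν.singularPart μ univ ≤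
      liminf (fun k => truncatedPower p μ ν x₀ k) atTop := by
  have hmeas : Measurable fun x => (ν.rnDeriv μ x).toReal :=
    (Measure.measurable_rnDeriv _ _).ennreal_toReal
  have hcm : ∀ k : ℕ, Measurable (cutoff x₀ (k : ℝ)) := fun k => (continuous_cutoff x₀ k).measurable
  have hA : powerIntegral p μ ν ≤ liminf (fun k : ℕ => ∫⁻ x, ENNReal.ofReal
      (cutoff x₀ k x * min (ν.rnDeriv μ x).toReal k ^ (3 - p)) ∂μ) atTop := by
    refine le_trans ?_ (lintegral_liminf_le fun k => ((hcm k).mul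
      ((hmeas.min measurable_const).pow_const _)).ennreal_ofReal)
    refine lintegral_mono_ae ((Measure.rnDeriv_lt_top ν μ).mono fun x hx => ?_)
    refine (Tendsto.liminf_eq ?_).ge
    refine tendsto_const_nhds.congr' ?_
    filter_upwards [eventually_cutoff_eq_one x₀ x,
      tendsto_natCast_atTop_atTop.eventually_ge_atTop (ν.rnDeriv μ x).toReal] with k hk hk'
    rw [hk, min_eq_left hk', one_mul,
      ← ENNReal.ofReal_rpow_of_nonneg ENNReal.toReal_nonneg (by linarith),
      ENNReal.ofReal_toReal hx.ne]
  have hB : ⊤ * ν.singularPart μ univ ≤ liminf (fun k : ℕ =>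
      ∫⁻ x, ENNReal.ofReal (k * cutoff x₀ k x) ∂(ν.singularPart μ)) atTop := by
    rw [← lintegral_const]
    refine le_trans ?_ (lintegral_liminf_le fun k => ((hcm k).const_mul _).ennreal_ofReal)
    refine lintegral_mono fun x => ?_
    refine (Tendsto.liminf_eq ?_).ge
    refine (ENNReal.tendsto_ofReal_atTop.comp tendsto_natCast_atTop_atTop).congr' ?_
    filter_upwards [eventually_cutoff_eq_one x₀ x] with k hk
    simp [hk]
  exact (add_le_add hA hB).trans (liminf_add_liminf_le _ _)

variable [IsLocallyFiniteMeasure μ]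

lemma mul_integral_le_of_absolutelyContinuous {ν : Measure M} [IsProbabilityMeasure ν] (hν : ν ≪ μ)
    (hp : p < 2) {g : M → ℝ} (hgm : Measurable g) (hg0 : 0 ≤ g) (hgν : Integrable g ν)
    (hgμ : Integrable (fun x => g x ^ ((3 - p) / (2 - p))) μ) :
    ENNReal.ofReal ((3 - p) * ∫ x, g x ∂ν) ≤
      powerIntegral p μ ν + ENNReal.ofReal ((2 - p) * ∫ x, g x ^ ((3 - p) / (2 - p)) ∂μ) := by
  have h1 : 0 < 3 - p := by linarith
  have h2 : 0 < 2 - p := by linarith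
  have hgq0 : ∀ x, 0 ≤ g x ^ ((3 - p) / (2 - p)) := fun x => Real.rpow_nonneg (hg0 x) _
  have hρg : Measurable fun x => ν.rnDeriv μ x * ENNReal.ofReal (g x) :=
    (Measure.measurable_rnDeriv ν μ).mul hgm.ennreal_ofReal
  rw [ENNReal.ofReal_mul h1.le, ENNReal.ofReal_mul h2.le,
    ofReal_integral_eq_lintegral_ofReal hgν (Eventually.of_forall hg0),
    ofReal_integral_eq_lintegral_ofReal hgμ (Eventually.of_forall hgq0),
    lintegral_eq_singularPart_add_rnDeriv (μ := μ) (hgm.ennreal_ofReal),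
    (Measure.singularPart_eq_zero _ _).2 hν, lintegral_zero_measure, zero_add, powerIntegral,
    ← lintegral_const_mul _ hρg,
    ← lintegral_const_mul _ (hgm.pow_const _).ennreal_ofReal,
    ← lintegral_add_left ((Measure.measurable_rnDeriv ν μ).pow_const _)]
  refine lintegral_mono_ae ((Measure.rnDeriv_lt_top ν μ).mono fun x hx => ?_)
  have hr : 0 ≤ (ν.rnDeriv μ x).toReal := ENNReal.toReal_nonneg
  rw [← ENNReal.ofReal_toReal hx.ne, ENNReal.ofReal_rpow_of_nonneg hr h1.le,
    ← ENNReal.ofReal_mul hr, ← ENNReal.ofReal_mul h1.le, ← ENNReal.ofReal_mul h2.le,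
    ← ENNReal.ofReal_add (Real.rpow_nonneg hr _) (mul_nonneg h2.le (hgq0 x))]
  refine ENNReal.ofReal_le_ofReal ?_
  have := mul_le_rpow_add_rpow (a := 3 - p) (by linarith) (hg0 x) hr
  rw [show 3 - p - 1 = 2 - p by ring] at this
  rwa [mul_comm (ν.rnDeriv μ x).toReal]

/-- Young's inequality integrated. If the measure is not absolutely continuous, the entropy is `⊤`.
-/
lemma affine_le_renyiEntropy_of_lt_two (hp : p < 2) (ν : WassersteinSpace p M) {g : M → ℝ}
    (hgm : Measurable g) (hg0 : 0 ≤ g) (hgν : Integrable g ν.toMeasure)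
    (hgμ : Integrable (fun x => g x ^ ((3 - p) / (2 - p))) μ) :
    ((1 / ((3 - p) * (2 - p)) * ((3 - p) * (∫ x, g x ∂ν.toMeasure) -
      (2 - p) * ∫ x, g x ^ ((3 - p) / (2 - p)) ∂μ) - 1 / ((3 - p) * (2 - p)) : ℝ) : EReal) ≤
      renyiEntropy p μ ν := by
  have h1 : 0 < 3 - p := by linarith
  have h2 : 0 < 2 - p := by linarith
  have hc : 0 < 1 / ((3 - p) * (2 - p)) := by positivity
  set c := 1 / ((3 - p) * (2 - p)) with hcdef
  by_cases hν : ν.toMeasure ≪ μ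
  · rw [renyiEntropy_of_lt_two hp ν hν, ← hcdef]
    have hY := mul_integral_le_of_absolutelyContinuous hν hp hgm hg0 hgν hgμ
    generalize powerIntegral p μ ν.toMeasure = J at *
    rcases eq_or_ne J ⊤ with rfl | hJ
    · rw [ENNReal.mul_top (by simpa using hc)]
      simp
    · lift J to NNReal using hJ
      have hX : 0 ≤ ∫ x, g x ^ ((3 - p) / (2 - p)) ∂μ :=
        integral_nonneg fun x => Real.rpow_nonneg (hg0 x) _
      rw [← ENNReal.ofReal_coe_nnreal, ← ENNReal.ofReal_add J.coe_nonneg (by positivity)] at hY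
      have hle := (ENNReal.ofReal_le_ofReal_iff (by positivity)).1 hY
      rw [← ENNReal.ofReal_coe_nnreal, ← ENNReal.ofReal_mul hc.le, EReal.coe_ennreal_ofReal,
        max_eq_left (by positivity), ← EReal.coe_sub]
      refine EReal.coe_le_coe_iff.2 ?_
      gcongr
      linarith
  · rw [renyiEntropy_eq_top_of_not_absolutelyContinuous hp ν hν]
    exact le_top

lemma integrable_cutoff_rpow (x₀ : M) (k : ℕ) {q : ℝ} (hq : 0 < q) :
    Integrable (fun x => cutoff x₀ k x ^ q) μ := by
  have hfin : μ (Metric.closedBall x₀ k) < ⊤ := (isCompact_closedBall x₀ (k : ℝ)).measure_lt_top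
  have hI : Integrable ((Metric.closedBall x₀ (k : ℝ)).indicator fun _ => (1 : ℝ)) μ :=
    (integrable_indicator_iff Metric.isClosed_closedBall.measurableSet).2
      (integrableOn_const hfin.ne)
  refine hI.mono' ((continuous_cutoff x₀ k).measurable.pow_const q).aestronglyMeasurable
    (Eventually.of_forall fun x => ?_)
  have hc := cutoff_mem_Icc x₀ (k : ℝ) x
  rw [Real.norm_of_nonneg (Real.rpow_nonneg hc.1 q)]
  by_cases hx : x ∈ Metric.closedBall x₀ (k : ℝ)
  · rw [indicator_of_mem hx]
    exact Real.rpow_le_one hc.1 hc.2 hq.le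
  · rw [indicator_of_notMem hx, cutoff_eq_zero hx, Real.zero_rpow hq.ne']

/-- The test function `χ φ` is nearly optimal in Young's inequality. Off `S`, with `m = min ρ k`,
one has `(χ φ)^q ≤ χ m^(3-p) ≤ ρ χ φ`, and the factors `1` and `2 - p` add up to `3 - p`. On `S`, `φ
= k` and `3 - p ≥ 1` suffices. -/
lemma truncatedPower_add_le (hp1 : 1 < p) (hp : p < 2) (ν : Measure M) [IsProbabilityMeasure ν]
    (x₀ : M) (k : ℕ) {S : Set M} (hS : MeasurableSet S) (hμS : ∀ᵐ x ∂μ, x ∉ S)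
    (hνS : ∀ᵐ x ∂(ν.singularPart μ), x ∈ S) :
    truncatedPower p μ ν x₀ k + ENNReal.ofReal ((2 - p) *
      ∫ x, (cutoff x₀ k x * truncatedDual p μ ν S k x) ^ ((3 - p) / (2 - p)) ∂μ) ≤
      ENNReal.ofReal ((3 - p) * ∫ x, cutoff x₀ k x * truncatedDual p μ ν S k x ∂ν) := by
  have h1 : 0 < 3 - p := by linarith
  have h2 : 0 < 2 - p := by linarith
  set q := (3 - p) / (2 - p) with hq
  have hq1 : 1 ≤ q := by rw [hq, one_le_div h2]; linarith
  set χ : M → ℝ := cutoff x₀ (k : ℝ) with hχ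
  set φ := truncatedDual p μ ν S k with hφ
  set ρ : M → ℝ := fun x => (ν.rnDeriv μ x).toReal with hρ
  have hχm : Measurable χ := (continuous_cutoff x₀ k).measurable
  have hφm : Measurable φ := measurable_truncatedDual ν hS k
  have hφI : ∀ x, φ x ∈ Icc (0 : ℝ) (max (k : ℝ) ((k : ℝ) ^ (2 - p))) :=
    truncatedDual_mem_Icc hp ν S k
  have hχI : ∀ x, χ x ∈ Icc (0 : ℝ) 1 := cutoff_mem_Icc x₀ k
  have hρm : Measurable ρ := (Measure.measurable_rnDeriv _ _).ennreal_toReal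
  have hg0 : ∀ x, 0 ≤ χ x * φ x := fun x => mul_nonneg (hχI x).1 (hφI x).1
  have hgm : Measurable fun x => χ x * φ x := hχm.mul hφm
  have hgν : Integrable (fun x => χ x * φ x) ν := by
    refine Integrable.of_bound hgm.aestronglyMeasurable (1 * max (k : ℝ) ((k : ℝ) ^ (2 - p)))
      (Eventually.of_forall fun x => ?_)
    rw [Real.norm_of_nonneg (hg0 x)]
    exact mul_le_mul (hχI x).2 (hφI x).2 (hφI x).1 zero_le_one
  have hgμ : Integrable (fun x => (χ x * φ x) ^ q) μ :=
    integrable_mul_rpow_of_mem_Icc (by linarith) (fun x => (hχI x).1) hχm hφm hφI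
      (integrable_cutoff_rpow x₀ k (by linarith))
  have hm0 : ∀ x, 0 ≤ min (ρ x) k := fun x => le_min ENNReal.toReal_nonneg k.cast_nonneg
  have hρg : Measurable fun x => ν.rnDeriv μ x * ENNReal.ofReal (χ x * φ x) :=
    (Measure.measurable_rnDeriv ν μ).mul hgm.ennreal_ofReal
  have hm1 : Measurable fun x => ENNReal.ofReal (χ x * min (ρ x) k ^ (3 - p)) :=
    (hχm.mul ((hρm.min measurable_const).pow_const _)).ennreal_ofReal
  rw [ENNReal.ofReal_mul h1.le, ENNReal.ofReal_mul h2.le,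
    ofReal_integral_eq_lintegral_ofReal hgν (Eventually.of_forall hg0),
    ofReal_integral_eq_lintegral_ofReal hgμ
      (Eventually.of_forall fun x => Real.rpow_nonneg (hg0 x) q),
    lintegral_eq_singularPart_add_rnDeriv (μ := μ) hgm.ennreal_ofReal, mul_add,
    ← lintegral_const_mul _ hρg, ← lintegral_const_mul _ hgm.ennreal_ofReal,
    ← lintegral_const_mul _ (hgm.pow_const _).ennreal_ofReal, truncatedPower, add_right_comm,
    ← lintegral_add_left hm1, add_comm]
  refine add_le_add (lintegral_mono_ae (hνS.mono fun x hx => ?_)) (lintegral_mono_ae ?_)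
  · rw [← ENNReal.ofReal_mul h1.le]
    refine ENNReal.ofReal_le_ofReal ?_
    simp only [hφ, truncatedDual, if_pos hx]
    have : 0 ≤ (k : ℝ) * χ x := mul_nonneg k.cast_nonneg (hχI x).1
    nlinarith
  · filter_upwards [hμS, Measure.rnDeriv_lt_top ν μ] with x hx hxt
    have hr : 0 ≤ ρ x := ENNReal.toReal_nonneg
    rw [← ENNReal.ofReal_toReal hxt.ne, ← ENNReal.ofReal_mul hr, ← ENNReal.ofReal_mul h1.le,
      ← ENNReal.ofReal_mul h2.le, ← ENNReal.ofReal_add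
      (mul_nonneg (hχI x).1 (Real.rpow_nonneg (hm0 x) _))
      (mul_nonneg h2.le (Real.rpow_nonneg (hg0 x) _))]
    refine ENNReal.ofReal_le_ofReal ?_
    have hφx : φ x = min (ρ x) k ^ (2 - p) := by simp only [hφ, truncatedDual, if_neg hx, hρ]
    have hpow : (χ x * φ x) ^ q ≤ χ x * min (ρ x) k ^ (3 - p) := by
      rw [Real.mul_rpow (hχI x).1 (hφI x).1, hφx, ← Real.rpow_mul (hm0 x), hq,
        mul_div_cancel₀ _ h2.ne']
      refine mul_le_mul_of_nonneg_right ?_ (Real.rpow_nonneg (hm0 x) _)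
      exact Real.rpow_le_self_of_le_one (hχI x).1 (hχI x).2 hq1
    have hmul : χ x * min (ρ x) k ^ (3 - p) ≤ ρ x * (χ x * φ x) := by
      rw [hφx, show 3 - p = (2 - p) + 1 by ring, Real.rpow_add_one' (hm0 x) (by linarith)]
      have h3 : 0 ≤ χ x * min (ρ x) k ^ (2 - p) :=
        mul_nonneg (hχI x).1 (Real.rpow_nonneg (hm0 x) _)
      nlinarith [min_le_left (ρ x) (k : ℝ)]
    nlinarith

/-- For `p < 2` the functional `𝒰_p` is lower semicontinuous. -/
theorem lowerSemicontinuous_renyiEntropy_of_lt_two (hp1 : 1 ≤ p) (hp1' : 1 < p) (hp : p < 2) :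
    letI := wassersteinPseudoMetric (M := M) hp1
    LowerSemicontinuous (renyiEntropy (M := M) p μ) := by
  have h1 : 0 < 3 - p := by linarith
  have h2 : 0 < 2 - p := by linarith
  have hc : 0 < 1 / ((3 - p) * (2 - p)) := by positivity
  refine lowerSemicontinuous_of_affine_minorants hp1 fun ν r hr => ?_
  set c := 1 / ((3 - p) * (2 - p)) with hcdef
  set q := (3 - p) / (2 - p) with hq
  have hq0 : 0 < q := by positivity
  obtain ⟨x₀⟩ := ν.nonempty
  have hE : renyiEntropy p μ ν ≤ ((ENNReal.ofReal c * (powerIntegral p μ ν.toMeasure +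
      ⊤ * ν.toMeasure.singularPart μ univ) : ℝ≥0∞) : EReal) - (c : EReal) := by
    by_cases hν : ν.toMeasure ≪ μ
    · rw [renyiEntropy_of_lt_two hp ν hν, (Measure.singularPart_eq_zero _ _).2 hν]
      simp [hcdef]
    · have hs : ν.toMeasure.singularPart μ univ ≠ 0 := by
        intro h
        exact hν ((Measure.singularPart_eq_zero _ _).1 (Measure.measure_univ_eq_zero.1 h))
      rw [ENNReal.top_mul hs, add_top, ENNReal.mul_top (by simpa using hc)]
      simp
  have hlt := hr.trans_le hE
  -- The alternative `r + c < 0` is kept apart because `ENNReal.ofReal` would lose the sign; any `k`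
  -- is then good enough.
  obtain ⟨k, hk⟩ : ∃ k : ℕ, ENNReal.ofReal ((r + c) / c) < truncatedPower p μ ν.toMeasure x₀ k ∨
      r + c < 0 := by
    by_cases hneg : r + c < 0
    · exact ⟨0, Or.inr hneg⟩
    have hlt' : ENNReal.ofReal ((r + c) / c) < powerIntegral p μ ν.toMeasure +
        ⊤ * ν.toMeasure.singularPart μ univ := by
      generalize powerIntegral p μ ν.toMeasure + ⊤ * ν.toMeasure.singularPart μ univ = J at hlt
      rcases eq_or_ne J ⊤ with rfl | hJ
      · exact ENNReal.ofReal_lt_top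
      · lift J to NNReal using hJ
        rw [← ENNReal.ofReal_coe_nnreal, ← ENNReal.ofReal_mul hc.le, EReal.coe_ennreal_ofReal,
          max_eq_left (by positivity), ← EReal.coe_sub, EReal.coe_lt_coe_iff] at hlt
        rw [← ENNReal.ofReal_coe_nnreal, ENNReal.ofReal_lt_ofReal_iff_of_nonneg
          (div_nonneg (not_lt.1 hneg) hc.le), div_lt_iff₀ hc]
        linarith
    have := hlt'.trans_le (le_liminf_truncatedPower hp ν.toMeasure x₀)
    obtain ⟨k, hk⟩ := (eventually_lt_of_lt_liminf this).exists
    exact ⟨k, Or.inl hk⟩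
  obtain ⟨S, hS, hμS, hνS⟩ := exists_measurableSet_singularPart μ ν.toMeasure
  have hadd := truncatedPower_add_le hp1' hp ν.toMeasure x₀ k hS hμS hνS
  have hcc := continuous_cutoff x₀ (k : ℝ)
  have hcI := cutoff_mem_Icc x₀ (k : ℝ)
  set β : ℝ := max (k : ℝ) ((k : ℝ) ^ (2 - p)) with hβ
  have hβ0 : 0 ≤ β := le_max_of_le_left k.cast_nonneg
  have hφI := truncatedDual_mem_Icc (μ := μ) hp ν.toMeasure S k
  have hφm := measurable_truncatedDual (p := p) (μ := μ) ν.toMeasure hS k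
  set φ := truncatedDual p μ ν.toMeasure S k with hφ
  have hXnn : 0 ≤ ∫ x, cutoff x₀ k x * φ x ∂ν.toMeasure :=
    integral_nonneg fun x => mul_nonneg (hcI x).1 (hφI x).1
  have hYnn : 0 ≤ ∫ x, (cutoff x₀ k x * φ x) ^ q ∂μ :=
    integral_nonneg fun x => Real.rpow_nonneg (mul_nonneg (hcI x).1 (hφI x).1) _
  have hJ : r < c * ((3 - p) * (∫ x, cutoff x₀ k x * φ x ∂ν.toMeasure) -
      (2 - p) * ∫ x, (cutoff x₀ k x * φ x) ^ q ∂μ) - c := by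
    have hle : (2 - p) * ∫ x, (cutoff x₀ k x * φ x) ^ q ∂μ ≤
        (3 - p) * ∫ x, cutoff x₀ k x * φ x ∂ν.toMeasure :=
      (ENNReal.ofReal_le_ofReal_iff (by positivity)).1 (le_add_self.trans hadd)
    rcases hk with hk | hk
    · rcases lt_or_ge (r + c) 0 with hneg | hnn
      · nlinarith
      · have h3 := (ENNReal.add_lt_add_right (ENNReal.ofReal_ne_top (r := (2 - p) *
          ∫ x, (cutoff x₀ k x * φ x) ^ q ∂μ)) hk).trans_le hadd
        rw [← ENNReal.ofReal_add (by positivity) (by positivity),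
          ENNReal.ofReal_lt_ofReal_iff_of_nonneg (by positivity), ← lt_sub_iff_add_lt,
          div_lt_iff₀ hc] at h3
        linarith
    · nlinarith
  have hkν : Integrable (cutoff x₀ (k : ℝ)) ν.toMeasure :=
    Integrable.of_bound hcc.aestronglyMeasurable 1 (Eventually.of_forall fun x => by
      rw [Real.norm_of_nonneg (hcI x).1]; exact (hcI x).2)
  -- The strict inequality `hJ` survives replacing `φ` by a sufficiently close continuous function.
  obtain ⟨φs, hφsc, hφsI, hlim1, hlim2⟩ := exists_continuous_tendsto_integral hcc
    (fun x => (hcI x).1) hkν (integrable_cutoff_rpow (μ := μ) x₀ k hq0) le_rfl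
    (B := β ^ q) (β := β)
    (continuousOn_id.rpow_const fun t _ => Or.inr hq0.le)
    (fun t ht => Real.rpow_le_rpow ht.1 ht.2 hq0.le) hφm hφI
  have hlim := (((hlim1.const_mul (3 - p)).sub (hlim2.const_mul (2 - p))).const_mul c).sub_const c
  obtain ⟨n, hn⟩ := (hlim.eventually (lt_mem_nhds hJ)).exists
  have hg0 : ∀ x, 0 ≤ cutoff x₀ k x * φs n x := fun x => mul_nonneg (hcI x).1 (hφsI n x).1
  have hgb : ∀ x, cutoff x₀ k x * φs n x ≤ β := fun x =>
    (mul_le_of_le_one_left (hφsI n x).1 (hcI x).2).trans (hφsI n x).2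
  refine ⟨x₀, fun x => (c * (3 - p)) * (cutoff x₀ k x * φs n x), c * (3 - p) * β,
    -(c * (2 - p) * ∫ x, (cutoff x₀ k x * φs n x) ^ q ∂μ) - c,
    continuous_const.mul (hcc.mul (hφsc n)), fun x => ?_, ?_, fun ν' => ?_⟩
  · have hpos : 0 ≤ c * (3 - p) := by positivity
    rw [abs_of_nonneg (mul_nonneg hpos (hg0 x))]
    have hw := one_le_momentWeight (show 0 ≤ p by linarith) x₀ x
    have : cutoff x₀ k x * φs n x ≤ β * momentWeight p x₀ x :=
      (hgb x).trans (le_mul_of_one_le_right hβ0 hw)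
    calc c * (3 - p) * (cutoff x₀ k x * φs n x)
        ≤ c * (3 - p) * (β * momentWeight p x₀ x) := by gcongr
      _ = _ := by ring
  · rw [integral_const_mul]
    linarith
  · have hint : Integrable (fun x => cutoff x₀ k x * φs n x) ν'.toMeasure :=
      Integrable.of_bound (hcc.mul (hφsc n)).aestronglyMeasurable β
        (Eventually.of_forall fun x => by rw [Real.norm_of_nonneg (hg0 x)]; exact hgb x)
    have := affine_le_renyiEntropy_of_lt_two (μ := μ) hp ν'
      (g := fun x => cutoff x₀ k x * φs n x) (hcc.mul (hφsc n)).measurable hg0 hint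
      (integrable_mul_rpow_of_mem_Icc hq0.le (fun x => (hcI x).1) hcc.measurable
        (hφsc n).measurable (hφsI n) (integrable_cutoff_rpow x₀ k hq0))
    refine le_trans (le_of_eq ?_) this
    rw [integral_const_mul, ← hcdef, ← hq]
    congr 1
    ring

end SmallExponent

/-! ### Perturbed test functions for `p > 2` -/

section PerturbedDual

variable {M : Type*} [MeasurableSpace M] [MetricSpace M] {μ ν : Measure M} {p : ℝ}

open Classical in
/-- A truncated power of the (perturbed) density, modified on a null set `S`. -/
noncomputable def perturbedDual (p : ℝ) (μ ν : Measure M) (x₀ : M) (S : Set M) (δ η : ℝ) (x : M) :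
    ℝ :=
  max η (if x ∈ S then 0 else ((ν.rnDeriv μ x).toReal +
    δ * momentWeight p x₀ x ^ (-(1 / (p - 2)))) ^ (2 - p) / momentWeight p x₀ x)

/-- The perturbation `δ w^(-1/(p-2))` is chosen so that its power `2 - p` is `δ^(2-p) w`. It keeps
the negative power of the density within `p`-growth where the density is small. -/
lemma perturbedDual_mem_Icc (hp : 2 < p) (x₀ : M) (S : Set M) {δ : ℝ} (hδ : 0 < δ) (η : ℝ) (x : M) :
    perturbedDual p μ ν x₀ S δ η x ∈ Icc η (max η (δ ^ (2 - p))) := by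
  have h2 : 0 < p - 2 := by linarith
  have hw0 : 0 < momentWeight p x₀ x :=
    zero_lt_one.trans_le (one_le_momentWeight (by linarith) x₀ x)
  refine ⟨le_max_left _ _, max_le_max le_rfl ?_⟩
  split_ifs
  · exact Real.rpow_nonneg hδ.le _
  · rw [div_le_iff₀ hw0]
    have hb : 0 < δ * momentWeight p x₀ x ^ (-(1 / (p - 2))) :=
      mul_pos hδ (Real.rpow_pos_of_pos hw0 _)
    calc ((ν.rnDeriv μ x).toReal + δ * momentWeight p x₀ x ^ (-(1 / (p - 2)))) ^ (2 - p)
        ≤ (δ * momentWeight p x₀ x ^ (-(1 / (p - 2)))) ^ (2 - p) :=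
          Real.rpow_le_rpow_of_nonpos hb
            (le_add_of_nonneg_left ENNReal.toReal_nonneg) (by linarith)
      _ = δ ^ (2 - p) * momentWeight p x₀ x := by
          rw [Real.mul_rpow hδ.le (Real.rpow_nonneg hw0.le _), ← Real.rpow_mul hw0.le,
            show -(1 / (p - 2)) * (2 - p) = 1 by field_simp; ring, Real.rpow_one]

variable [OpensMeasurableSpace M]

lemma measurable_perturbedDual (x₀ : M) {S : Set M} (hS : MeasurableSet S) (δ η : ℝ) :
    Measurable (perturbedDual p μ ν x₀ S δ η) := by
  have hwm : Measurable (momentWeight p x₀) := (continuous_momentWeight p x₀).measurable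
  have hρ : Measurable fun x => (ν.rnDeriv μ x).toReal :=
    (Measure.measurable_rnDeriv _ _).ennreal_toReal
  exact measurable_const.max (Measurable.ite hS measurable_const
    (((hρ.add ((hwm.pow_const _).const_mul δ)).pow_const _).div hwm))

end PerturbedDual

/-! ### Lower semicontinuity for `2 < p < 3` -/

section LargeExponent

variable {M : Type*} [MeasurableSpace M] {μ ν : Measure M} [SigmaFinite μ] [IsProbabilityMeasure ν]
  {p : ℝ}

/-- Young's inequality on the absolutely continuous part; singular mass only enlarges the integral
of `g` on the right. -/
lemma powerIntegral_le_of_two_lt (hp : 2 < p) (hp3 : p < 3) {g : M → ℝ} (hgm : Measurable g)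
    (hg0 : ∀ x, 0 < g x) (hgν : Integrable g ν)
    (hgμ : Integrable (fun x => g x ^ (-((3 - p) / (p - 2)))) μ) :
    powerIntegral p μ ν ≤ ENNReal.ofReal
      ((3 - p) * (∫ x, g x ∂ν) + (p - 2) * ∫ x, g x ^ (-((3 - p) / (p - 2))) ∂μ) := by
  have h1 : 0 < 3 - p := by linarith
  have h2 : 0 < p - 2 := by linarith
  set s := (3 - p) / (p - 2) with hs
  have hgq0 : ∀ x, 0 ≤ g x ^ (-s) := fun x => Real.rpow_nonneg (hg0 x).le _
  have hX : 0 ≤ ∫ x, g x ∂ν := integral_nonneg fun x => (hg0 x).le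
  have hY : 0 ≤ ∫ x, g x ^ (-s) ∂μ := integral_nonneg hgq0
  have hρg : Measurable fun x => ENNReal.ofReal (3 - p) * (ν.rnDeriv μ x * ENNReal.ofReal (g x)) :=
    ((Measure.measurable_rnDeriv ν μ).mul hgm.ennreal_ofReal).const_mul _
  rw [ENNReal.ofReal_add (by positivity) (by positivity), ENNReal.ofReal_mul h1.le,
    ENNReal.ofReal_mul h2.le,
    ofReal_integral_eq_lintegral_ofReal hgν (Eventually.of_forall fun x => (hg0 x).le),
    ofReal_integral_eq_lintegral_ofReal hgμ (Eventually.of_forall hgq0),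
    lintegral_eq_singularPart_add_rnDeriv (μ := μ) hgm.ennreal_ofReal]
  calc powerIntegral p μ ν ≤ ∫⁻ x, (ENNReal.ofReal (3 - p) *
        (ν.rnDeriv μ x * ENNReal.ofReal (g x)) +
        ENNReal.ofReal (p - 2) * ENNReal.ofReal (g x ^ (-s))) ∂μ := by
        refine lintegral_mono_ae ((Measure.rnDeriv_lt_top ν μ).mono fun x hx => ?_)
        have hr : 0 ≤ (ν.rnDeriv μ x).toReal := ENNReal.toReal_nonneg
        rw [← ENNReal.ofReal_toReal hx.ne, ENNReal.ofReal_rpow_of_nonneg hr h1.le,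
          ← ENNReal.ofReal_mul hr, ← ENNReal.ofReal_mul h1.le, ← ENNReal.ofReal_mul h2.le,
          ← ENNReal.ofReal_add (mul_nonneg h1.le (mul_nonneg hr (hg0 x).le))
            (mul_nonneg h2.le (hgq0 x))]
        refine ENNReal.ofReal_le_ofReal ?_
        have := rpow_le_mul_add_rpow_neg h1 (by linarith) (hg0 x) hr
        rw [show 1 - (3 - p) = p - 2 by ring] at this
        rwa [mul_comm (ν.rnDeriv μ x).toReal]
    _ = ENNReal.ofReal (3 - p) * ∫⁻ x, ν.rnDeriv μ x * ENNReal.ofReal (g x) ∂μ +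
        ENNReal.ofReal (p - 2) * ∫⁻ x, ENNReal.ofReal (g x ^ (-s)) ∂μ := by
        have hρg' : Measurable fun x => ν.rnDeriv μ x * ENNReal.ofReal (g x) :=
          (Measure.measurable_rnDeriv ν μ).mul hgm.ennreal_ofReal
        rw [lintegral_add_left hρg, lintegral_const_mul _ hρg',
          lintegral_const_mul _ (hgm.pow_const _).ennreal_ofReal]
    _ ≤ _ := by
        gcongr
        exact le_add_self

variable [MetricSpace M]

lemma renyiEntropy_of_two_lt_toReal (hp : 2 < p) (hp3 : p < 3) (ν : WassersteinSpace p M)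
    (hfin : powerIntegral p μ ν.toMeasure ≠ ⊤) :
    renyiEntropy p μ ν = ((1 / ((3 - p) * (p - 2)) *
      (1 - (powerIntegral p μ ν.toMeasure).toReal) : ℝ) : EReal) := by
  have h1 : 0 < 3 - p := by linarith
  have h2 : 0 < p - 2 := by linarith
  have hc : 0 < 1 / ((3 - p) * (p - 2)) := by positivity
  rw [renyiEntropy_of_two_lt hp hp3 ν]
  generalize powerIntegral p μ ν.toMeasure = J at *
  lift J to NNReal using hfin
  rw [← ENNReal.ofReal_coe_nnreal, ← ENNReal.ofReal_mul hc.le, EReal.coe_ennreal_ofReal,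
    max_eq_left (by positivity), ← EReal.coe_sub, ENNReal.toReal_ofReal J.coe_nonneg]
  congr 1
  ring

variable [ProperSpace M] [BorelSpace M]

lemma powerIntegral_ne_top (hp : 2 < p) (hp3 : p < 3) {x₀ : M}
    (hw : Integrable (fun x => momentWeight p x₀ x ^ (-((3 - p) / (p - 2)))) μ)
    (ν : WassersteinSpace p M) : powerIntegral p μ ν.toMeasure ≠ ⊤ :=
  ne_top_of_le_ne_top ENNReal.ofReal_ne_top (powerIntegral_le_of_two_lt hp hp3
    (continuous_momentWeight p x₀).measurable
    (fun x => zero_lt_one.trans_le (one_le_momentWeight (by linarith) x₀ x))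
    (integrable_momentWeight (by linarith) ν x₀) hw)

/-- Near-optimality of `w φ` in the dual bound. With `b = δ w^(-1/(p-2))`, both integrals are
compared with `∫ (ρ + b)^(3-p)`, the first up to the cost of the floor `η`. The weights `3 - p` and
`p - 2` sum to one, and subadditivity of the power `3 - p < 1` splits off the `b` term. -/
lemma dual_perturbedDual_le (hp : 2 < p) (hp3 : p < 3) {x₀ : M}
    (hw : Integrable (fun x => momentWeight p x₀ x ^ (-((3 - p) / (p - 2)))) μ)
    (ν : WassersteinSpace p M) {S : Set M} (hS : MeasurableSet S) (hμS : ∀ᵐ x ∂μ, x ∉ S)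
    (hνS : ∀ᵐ x ∂(ν.toMeasure.singularPart μ), x ∈ S) {δ η : ℝ} (hδ : 0 < δ) (hη : 0 < η) :
    (3 - p) * (∫ x, momentWeight p x₀ x * perturbedDual p μ ν.toMeasure x₀ S δ η x ∂ν.toMeasure) +
      (p - 2) * ∫ x, (momentWeight p x₀ x * perturbedDual p μ ν.toMeasure x₀ S δ η x) ^
        (-((3 - p) / (p - 2))) ∂μ ≤
      (powerIntegral p μ ν.toMeasure).toReal + η * (∫ x, momentWeight p x₀ x ∂ν.toMeasure) +
        δ ^ (3 - p) * ∫ x, momentWeight p x₀ x ^ (-((3 - p) / (p - 2))) ∂μ := by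
  have h1 : 0 < 3 - p := by linarith
  have h2 : 0 < p - 2 := by linarith
  have hIfin := powerIntegral_ne_top hp hp3 hw ν
  have hWint := integrable_momentWeight (by linarith) ν x₀
  have hwm : Measurable (momentWeight p x₀) := (continuous_momentWeight p x₀).measurable
  have hw1 : ∀ x, 1 ≤ momentWeight p x₀ x := one_le_momentWeight (by linarith) x₀
  set w := momentWeight p x₀ with hwdef
  have hw0 : ∀ x, 0 < w x := fun x => zero_lt_one.trans_le (hw1 x)
  set s := (3 - p) / (p - 2) with hs
  have hs0 : 0 < s := by positivity
  set ρ : M → ℝ := fun x => (ν.toMeasure.rnDeriv μ x).toReal with hρ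
  have hρm : Measurable ρ := (Measure.measurable_rnDeriv _ _).ennreal_toReal
  have hρ0 : ∀ x, 0 ≤ ρ x := fun x => ENNReal.toReal_nonneg
  set b : M → ℝ := fun x => δ * w x ^ (-(1 / (p - 2))) with hb
  have hb0 : ∀ x, 0 < b x := fun x => mul_pos hδ (Real.rpow_pos_of_pos (hw0 x) _)
  have hbm : Measurable b := (hwm.pow_const _).const_mul δ
  have hba : ∀ x, b x ^ (3 - p) = δ ^ (3 - p) * w x ^ (-s) := fun x => by
    rw [hb, Real.mul_rpow hδ.le (Real.rpow_nonneg (hw0 x).le _), ← Real.rpow_mul (hw0 x).le,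
      show -(1 / (p - 2)) * (3 - p) = -s by rw [hs]; ring]
  set φ := perturbedDual p μ ν.toMeasure x₀ S δ η with hφ
  have hφm : Measurable φ := measurable_perturbedDual x₀ hS δ η
  have hφI : ∀ x, φ x ∈ Icc η (max η (δ ^ (2 - p))) := perturbedDual_mem_Icc hp x₀ S hδ η
  have hφ0 : ∀ x, 0 < φ x := fun x => hη.trans_le (hφI x).1
  set K := ∫ x, (ρ x + b x) ^ (3 - p) ∂μ with hK
  have hρpow : Integrable (fun x => ρ x ^ (3 - p)) μ := by
    refine ⟨(hρm.pow_const _).aestronglyMeasurable, ?_⟩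
    rw [hasFiniteIntegral_iff_ofReal (Eventually.of_forall fun x => Real.rpow_nonneg (hρ0 x) _)]
    have := lintegral_ofReal_mul_rpow_rnDeriv (μ := μ) (ν := ν.toMeasure) zero_le_one h1.le
    simp only [one_mul, ENNReal.ofReal_one] at this
    rw [this]
    exact hIfin.lt_top
  have hρint : ∫ x, ρ x ^ (3 - p) ∂μ = (powerIntegral p μ ν.toMeasure).toReal := by
    rw [integral_eq_lintegral_of_nonneg_ae
      (Eventually.of_forall fun x => Real.rpow_nonneg (hρ0 x) _)
      (hρm.pow_const _).aestronglyMeasurable]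
    have := lintegral_ofReal_mul_rpow_rnDeriv (μ := μ) (ν := ν.toMeasure) zero_le_one h1.le
    simp only [one_mul, ENNReal.ofReal_one] at this
    rw [this, powerIntegral]
  have hbint : Integrable (fun x => b x ^ (3 - p)) μ := by
    simp only [hba]
    exact hw.const_mul _
  have hle : ∀ x, (ρ x + b x) ^ (3 - p) ≤ ρ x ^ (3 - p) + b x ^ (3 - p) := fun x =>
    Real.rpow_add_le_add_rpow (hρ0 x) (hb0 x).le h1.le (by linarith)
  have hsum0 : ∀ x, 0 < ρ x + b x := fun x => add_pos_of_nonneg_of_pos (hρ0 x) (hb0 x)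
  have hKint : Integrable (fun x => (ρ x + b x) ^ (3 - p)) μ := by
    refine (hρpow.add hbint).mono' ((hρm.add hbm).pow_const _).aestronglyMeasurable
      (Eventually.of_forall fun x => ?_)
    rw [Real.norm_of_nonneg (Real.rpow_nonneg (hsum0 x).le _)]
    exact hle x
  have hKle : K ≤ (powerIntegral p μ ν.toMeasure).toReal + δ ^ (3 - p) * ∫ x, w x ^ (-s) ∂μ := by
    rw [← hρint, ← integral_const_mul, ← integral_add hρpow (hw.const_mul _)]
    refine integral_mono hKint (hρpow.add (hw.const_mul _)) fun x => ?_
    simp only [← hba]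
    exact hle x
  have hK0 : 0 ≤ K := integral_nonneg fun x => Real.rpow_nonneg (hsum0 x).le _
  have hX : ∫ x, w x * φ x ∂ν.toMeasure ≤ η * (∫ x, w x ∂ν.toMeasure) + K := by
    have hW0 : 0 ≤ ∫ x, w x ∂ν.toMeasure := integral_nonneg fun x => (hw0 x).le
    have hint : Integrable (fun x => w x * φ x) ν.toMeasure := by
      refine (hWint.mul_const (max η (δ ^ (2 - p)))).mono' (hwm.mul hφm).aestronglyMeasurable
        (Eventually.of_forall fun x => ?_)
      rw [Real.norm_of_nonneg (mul_pos (hw0 x) (hφ0 x)).le]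
      exact mul_le_mul_of_nonneg_left (hφI x).2 (hw0 x).le
    have m₁ : Measurable fun x => ENNReal.ofReal (w x * φ x) := (hwm.mul hφm).ennreal_ofReal
    have m₂ : Measurable fun x => ENNReal.ofReal ((ρ x + b x) ^ (3 - p)) :=
      ((hρm.add hbm).pow_const _).ennreal_ofReal
    refine (ENNReal.ofReal_le_ofReal_iff (by positivity)).1 ?_
    rw [ENNReal.ofReal_add (by positivity) hK0, ← integral_const_mul,
      ofReal_integral_eq_lintegral_ofReal hint
        (Eventually.of_forall fun x => (mul_pos (hw0 x) (hφ0 x)).le),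
      ofReal_integral_eq_lintegral_ofReal (hWint.const_mul η)
        (Eventually.of_forall fun x => (mul_pos hη (hw0 x)).le), hK,
      ofReal_integral_eq_lintegral_ofReal hKint
        (Eventually.of_forall fun x => Real.rpow_nonneg (hsum0 x).le _),
      lintegral_eq_singularPart_add_rnDeriv (μ := μ) m₁,
      lintegral_eq_singularPart_add_rnDeriv (μ := μ) (hwm.const_mul η).ennreal_ofReal, add_assoc,
      ← lintegral_add_right _ m₂]
    refine add_le_add (lintegral_mono_ae (hνS.mono fun x hx => ?_)) (lintegral_mono_ae ?_)
    · refine ENNReal.ofReal_le_ofReal ?_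
      simp only [hφ, perturbedDual, if_pos hx, max_eq_left hη.le]
      exact (mul_comm _ _).le
    · filter_upwards [hμS, Measure.rnDeriv_lt_top ν.toMeasure μ] with x hx hxt
      rw [← ENNReal.ofReal_toReal hxt.ne, ← ENNReal.ofReal_mul (hρ0 x),
        ← ENNReal.ofReal_mul (hρ0 x),
        ← ENNReal.ofReal_add (mul_nonneg (hρ0 x) (mul_pos hη (hw0 x)).le)
          (Real.rpow_nonneg (hsum0 x).le _)]
      refine ENNReal.ofReal_le_ofReal ?_
      have hφx : w x * φ x ≤ η * w x + (ρ x + b x) ^ (2 - p) := by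
        have h3 : φ x = max η ((ρ x + b x) ^ (2 - p) / w x) := by
          simp only [hφ, perturbedDual, if_neg hx, hρ, hb, hwdef]
        have h4 : 0 ≤ (ρ x + b x) ^ (2 - p) / w x :=
          div_nonneg (Real.rpow_nonneg (hsum0 x).le _) (hw0 x).le
        calc w x * φ x ≤ w x * (η + (ρ x + b x) ^ (2 - p) / w x) := by
              rw [h3]
              refine mul_le_mul_of_nonneg_left ?_ (hw0 x).le
              exact max_le (by linarith) (by linarith)
          _ = _ := by field_simp [(hw0 x).ne']
      have hpow : ρ x * (ρ x + b x) ^ (2 - p) ≤ (ρ x + b x) ^ (3 - p) := by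
        rw [show 3 - p = (2 - p) + 1 by ring, Real.rpow_add_one (hsum0 x).ne', mul_comm]
        exact mul_le_mul_of_nonneg_left (le_add_of_nonneg_right (hb0 x).le)
          (Real.rpow_nonneg (hsum0 x).le _)
      calc ρ x * (w x * φ x) ≤ ρ x * (η * w x + (ρ x + b x) ^ (2 - p)) :=
            mul_le_mul_of_nonneg_left hφx (hρ0 x)
        _ ≤ _ := by rw [mul_add]; gcongr
  have hY : ∫ x, (w x * φ x) ^ (-s) ∂μ ≤ K := by
    have hint : Integrable (fun x => (w x * φ x) ^ (-s)) μ := by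
      refine (hw.mul_const (η ^ (-s))).mono' ((hwm.mul hφm).pow_const _).aestronglyMeasurable
        (Eventually.of_forall fun x => ?_)
      rw [Real.norm_of_nonneg (Real.rpow_nonneg (mul_pos (hw0 x) (hφ0 x)).le _),
        Real.mul_rpow (hw0 x).le (hφ0 x).le]
      exact mul_le_mul_of_nonneg_left
        (Real.rpow_le_rpow_of_nonpos hη (hφI x).1 (by linarith)) (Real.rpow_nonneg (hw0 x).le _)
    refine integral_mono_ae hint hKint (hμS.mono fun x hx => ?_)
    have h3 : (ρ x + b x) ^ (2 - p) ≤ w x * φ x := by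
      have h4 : (ρ x + b x) ^ (2 - p) / w x ≤ φ x := by
        simp only [hφ, perturbedDual, if_neg hx, hρ, hb, hwdef]
        exact le_max_right _ _
      rw [div_le_iff₀ (hw0 x)] at h4
      linarith
    calc (w x * φ x) ^ (-s) ≤ ((ρ x + b x) ^ (2 - p)) ^ (-s) :=
          Real.rpow_le_rpow_of_nonpos (Real.rpow_pos_of_pos (hsum0 x) _) h3 (by linarith)
      _ = (ρ x + b x) ^ (3 - p) := by
          rw [← Real.rpow_mul (hsum0 x).le, show (2 - p) * -s = 3 - p by
            rw [hs]; field_simp; ring]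
  have hW0 : 0 ≤ η * ∫ x, w x ∂ν.toMeasure :=
    mul_nonneg hη.le (integral_nonneg fun x => (hw0 x).le)
  nlinarith

/-- For `2 < p < 3` the functional `𝒰_p` is lower semicontinuous, provided that
`(1 + d)^(-p (3 - p) / (p - 2))` is integrable. -/
theorem lowerSemicontinuous_renyiEntropy_of_two_lt (hp1 : 1 ≤ p) (hp : 2 < p) (hp3 : p < 3) {x₀ : M}
    (hw : Integrable (fun x => momentWeight p x₀ x ^ (-((3 - p) / (p - 2)))) μ) :
    letI := wassersteinPseudoMetric (M := M) hp1
    LowerSemicontinuous (renyiEntropy (M := M) p μ) := by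
  have h1 : 0 < 3 - p := by linarith
  have h2 : 0 < p - 2 := by linarith
  have hc : 0 < 1 / ((3 - p) * (p - 2)) := by positivity
  refine lowerSemicontinuous_of_affine_minorants hp1 fun ν r hr => ?_
  have hwc := continuous_momentWeight p x₀
  have hw1 : ∀ x, 1 ≤ momentWeight p x₀ x := one_le_momentWeight (by linarith) x₀
  have hw0 : ∀ x, 0 < momentWeight p x₀ x := fun x => zero_lt_one.trans_le (hw1 x)
  rw [renyiEntropy_of_two_lt_toReal hp hp3 ν (powerIntegral_ne_top hp hp3 hw ν),
    EReal.coe_lt_coe_iff] at hr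
  set c := 1 / ((3 - p) * (p - 2)) with hcdef
  set s := (3 - p) / (p - 2) with hs
  have hs0 : 0 < s := by positivity
  set J := (powerIntegral p μ ν.toMeasure).toReal with hJ
  set W := ∫ x, momentWeight p x₀ x ∂ν.toMeasure with hW
  set H := ∫ x, momentWeight p x₀ x ^ (-s) ∂μ with hH
  have hW0 : 0 ≤ W := integral_nonneg fun x => (hw0 x).le
  have hH0 : 0 ≤ H := integral_nonneg fun x => Real.rpow_nonneg (hw0 x).le _
  set ε := (1 - J - r / c) with hε
  have hε0 : 0 < ε := by
    have : r / c < 1 - J := by rw [div_lt_iff₀ hc]; linarith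
    linarith
  -- `η` and `δ` make the two error terms of `dual_perturbedDual_le` smaller than `ε / 2` each,
  -- where `ε` is the gap left by `r`.
  set η := ε / (4 * (W + 1)) with hη
  have hη0 : 0 < η := by positivity
  have hηW : η * W < ε / 2 := by
    rw [hη, div_mul_eq_mul_div, div_lt_iff₀ (by positivity)]
    nlinarith
  set δ := (ε / (4 * (H + 1))) ^ (1 / (3 - p)) with hδ
  have hδ0 : 0 < δ := Real.rpow_pos_of_pos (by positivity) _
  have hδH : δ ^ (3 - p) * H < ε / 2 := by
    rw [hδ, ← Real.rpow_mul (by positivity), one_div_mul_cancel h1.ne', Real.rpow_one,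
      div_mul_eq_mul_div, div_lt_iff₀ (by positivity)]
    nlinarith
  obtain ⟨S, hS, hμS, hνS⟩ := exists_measurableSet_singularPart μ ν.toMeasure
  have hdual := dual_perturbedDual_le hp hp3 hw ν hS hμS hνS hδ0 hη0
  have hφI := perturbedDual_mem_Icc (μ := μ) (ν := ν.toMeasure) hp x₀ S hδ0 η
  have hφm := measurable_perturbedDual (p := p) (μ := μ) (ν := ν.toMeasure) x₀ hS δ η
  set φ := perturbedDual p μ ν.toMeasure x₀ S δ η with hφ
  set β := max η (δ ^ (2 - p)) with hβ
  rw [← hs, ← hJ, ← hW, ← hH] at hdual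
  obtain ⟨φs, hφsc, hφsI, hlim1, hlim2⟩ := exists_continuous_tendsto_integral hwc
    (fun x => (hw0 x).le) (integrable_momentWeight hp1 ν x₀) hw hη0.le (B := η ^ (-s)) (β := β)
    (continuousOn_id.rpow_const fun t ht => Or.inl (hη0.trans_le ht.1).ne')
    (fun t ht => Real.rpow_le_rpow_of_nonpos hη0 ht.1 (by linarith)) hφm hφI
  have hlim := (hlim1.const_mul (3 - p)).add (hlim2.const_mul (p - 2))
  have hlt : (3 - p) * (∫ x, momentWeight p x₀ x * φ x ∂ν.toMeasure) +
      (p - 2) * ∫ x, (momentWeight p x₀ x * φ x) ^ (-s) ∂μ < 1 - r / c := by linarith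
  obtain ⟨n, hn⟩ := (hlim.eventually (gt_mem_nhds hlt)).exists
  have hg0 : ∀ x, 0 < momentWeight p x₀ x * φs n x := fun x =>
    mul_pos (hw0 x) (hη0.trans_le (hφsI n x).1)
  have hgb : ∀ x, momentWeight p x₀ x * φs n x ≤ β * momentWeight p x₀ x := fun x => by
    rw [mul_comm β]
    exact mul_le_mul_of_nonneg_left (hφsI n x).2 (hw0 x).le
  have hgc : Continuous fun x => momentWeight p x₀ x * φs n x := hwc.mul (hφsc n)
  have hgμ : Integrable (fun x => (momentWeight p x₀ x * φs n x) ^ (-s)) μ := by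
    refine (hw.mul_const (η ^ (-s))).mono' (hgc.measurable.pow_const _).aestronglyMeasurable
      (Eventually.of_forall fun x => ?_)
    rw [Real.norm_of_nonneg (Real.rpow_nonneg (hg0 x).le _),
      Real.mul_rpow (hw0 x).le (hη0.le.trans (hφsI n x).1)]
    exact mul_le_mul_of_nonneg_left
      (Real.rpow_le_rpow_of_nonpos hη0 (hφsI n x).1 (by linarith)) (Real.rpow_nonneg (hw0 x).le _)
  have hc3 : 0 ≤ c * (3 - p) := by positivity
  refine ⟨x₀, fun x => -(c * (3 - p)) * (momentWeight p x₀ x * φs n x), c * (3 - p) * β,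
    c * (1 - (p - 2) * ∫ x, (momentWeight p x₀ x * φs n x) ^ (-s) ∂μ),
    continuous_const.mul hgc, fun x => ?_, ?_, fun ν' => ?_⟩
  · rw [abs_mul, abs_neg, abs_of_nonneg hc3, abs_of_nonneg (hg0 x).le, mul_assoc _ β]
    exact mul_le_mul_of_nonneg_left (hgb x) hc3
  · rw [integral_const_mul]
    rw [lt_sub_comm, div_lt_iff₀ hc] at hn
    linarith
  · have hgν : Integrable (fun x => momentWeight p x₀ x * φs n x) ν'.toMeasure := by
      refine ((integrable_momentWeight hp1 ν' x₀).const_mul β).mono' hgc.aestronglyMeasurable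
        (Eventually.of_forall fun x => ?_)
      rw [Real.norm_of_nonneg (hg0 x).le]
      exact hgb x
    have hle := powerIntegral_le_of_two_lt (μ := μ) (ν := ν'.toMeasure) hp hp3 hgc.measurable hg0
      hgν hgμ
    rw [renyiEntropy_of_two_lt_toReal hp hp3 ν' (powerIntegral_ne_top hp hp3 hw ν'),
      EReal.coe_le_coe_iff, integral_const_mul, ← hcdef]
    have hX : 0 ≤ ∫ x, momentWeight p x₀ x * φs n x ∂ν'.toMeasure :=
      integral_nonneg fun x => (hg0 x).le
    have hY : 0 ≤ ∫ x, (momentWeight p x₀ x * φs n x) ^ (-s) ∂μ :=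
      integral_nonneg fun x => Real.rpow_nonneg (hg0 x).le _
    have hle' := ENNReal.toReal_mono ENNReal.ofReal_ne_top hle
    rw [ENNReal.toReal_ofReal (by positivity), ← hs] at hle'
    have := mul_le_mul_of_nonneg_left hle' hc.le
    linarith

end LargeExponent

/-! ### `U_p` in the strong curvature condition -/

section SmallExponent

variable {p : ℝ}

/-- The transformed function is a positive multiple of `e^(-(2-p)s) - 1`. -/
lemma dcInfty_renyiU (hp1 : 1 < p) (hp : p < 2) : DCInfty (renyiU p) := by
  have h1 : 0 < 3 - p := by linarith
  have h2 : 0 < 2 - p := by linarith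
  have hc : 0 ≤ 1 / ((3 - p) * (2 - p)) := by positivity
  refine ⟨?_, ?_, ?_, ?_⟩
  · exact ((Real.continuous_rpow_const h1.le).sub continuous_id).const_smul
      (1 / ((3 - p) * (2 - p))) |>.continuousOn
  · exact ((convexOn_rpow (p := 3 - p) (by linarith)).sub
      (concaveOn_id (convex_Ici (0 : ℝ)))).smul hc
  · simp [renyiU, Real.zero_rpow h1.ne']
  · have e : (fun s : ℝ => Real.exp s * renyiU p (Real.exp (-s))) =
        fun s : ℝ => (1 / ((3 - p) * (2 - p))) • (Real.exp (-(2 - p) • s) - 1) := by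
      funext s
      have e1 : Real.exp s * Real.exp (-s) ^ (3 - p) = Real.exp (-(2 - p) • s) := by
        rw [← Real.exp_mul, ← Real.exp_add, smul_eq_mul]
        ring_nf
      have e2 : Real.exp s * Real.exp (-s) = 1 := by rw [← Real.exp_add]; simp
      rw [renyiU, smul_eq_mul, ← e1]
      linear_combination (-(1 / ((3 - p) * (2 - p)))) * e2
    rw [e]
    have hexp : ConvexOn ℝ univ fun s : ℝ => Real.exp (-(2 - p) • s) :=
      convexOn_exp.comp_linearMap (LinearMap.lsmul ℝ ℝ (-(2 - p)))
    exact (hexp.sub (concaveOn_const 1 convex_univ)).smul hc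

lemma distorted_renyiU {β ρ : ℝ} (hβ : 0 < β) (hρ : 0 < ρ) :
    distorted (renyiU p) β ρ = 1 / ((3 - p) * (2 - p)) * ((ρ / β) ^ (2 - p) - 1) := by
  have hr : 0 < ρ / β := by positivity
  have e : (ρ / β) ^ (3 - p) = (ρ / β) ^ (2 - p) * (ρ / β) := by
    rw [← Real.rpow_add_one hr.ne']
    ring_nf
  have e2 : β / ρ * (ρ / β) = 1 := by field_simp
  rw [distorted, renyiU, e]
  linear_combination (1 / ((3 - p) * (2 - p)) * ((ρ / β) ^ (2 - p) - 1)) * e2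

lemma neg_le_distorted_renyiU (hp : p < 2) {β ρ : ℝ} (hβ : 0 < β) (hρ : 0 ≤ ρ) :
    -distorted (renyiU p) β ρ ≤ 1 / ((3 - p) * (2 - p)) := by
  have h1 : 0 < 3 - p := by linarith
  have h2 : 0 < 2 - p := by linarith
  have hc : 0 < 1 / ((3 - p) * (2 - p)) := by positivity
  -- At zero density division by zero makes `distorted` vanish.
  rcases hρ.eq_or_lt with rfl | hρ
  · simpa [distorted] using hc.le
  · rw [distorted_renyiU hβ hρ]
    have : 0 ≤ (ρ / β) ^ (2 - p) := by positivity
    nlinarith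

lemma distorted_renyiU_le (hp : p < 2) {β ρ : ℝ} (hβ : 1 ≤ β) (hρ : 0 < ρ) :
    distorted (renyiU p) β ρ ≤
      1 / ((3 - p) * (2 - p)) * ρ ^ (2 - p) - 1 / ((3 - p) * (2 - p)) := by
  have h1 : 0 < 3 - p := by linarith
  have h2 : 0 < 2 - p := by linarith
  have hc : 0 < 1 / ((3 - p) * (2 - p)) := by positivity
  rw [distorted_renyiU (by linarith) hρ, mul_sub, mul_one]
  gcongr
  exact div_le_self hρ.le hβ

variable {M : Type*} [MeasurableSpace M] {μ : Measure M} [SigmaFinite μ]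

/-- Changing from `ν` to `μ` contributes one factor of the density. Where the density vanishes both
integrands are zero, even if `a < 1` makes the power infinite. -/
lemma lintegral_rpow_rnDeriv_sub_one {ν : Measure M} [SigmaFinite ν] (hν : ν ≪ μ) {a : ℝ}
    (ha : 0 < a) : ∫⁻ x, ν.rnDeriv μ x ^ (a - 1) ∂ν = ∫⁻ x, ν.rnDeriv μ x ^ a ∂μ := by
  have hm : Measurable fun x => ν.rnDeriv μ x ^ (a - 1) :=
    (Measure.measurable_rnDeriv ν μ).pow_const _
  rw [← lintegral_rnDeriv_mul hν hm.aemeasurable]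
  refine lintegral_congr_ae ?_
  filter_upwards [Measure.rnDeriv_lt_top ν μ] with x hx
  rcases eq_or_ne (ν.rnDeriv μ x) 0 with h0 | h0
  · simp [h0, ha]
  · nth_rewrite 1 [← ENNReal.rpow_one (ν.rnDeriv μ x)]
    rw [← ENNReal.rpow_add _ _ h0 hx.ne]
    ring_nf

variable {Ω : Type*} [MeasurableSpace Ω] {π : Measure Ω} [IsProbabilityMeasure π]

lemma lintegral_neg_distorted_renyiU_ne_top (hp : p < 2) {β : Ω → ℝ} (hβ : ∀ z, 1 ≤ β z)
    (ρ : Ω → ℝ≥0∞) :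
    ∫⁻ z, ENNReal.ofReal (-distorted (renyiU p) (β z) (ρ z).toReal) ∂π ≠ ⊤ := by
  refine ne_top_of_le_ne_top (b := ENNReal.ofReal (1 / ((3 - p) * (2 - p))))
    ENNReal.ofReal_ne_top ?_
  calc _ ≤ ∫⁻ _, ENNReal.ofReal (1 / ((3 - p) * (2 - p))) ∂π :=
        lintegral_mono fun z => ENNReal.ofReal_le_ofReal
          (neg_le_distorted_renyiU hp (by linarith [hβ z]) ENNReal.toReal_nonneg)
    _ = _ := by simp

variable [MetricSpace M] {q : Ω → M}

/-- Coefficients `β ≥ 1` only lower the integrand. What remains depends on one marginal, and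
`ρ^(2-p) ν = ρ^(3-p) μ`. -/
lemma extIntegral_distorted_renyiU_le (hp : p < 2) {ν : WassersteinSpace p M}
    (hν : ν.toMeasure ≪ μ) (hq : Measurable q) (hπ : π.map q = ν.toMeasure) {β : Ω → ℝ}
    (hβ : ∀ z, 1 ≤ β z) :
    extIntegral π (fun z => distorted (renyiU p) (β z) (ν.toMeasure.rnDeriv μ (q z)).toReal) ≤
      renyiEntropy p μ ν := by
  have h1 : 0 < 3 - p := by linarith
  have h2 : 0 < 2 - p := by linarith
  have hc : 0 < 1 / ((3 - p) * (2 - p)) := by positivity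
  have hρm : Measurable fun x => ν.toMeasure.rnDeriv μ x := Measure.measurable_rnDeriv _ _
  have hpos : ∀ᵐ z ∂π, 0 < (ν.toMeasure.rnDeriv μ (q z)).toReal := by
    refine ae_of_ae_map hq.aemeasurable (p := fun x => 0 < (ν.toMeasure.rnDeriv μ x).toReal) ?_
    rw [hπ]
    filter_upwards [Measure.rnDeriv_pos hν, hν.ae_le (Measure.rnDeriv_lt_top ν.toMeasure μ)]
      with x h0 ht using ENNReal.toReal_pos h0.ne' ht.ne
  have hA : ∫⁻ z, ENNReal.ofReal
      (1 / ((3 - p) * (2 - p)) * (ν.toMeasure.rnDeriv μ (q z)).toReal ^ (2 - p)) ∂π =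
      ENNReal.ofReal (1 / ((3 - p) * (2 - p))) * powerIntegral p μ ν.toMeasure := by
    have hm : Measurable fun x => ENNReal.ofReal
        (1 / ((3 - p) * (2 - p)) * (ν.toMeasure.rnDeriv μ x).toReal ^ (2 - p)) :=
      ((hρm.ennreal_toReal.pow_const _).const_mul _).ennreal_ofReal
    have hm2 : Measurable fun x => ν.toMeasure.rnDeriv μ x ^ (2 - p) := hρm.pow_const _
    have e := lintegral_rpow_rnDeriv_sub_one hν h1
    rw [show 3 - p - 1 = 2 - p by ring] at e
    rw [← lintegral_map hm hq, hπ, powerIntegral, ← e, ← lintegral_const_mul _ hm2]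
    refine lintegral_congr_ae ?_
    filter_upwards [hν.ae_le (Measure.rnDeriv_lt_top ν.toMeasure μ)] with x hx
    rw [ENNReal.ofReal_mul hc.le, ← ENNReal.ofReal_rpow_of_nonneg ENNReal.toReal_nonneg h2.le,
      ENNReal.ofReal_toReal hx.ne]
  have hAm : Measurable fun z =>
      1 / ((3 - p) * (2 - p)) * (ν.toMeasure.rnDeriv μ (q z)).toReal ^ (2 - p) :=
    ((hρm.comp hq).ennreal_toReal.pow_const _).const_mul _
  have key := extIntegral_sub_of_nonneg (μ := π) hAm.aemeasurable
    (aemeasurable_const (b := 1 / ((3 - p) * (2 - p))))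
    (fun z => mul_nonneg hc.le (Real.rpow_nonneg ENNReal.toReal_nonneg _)) (fun _ => hc.le)
    (Or.inr (by simp))
  rw [renyiEntropy_of_lt_two hp ν hν, ← hA]
  refine (extIntegral_mono (hpos.mono fun z hz => distorted_renyiU_le hp (hβ z) hz)).trans
    (key.le.trans_eq ?_)
  congr 1
  rw [lintegral_const, measure_univ, mul_one, EReal.coe_ennreal_ofReal, max_eq_left hc.le]

end SmallExponent

/-! ### Approximate convexity for `p < 2` -/

section Convexity

lemma one_le_betaInfty {M : Type*} [MetricSpace M] {K s : ℝ} (hK : 0 ≤ K)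
    (hs : s ∈ Icc (0 : ℝ) 1) (x y : M) :
    1 ≤ betaInfty K s x y := by
  rw [betaInfty, Real.one_le_exp_iff]
  have : 0 ≤ 1 - s ^ 2 := by nlinarith [hs.1, hs.2]
  positivity

variable {M : Type*} [MeasurableSpace M] [MetricSpace M]
  {μ : Measure M} [SigmaFinite μ] {p : ℝ}

lemma renyiEntropy_ne_bot_of_lt_two (hp : p < 2) (ν : WassersteinSpace p M) :
    renyiEntropy p μ ν ≠ ⊥ := by
  by_cases hν : ν.toMeasure ≪ μ
  · rw [renyiEntropy_of_lt_two hp ν hν, sub_eq_add_neg, ← EReal.coe_neg]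
    refine ne_of_gt (EReal.bot_lt_add_iff.2 ⟨?_, EReal.bot_lt_coe _⟩)
    exact lt_of_lt_of_le EReal.bot_lt_zero (EReal.coe_ennreal_nonneg _)
  · rw [renyiEntropy_eq_top_of_not_absolutelyContinuous hp ν hν]
    exact top_ne_bot

lemma exists_geodesic_renyiEntropy_le (hp1 : 1 < p) (hp : p < 2)
    {K : ℝ} (hK : 0 ≤ K) (h : StrongCDInfty p K μ) {ν₀ ν₁ : WassersteinSpace p M}
    (h0 : ν₀.toMeasure ≪ μ) (h1 : ν₁.toMeasure ≪ μ) :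
    ∃ γ : ℝ → WassersteinSpace p M, IsGeodesicFromTo (wDist p) γ ν₀ ν₁ ∧
      ∀ t ∈ Icc (0 : ℝ) 1, renyiEntropy p μ (γ t) ≤
        ((1 - t : ℝ) : EReal) * renyiEntropy p μ ν₀ + (t : EReal) * renyiEntropy p μ ν₁ := by
  obtain ⟨γ, hγ, π, hπ, hU⟩ := h ν₀ ν₁ h0 h1
  refine ⟨γ, hγ, fun t ht' => ?_⟩
  have ht'' : 1 - t ∈ Icc (0 : ℝ) 1 := ⟨by linarith [ht'.2], by linarith [ht'.1]⟩
  have := hπ.1.isProbabilityMeasure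
  have hb₀ : ∀ z : M × M, 1 ≤ betaInfty K (1 - t) z.1 z.2 :=
    fun z => one_le_betaInfty hK ht'' z.1 z.2
  have hb₁ : ∀ z : M × M, 1 ≤ betaInfty K t z.1 z.2 := fun z => one_le_betaInfty hK ht' z.1 z.2
  have hn₀ := lintegral_neg_distorted_renyiU_ne_top (π := π) hp hb₀
    (fun z => ν₀.toMeasure.rnDeriv μ z.1)
  have hn₁ := lintegral_neg_distorted_renyiU_ne_top (π := π) hp hb₁
    (fun z => ν₁.toMeasure.rnDeriv μ z.2)
  have hle := hU t ht' (renyiU p) (dcInfty_renyiU hp1 hp) hn₀ hn₁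
  have hle₀ := extIntegral_distorted_renyiU_le hp h0 measurable_fst hπ.1.1 hb₀
  have hle₁ := extIntegral_distorted_renyiU_le hp h1 measurable_snd hπ.1.2 hb₁
  exact hle.trans (add_le_add
    (mul_le_mul_of_nonneg_left hle₀ (EReal.coe_nonneg.2 ht''.1))
    (mul_le_mul_of_nonneg_left hle₁ (EReal.coe_nonneg.2 ht'.1)))

variable [ProperSpace M] [BorelSpace M]

/-- Finite energy forces absolute continuity, so the curvature condition applies to the end points
themselves and its geodesic needs no error term. -/
lemma approxConvex_renyiEntropy_of_strongCDInfty (hp1 : 1 ≤ p) (hp1' : 1 < p) (hp : p < 2)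
    {K : ℝ} (hK : 0 ≤ K) (h : StrongCDInfty p K μ) :
    letI := wassersteinPseudoMetric (M := M) hp1
    ApproxConvex (renyiEntropy (M := M) p μ) := by
  let _ := wassersteinPseudoMetric (M := M) hp1
  intro ν₀ hν₀ ν₁ hν₁ t ht ε hε
  have hac : ∀ ν ∈ finiteDomain (renyiEntropy (M := M) p μ), ν.toMeasure ≪ μ := fun ν hν =>
    by_contra fun hn => hν.1 (renyiEntropy_eq_top_of_not_absolutelyContinuous hp ν hn)
  have ht' : t ∈ Icc (0 : ℝ) 1 := Ioo_subset_Icc_self ht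
  obtain ⟨γ, hγ, hU⟩ := exists_geodesic_renyiEntropy_le hp1' hp hK h (hac _ hν₀) (hac _ hν₁)
  refine ⟨γ t, ?_, ?_⟩
  · have hd := hγ.2.2 0 ⟨le_rfl, zero_le_one⟩ t ht'
    rw [hγ.1, sub_zero, abs_of_pos ht.1] at hd
    calc edist ν₀ (γ t) = ENNReal.ofReal t * edist ν₀ ν₁ := hd
      _ = ENNReal.ofReal (t * dist ν₀ ν₁) := by
        rw [edist_dist, ← ENNReal.ofReal_mul ht.1.le]
      _ ≤ _ := ENNReal.ofReal_le_ofReal (by linarith)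
  · calc renyiEntropy p μ (γ t)
        ≤ ((1 - t : ℝ) : EReal) * renyiEntropy p μ ν₀ + (t : EReal) * renyiEntropy p μ ν₁ :=
          hU t ht'
      _ = (((1 - t) * (renyiEntropy p μ ν₀).toReal + t * (renyiEntropy p μ ν₁).toReal : ℝ) :
          EReal) := by
          rw [EReal.coe_add, EReal.coe_mul, EReal.coe_mul, EReal.coe_toReal hν₀.1 hν₀.2,
            EReal.coe_toReal hν₁.1 hν₁.2]
      _ ≤ _ := EReal.coe_le_coe_iff.2 (by linarith)

end Convexity

/-! ### Consequences of Ahlfors regularity -/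

section Ahlfors

/-- Dyadic comparison: choose `k` with `2^k ≤ 1 + d < 2^(k+1)` and keep the `k`-th term. -/
lemma ofReal_one_add_dist_rpow_le_tsum {M : Type*} [MetricSpace M] {q : ℝ} (hq : 0 ≤ q) (x₀ x : M) :
    ENNReal.ofReal ((1 + dist x x₀) ^ (-q)) ≤
      ∑' k : ℕ, (Metric.ball x₀ (2 ^ (k + 1))).indicator
        (fun _ => ENNReal.ofReal ((2 ^ k : ℝ) ^ (-q))) x := by
  obtain ⟨k, hk1, hk2⟩ := exists_nat_pow_near
    (show (1 : ℝ) ≤ 1 + dist x x₀ by linarith [dist_nonneg (x := x) (y := x₀)])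
    (one_lt_two : (1 : ℝ) < 2)
  refine le_trans ?_ (ENNReal.le_tsum k)
  rw [indicator_of_mem (by rw [Metric.mem_ball]; linarith)]
  exact ENNReal.ofReal_le_ofReal
    (Real.rpow_le_rpow_of_nonpos (by positivity) hk1 (by linarith))

variable {M : Type*} [MetricSpace M] [MeasurableSpace M] {μ : Measure M} {n : ℝ}

/-- Needs two points: on a single point the diameter is zero and regularity imposes nothing. -/
lemma AhlforsRegular.isOpenPosMeasure [Nontrivial M] (h : AhlforsRegular n μ) :
    μ.IsOpenPosMeasure := by
  obtain ⟨c, C, hc, -, h⟩ := h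
  refine ⟨fun U hU ⟨x, hx⟩ h0 => ?_⟩
  obtain ⟨ε, hε, hεU⟩ := Metric.isOpen_iff.1 hU x hx
  have hd : 0 < Metric.ediam (univ : Set M) := Metric.ediam_pos_iff.2 nontrivial_univ
  obtain ⟨r, hr0, hr⟩ := ENNReal.lt_iff_exists_nnreal_btwn.1
    (lt_min hd (ENNReal.ofReal_pos.2 hε))
  have hr0' : (0 : ℝ) < r := by exact_mod_cast hr0
  have hrε : (r : ℝ) < ε := by
    have := hr.trans_le (min_le_right _ _)
    rw [← ENNReal.ofReal_coe_nnreal] at this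
    exact (ENNReal.ofReal_lt_ofReal_iff hε).1 this
  have h1 := (h x r hr0' (by
    rw [ENNReal.ofReal_coe_nnreal]; exact (hr.trans_le (min_le_left _ _)).le)).1
  have h2 : 0 < ENNReal.ofReal (c * (r : ℝ) ^ n) :=
    ENNReal.ofReal_pos.2 (mul_pos hc (Real.rpow_pos_of_pos hr0' n))
  exact (h2.trans_le (h1.trans (measure_mono ((Metric.ball_subset_ball hrε.le).trans hεU)))).ne' h0

/-- In an unbounded space the dyadic sum is geometric with ratio `2^(n-q) < 1`. A bounded proper
space is compact and has finite measure. -/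
lemma AhlforsRegular.integrable_one_add_dist_rpow [ProperSpace M] [BorelSpace M]
    [IsLocallyFiniteMeasure μ] (h : AhlforsRegular n μ) {q : ℝ} (hq : 0 < q) (hnq : n < q)
    (x₀ : M) : Integrable (fun x => (1 + dist x x₀) ^ (-q)) μ := by
  have hpos : ∀ x, 0 < 1 + dist x x₀ := fun x => by linarith [dist_nonneg (x := x) (y := x₀)]
  have hcont : Continuous fun x => (1 + dist x x₀) ^ (-q) :=
    (continuous_const.add (continuous_id.dist continuous_const)).rpow_const
      fun x => Or.inl (hpos x).ne'
  refine ⟨hcont.aestronglyMeasurable, ?_⟩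
  rw [hasFiniteIntegral_iff_ofReal (.of_forall fun x => Real.rpow_nonneg (hpos x).le _)]
  by_cases hd : Metric.ediam (univ : Set M) = ⊤
  · obtain ⟨c, C, -, hC, h⟩ := h
    have hm : ∀ k : ℕ, Measurable ((Metric.ball x₀ (2 ^ (k + 1))).indicator
        (fun _ : M => ENNReal.ofReal ((2 ^ k : ℝ) ^ (-q)))) := fun k =>
      measurable_const.indicator Metric.isOpen_ball.measurableSet
    refine (lintegral_mono fun x => ofReal_one_add_dist_rpow_le_tsum hq.le x₀ x).trans_lt ?_
    rw [lintegral_tsum fun k => (hm k).aemeasurable]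
    have hle : ∀ k : ℕ, ∫⁻ x, (Metric.ball x₀ (2 ^ (k + 1))).indicator
        (fun _ => ENNReal.ofReal ((2 ^ k : ℝ) ^ (-q))) x ∂μ ≤
        ENNReal.ofReal (C * 2 ^ n * ((2 : ℝ) ^ (n - q)) ^ k) := fun k => by
      rw [lintegral_indicator_const Metric.isOpen_ball.measurableSet]
      have h2 := (h x₀ (2 ^ (k + 1)) (by positivity) (by rw [hd]; exact le_top)).2
      refine (mul_le_mul_right h2 _).trans_eq ?_
      rw [← ENNReal.ofReal_mul (by positivity)]
      congr 1
      rw [pow_succ, Real.mul_rpow (by positivity) (by positivity), Real.rpow_sub (by positivity),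
        ← Real.rpow_natCast, ← Real.rpow_natCast, ← Real.rpow_mul (by positivity),
        ← Real.rpow_mul (by positivity), Real.div_rpow (by positivity) (by positivity),
        ← Real.rpow_mul (by positivity), ← Real.rpow_mul (by positivity), mul_neg,
        Real.rpow_neg (by positivity), mul_comm n, mul_comm q]
      ring
    refine (ENNReal.tsum_le_tsum hle).trans_lt ?_
    rw [← ENNReal.ofReal_tsum_of_nonneg (fun k => by positivity)]
    · exact ENNReal.ofReal_lt_top
    · exact (summable_geometric_of_lt_one (by positivity)
        (Real.rpow_lt_one_of_one_lt_of_neg one_lt_two (by linarith))).mul_left _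
  · have hcpt : IsCompact (univ : Set M) := Metric.isCompact_of_isClosed_isBounded isClosed_univ
      (Metric.isBounded_iff_ediam_ne_top.2 hd)
    calc ∫⁻ x, ENNReal.ofReal ((1 + dist x x₀) ^ (-q)) ∂μ ≤ ∫⁻ _, 1 ∂μ :=
          lintegral_mono fun x => ENNReal.ofReal_le_one.2
            (Real.rpow_le_one_of_one_le_of_nonpos
              (by linarith [dist_nonneg (x := x) (y := x₀)]) (by linarith))
      _ < ⊤ := by simpa using hcpt.measure_lt_top

end Ahlfors

/-! ### Approximation by absolutely continuous measures -/

section Smearing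

variable {M : Type*} [MetricSpace M] [MeasurableSpace M] [ProperSpace M] [BorelSpace M] {p : ℝ}

lemma exists_wassersteinSpace_of_ae_edist_le (hp : 1 ≤ p) (ν : WassersteinSpace p M)
    {π : Measure (M × M)} (hπ : π.map Prod.fst = ν.toMeasure) {ε : ℝ≥0∞} (hε : ε ≠ ⊤)
    (h : ∀ᵐ z ∂π, edist z.1 z.2 ≤ ε) :
    ∃ ν' : WassersteinSpace p M, ν'.toMeasure = π.map Prod.snd ∧ wDist p ν ν' ≤ ε := by
  have hp0 : 0 < p := by linarith
  have hprob : IsProbabilityMeasure π :=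
    IsCoupling.isProbabilityMeasure (ν₁ := π.map Prod.snd) ⟨hπ, rfl⟩
  have hprob2 : IsProbabilityMeasure (π.map Prod.snd) :=
    Measure.isProbabilityMeasure_map measurable_snd.aemeasurable
  have hcost : ∫⁻ z, edist z.1 z.2 ^ p ∂π ≤ ε ^ p := by
    refine (lintegral_mono_ae (h.mono fun z hz => ENNReal.rpow_le_rpow hz hp0.le)).trans ?_
    simp
  obtain ⟨x₀, hx₀⟩ := ν.2
  have hm : Measurable fun x : M => edist x x₀ ^ p :=
    (measurable_id.edist measurable_const).pow_const p
  have hmom : ∫⁻ x, edist x x₀ ^ p ∂(π.map Prod.snd) ≠ ⊤ := by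
    have hle : ∀ z : M × M, edist z.2 x₀ ^ p ≤
        2 ^ (p - 1) * (edist z.1 z.2 ^ p + edist z.1 x₀ ^ p) := fun z =>
      (ENNReal.rpow_le_rpow (by rw [edist_comm z.1]; exact edist_triangle z.2 z.1 x₀)
        hp0.le).trans (ENNReal.rpow_add_le_mul_rpow_add_rpow _ _ hp)
    rw [lintegral_map hm measurable_snd]
    refine ne_top_of_le_ne_top ?_ (lintegral_mono hle)
    have hm1 : Measurable fun z : M × M => edist z.1 x₀ ^ p := hm.comp measurable_fst
    have hm2 : Measurable fun z : M × M => edist z.1 z.2 ^ p + edist z.1 x₀ ^ p :=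
      (measurable_edist_rpow p).add hm1
    rw [lintegral_const_mul _ hm2,
      lintegral_add_left (measurable_edist_rpow p),
      IsCoupling.lintegral_fst (ν₁ := π.map Prod.snd) ⟨hπ, rfl⟩ hm]
    refine ENNReal.mul_ne_top (ENNReal.rpow_ne_top_of_nonneg (by linarith) ENNReal.ofNat_ne_top)
      (ENNReal.add_ne_top.2 ⟨ne_top_of_le_ne_top
        (ENNReal.rpow_ne_top_of_nonneg hp0.le hε) hcost, hx₀⟩)
  refine ⟨⟨⟨π.map Prod.snd, hprob2⟩, x₀, hmom⟩, rfl, ?_⟩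
  refine (wDist_le_of_isCoupling hp0 (π := π) ⟨hπ, rfl⟩).trans ?_
  calc transportCost p π ^ (1 / p) ≤ (1 * ε ^ p) ^ (1 / p) := by
        refine ENNReal.rpow_le_rpow (mul_le_mul' ?_ hcost) (by positivity)
        rw [← ENNReal.ofReal_one]
        exact ENNReal.ofReal_le_ofReal ((div_le_one hp0).2 hp)
    _ = ε := by
        rw [one_mul, ← ENNReal.rpow_mul, mul_one_div_cancel hp0.ne', ENNReal.rpow_one]

variable {μ : Measure M} [IsLocallyFiniteMeasure μ] [μ.IsOpenPosMeasure]

/-- Any measure can be spread out over balls of radius `ε`. -/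
lemma exists_smearing (s : Measure M) [IsFiniteMeasure s] {ε : ℝ} (hε : 0 < ε) :
    ∃ π : Measure (M × M), π.map Prod.fst = s ∧ π.map Prod.snd ≪ μ ∧
      ∀ᵐ z ∂π, edist z.1 z.2 ≤ ENNReal.ofReal ε := by
  set D : Set (M × M) := {z | edist z.1 z.2 ≤ ENNReal.ofReal ε} with hD
  have hDm : MeasurableSet D :=
    measurableSet_le (measurable_fst.edist measurable_snd) measurable_const
  have hball : ∀ x, Prod.mk x ⁻¹' D = Metric.closedBall x ε := fun x => by
    ext y
    rw [mem_preimage, hD, mem_ofPred_eq, Metric.mem_closedBall, edist_dist,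
      ENNReal.ofReal_le_ofReal_iff hε.le, dist_comm]
  set v : M → ℝ≥0∞ := fun x => μ (Prod.mk x ⁻¹' D) with hv
  have hvm : Measurable v := measurable_measure_prodMk_left hDm
  have hv0 : ∀ x, v x ≠ 0 := fun x => by
    rw [hv]; simp only; rw [hball]
    exact (Metric.measure_closedBall_pos μ x hε).ne'
  have hvt : ∀ x, v x ≠ ⊤ := fun x => by
    rw [hv]; simp only; rw [hball]
    exact (isCompact_closedBall x ε).measure_ne_top
  -- The density of the normalized restriction of `μ` to the closed ball of radius `ε` around the
  -- first coordinate.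
  set f : M × M → ℝ≥0∞ := D.indicator fun z => (v z.1)⁻¹ with hf
  have hfm : Measurable f := (hvm.comp measurable_fst).inv.indicator hDm
  have hint : ∀ x, ∫⁻ y, f (x, y) ∂μ = 1 := fun x => by
    have e : ∀ y, f (x, y) = (Prod.mk x ⁻¹' D).indicator (fun _ => (v x)⁻¹) y := fun y => by
      rw [hf]; simp only [indicator, mem_preimage]
    simp_rw [e]
    rw [lintegral_indicator_const (measurable_prodMk_left hDm)]
    exact ENNReal.inv_mul_cancel (hv0 x) (hvt x)
  refine ⟨(s.prod μ).withDensity f, ?_, ?_, ?_⟩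
  · ext A hA
    rw [Measure.map_apply measurable_fst hA, withDensity_apply _ (measurable_fst hA),
      ← prod_univ, ← Measure.prod_restrict, lintegral_prod _ hfm.aemeasurable]
    simp [hint]
  · refine Measure.AbsolutelyContinuous.mk fun A hA h0 => ?_
    rw [Measure.map_apply measurable_snd hA]
    refine withDensity_absolutelyContinuous _ _ ?_
    rw [← univ_prod, Measure.prod_prod, h0, mul_zero]
  · rw [ae_withDensity_iff hfm]
    refine .of_forall fun z hz => ?_
    by_contra hn
    exact hz (indicator_of_notMem (show z ∉ D from hn) _)

/-- Only the singular part is smeared; the rest is transported by the diagonal, so the density can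
only grow. -/
lemma exists_absolutelyContinuous_powerIntegral_le (hp : 1 ≤ p) (hp3 : p < 3)
    (ν : WassersteinSpace p M) {ε : ℝ} (hε : 0 < ε) :
    ∃ ν' : WassersteinSpace p M, ν'.toMeasure ≪ μ ∧ wDist p ν ν' ≤ ENNReal.ofReal ε ∧
      powerIntegral p μ ν.toMeasure ≤ powerIntegral p μ ν'.toMeasure := by
  set ρ := ν.toMeasure.rnDeriv μ with hρ
  have hdiag : Measurable fun x : M => (x, x) := measurable_id.prodMk measurable_id
  obtain ⟨π₁, h1, h2, h3⟩ := exists_smearing (μ := μ) (ν.toMeasure.singularPart μ) hε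
  set π₂ : Measure (M × M) := (μ.withDensity ρ).map fun x => (x, x) with hπ₂
  have hfst : π₂.map Prod.fst = μ.withDensity ρ := by
    rw [hπ₂, Measure.map_map measurable_fst hdiag]; exact Measure.map_id
  have hsnd : π₂.map Prod.snd = μ.withDensity ρ := by
    rw [hπ₂, Measure.map_map measurable_snd hdiag]; exact Measure.map_id
  obtain ⟨ν', hν', hd⟩ := exists_wassersteinSpace_of_ae_edist_le hp ν (π := π₁ + π₂)
    (by rw [Measure.map_add _ _ measurable_fst, h1, hfst,
      ν.toMeasure.haveLebesgueDecomposition_add μ |>.symm]) (ENNReal.ofReal_ne_top (r := ε)) (by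
      rw [ae_add_measure_iff]
      refine ⟨h3, ?_⟩
      rw [hπ₂, ae_map_iff hdiag.aemeasurable (measurableSet_le
        (measurable_fst.edist measurable_snd) measurable_const)]
      simp)
  rw [Measure.map_add _ _ measurable_snd, hsnd] at hν'
  refine ⟨ν', ?_, hd, ?_⟩
  · rw [hν']
    exact h2.add_left (withDensity_absolutelyContinuous _ _)
  · have : IsFiniteMeasure (π₁.map Prod.snd) :=
      isFiniteMeasure_of_le ν'.toMeasure (by rw [hν']; exact Measure.le_add_right le_rfl)
    refine lintegral_mono_ae ?_
    filter_upwards [Measure.rnDeriv_add' (π₁.map Prod.snd) (μ.withDensity ρ) μ,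
      Measure.rnDeriv_withDensity μ (Measure.measurable_rnDeriv ν.toMeasure μ)] with x hx hx'
    refine ENNReal.rpow_le_rpow ?_ (by linarith)
    rw [hν', hx, Pi.add_apply, hx']
    exact le_add_self

end Smearing

/-! ### Concavity of the power integral under the curvature condition -/

section LargeExponentConvexity

variable {M : Type*} [MetricSpace M] [MeasurableSpace M] {μ : Measure M} {p : ℝ}

lemma tau_zero (N s θ : ℝ) : tau 0 N s θ = ENNReal.ofReal s := by simp [tau]

variable [SigmaFinite μ]

/-- Only `N' = N` is used, where `1 - 1/N = 3 - p`. For zero curvature the coefficients do not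
depend on the distance, so the coupling enters through its marginals alone. -/
lemma CDCondition.exists_geodesic_powerIntegral {N : ℝ} (h : CDCondition p 0 N μ)
    (hpN : 1 / N = p - 2) (hp3 : p < 3) {ν₀ ν₁ : WassersteinSpace p M}
    (h0 : ν₀.toMeasure ≪ μ) (h1 : ν₁.toMeasure ≪ μ) :
    ∃ γ : ℝ → WassersteinSpace p M, IsGeodesicFromTo (wDist p) γ ν₀ ν₁ ∧
      ∀ t ∈ Icc (0 : ℝ) 1, ENNReal.ofReal (1 - t) * powerIntegral p μ ν₀.toMeasure +
        ENNReal.ofReal t * powerIntegral p μ ν₁.toMeasure ≤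
          powerIntegral p μ (γ t).toMeasure := by
  obtain ⟨γ, hγ, π, hπ, hle⟩ := h ν₀ ν₁ h0 h1
  refine ⟨γ, hγ, fun t ht => ?_⟩
  have e1 : -(1 / N) = 3 - p - 1 := by rw [hpN]; ring
  have e2 : 1 - 1 / N = 3 - p := by rw [hpN]; ring
  have hm : ∀ ν : WassersteinSpace p M,
      Measurable fun x => ν.toMeasure.rnDeriv μ x ^ (3 - p - 1) := fun ν =>
    (Measure.measurable_rnDeriv _ _).pow_const _
  have hm0 : Measurable fun z : M × M => ν₀.toMeasure.rnDeriv μ z.1 ^ (3 - p - 1) :=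
    (hm ν₀).comp measurable_fst
  have hm1 : Measurable fun z : M × M => ν₁.toMeasure.rnDeriv μ z.2 ^ (3 - p - 1) :=
    (hm ν₁).comp measurable_snd
  have hm0' : Measurable fun z : M × M =>
      ENNReal.ofReal (1 - t) * ν₀.toMeasure.rnDeriv μ z.1 ^ (3 - p - 1) := hm0.const_mul _
  have key := hle t ht N le_rfl
  simp only [tau_zero, e1, e2] at key
  rw [lintegral_add_left hm0', lintegral_const_mul _ hm0, lintegral_const_mul _ hm1,
    hπ.1.lintegral_fst (hm ν₀), hπ.1.lintegral_snd (hm ν₁),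
    lintegral_rpow_rnDeriv_sub_one h0 (by linarith),
    lintegral_rpow_rnDeriv_sub_one h1 (by linarith)] at key
  exact key

end LargeExponentConvexity

/-! ### Approximate convexity for `p > 2` -/

section LargeExponentApproxConvex

variable {M : Type*} [MetricSpace M] [MeasurableSpace M] [ProperSpace M] [BorelSpace M]
  {μ : Measure M} {p : ℝ}

instance [Subsingleton M] : Subsingleton (WassersteinSpace p M) := by
  refine ⟨fun ν₀ ν₁ => Subtype.ext (Subtype.ext (Measure.ext fun s _ => ?_))⟩
  change ν₀.toMeasure s = ν₁.toMeasure s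
  rcases s.eq_empty_or_nonempty with rfl | hs
  · simp
  · rw [Subsingleton.eq_univ_of_nonempty hs, measure_univ, measure_univ]

lemma approxConvex_of_subsingleton {X : Type*} [PseudoMetricSpace X] [Subsingleton X]
    (f : X → EReal) : ApproxConvex f := by
  intro x hx y _ t _ ε hε
  refine ⟨x, by simp, ?_⟩
  rw [Subsingleton.elim y x, ← EReal.coe_toReal hx.1 hx.2, EReal.toReal_coe]
  exact EReal.coe_le_coe_iff.2 (by linarith)

variable [IsLocallyFiniteMeasure μ] [μ.IsOpenPosMeasure]

lemma approxConvex_renyiEntropy_of_cdCondition (hp1 : 1 ≤ p) (hp : 2 < p) (hp3 : p < 3)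
    (hfin : ∀ ν : WassersteinSpace p M, powerIntegral p μ ν.toMeasure ≠ ⊤) {N : ℝ}
    (h : CDCondition p 0 N μ) (hpN : 1 / N = p - 2) :
    letI := wassersteinPseudoMetric (M := M) hp1
    ApproxConvex (renyiEntropy (M := M) p μ) := by
  let _ := wassersteinPseudoMetric (M := M) hp1
  intro ν₀ _ ν₁ _ t ht ε hε
  have ht' : t ∈ Icc (0 : ℝ) 1 := Ioo_subset_Icc_self ht
  have hc : 0 ≤ 1 / ((3 - p) * (p - 2)) :=
    one_div_nonneg.2 (mul_nonneg (by linarith) (by linarith))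
  -- End points may be singular. Replacing both within `ε / 3` costs at most `ε / 3 + t * (2 * ε /
  -- 3) ≤ ε` in distance and nothing in energy.
  obtain ⟨ν₀', h0, hd0, hI0⟩ := exists_absolutelyContinuous_powerIntegral_le (μ := μ) hp1 hp3 ν₀
    (show 0 < ε / 3 by positivity)
  obtain ⟨ν₁', h1, hd1, hI1⟩ := exists_absolutelyContinuous_powerIntegral_le (μ := μ) hp1 hp3 ν₁
    (show 0 < ε / 3 by positivity)
  obtain ⟨γ, hγ, hI⟩ := h.exists_geodesic_powerIntegral hpN hp3 h0 h1
  refine ⟨γ t, ?_, ?_⟩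
  · have hd := hγ.2.2 0 ⟨le_rfl, zero_le_one⟩ t ht'
    rw [hγ.1, sub_zero, abs_of_pos ht.1] at hd
    have hd0' : dist ν₀ ν₀' ≤ ε / 3 := (edist_le_ofReal (by positivity)).1 hd0
    have hd1' : dist ν₁ ν₁' ≤ ε / 3 := (edist_le_ofReal (by positivity)).1 hd1
    have hdt : dist ν₀' (γ t) = t * dist ν₀' ν₁' := by
      rw [dist_edist, dist_edist, show edist ν₀' (γ t) = _ from hd, ENNReal.toReal_mul,
        ENNReal.toReal_ofReal ht.1.le]
      rfl
    have h4 : dist ν₀' ν₁' ≤ dist ν₀ ν₀' + dist ν₀ ν₁ + dist ν₁ ν₁' := by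
      rw [dist_comm ν₀ ν₀']
      exact dist_triangle4 _ _ _ _
    have h5 := dist_triangle ν₀ ν₀' (γ t)
    refine (edist_le_ofReal (by have := dist_nonneg (x := ν₀) (y := ν₁); nlinarith [ht.1])).2 ?_
    nlinarith [ht.1, ht.2]
  · have hreal : (1 - t) * (powerIntegral p μ ν₀.toMeasure).toReal +
        t * (powerIntegral p μ ν₁.toMeasure).toReal ≤
        (powerIntegral p μ (γ t).toMeasure).toReal := by
      rw [← ENNReal.toReal_ofReal (show 0 ≤ 1 - t by linarith [ht.2]), ← ENNReal.toReal_mul]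
      nth_rewrite 2 [← ENNReal.toReal_ofReal ht.1.le]
      rw [← ENNReal.toReal_mul, ← ENNReal.toReal_add
        (ENNReal.mul_ne_top ENNReal.ofReal_ne_top (hfin ν₀))
        (ENNReal.mul_ne_top ENNReal.ofReal_ne_top (hfin ν₁))]
      refine ENNReal.toReal_mono (hfin _) (le_trans ?_ (hI t ht'))
      gcongr
    simp_rw [fun ν : WassersteinSpace p M => renyiEntropy_of_two_lt_toReal hp hp3 ν (hfin ν),
      EReal.toReal_coe]
    refine EReal.coe_le_coe_iff.2 ?_
    nlinarith [mul_le_mul_of_nonneg_left hreal hc]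

end LargeExponentApproxConvex

/-- `(3 + √5) / 2` is the larger root of `p² - 3p + 1`, so `p (3 - p) > 1` and `n < N = 1/(p-2) < p
(3-p)/(p-2)`. -/
lemma exponent_estimates {p N n : ℝ} (hp : 2 < p) (hp' : p < (3 + √5) / 2)
    (hpN : p = (2 * N + 1) / N) (hn : 0 < n) (hnN : n < N) :
    p < 3 ∧ 1 / N = p - 2 ∧ n < p * ((3 - p) / (p - 2)) := by
  have h5 : √5 < 3 := (Real.sqrt_lt' (by norm_num)).2 (by norm_num)
  have h5' : √5 ^ 2 = 5 := Real.sq_sqrt (by norm_num)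
  have hN : 0 < N := hn.trans hnN
  have h1 : 1 / N = p - 2 := by rw [hpN]; field_simp; ring
  refine ⟨by linarith, h1, ?_⟩
  have h2 : N * (p - 2) = 1 := by rw [← h1]; field_simp
  have h3 : 1 < p * (3 - p) := by nlinarith [Real.sqrt_nonneg 5]
  rw [← mul_div_assoc, lt_div_iff₀ (by linarith)]
  nlinarith

/-! ### The two curvature regimes -/

section DescendingSlope

variable {M : Type*} [MetricSpace M] [ProperSpace M] [MeasurableSpace M] [BorelSpace M] {p : ℝ}

lemma isLSC_and_isUpperGradient_descendingSlope (hp1 : 1 ≤ p)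
    {f : WassersteinSpace p M → EReal} (hbot : ∀ ν, f ν ≠ ⊥)
    (hf : letI := wassersteinPseudoMetric (M := M) hp1; LowerSemicontinuous f)
    (hc : letI := wassersteinPseudoMetric (M := M) hp1; ApproxConvex f) :
    IsLSC (wDist p) (descendingSlope (wDist p) f) ∧
      IsUpperGradient (wDist p) (descendingSlope (wDist p) f) f := by
  let _ := wassersteinPseudoMetric (M := M) hp1
  exact ⟨isLSC_of_lowerSemicontinuous (lowerSemicontinuous_descendingSlope hf hbot hc),
    isUpperGradient_descendingSlope hf hbot hc⟩

variable {μ : Measure M} [IsLocallyFiniteMeasure μ]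

theorem StrongCDInfty.descendingSlope_renyiEntropy {K : ℝ} (h : StrongCDInfty p K μ) (hK : 0 ≤ K)
    (hp1 : 1 < p) (hp : p < 2) :
    IsLSC (wDist p) (descendingSlope (wDist p) (renyiEntropy (M := M) p μ)) ∧
      IsUpperGradient (wDist p) (descendingSlope (wDist p) (renyiEntropy (M := M) p μ))
        (renyiEntropy p μ) :=
  isLSC_and_isUpperGradient_descendingSlope hp1.le (renyiEntropy_ne_bot_of_lt_two hp)
    (lowerSemicontinuous_renyiEntropy_of_lt_two hp1.le hp1 hp)
    (approxConvex_renyiEntropy_of_strongCDInfty hp1.le hp1 hp hK h)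

theorem CDCondition.descendingSlope_renyiEntropy {N n : ℝ} (hCD : CDCondition p 0 N μ)
    (hA : AhlforsRegular n μ) (hn : 0 < n) (hp : 2 < p) (hp3 : p < 3) (hN : 1 / N = p - 2)
    (hq : n < p * ((3 - p) / (p - 2))) :
    IsLSC (wDist p) (descendingSlope (wDist p) (renyiEntropy (M := M) p μ)) ∧
      IsUpperGradient (wDist p) (descendingSlope (wDist p) (renyiEntropy (M := M) p μ))
        (renyiEntropy p μ) := by
  have hp1 : 1 ≤ p := by linarith
  have hw : ∀ x₀ : M, Integrable (fun x => momentWeight p x₀ x ^ (-((3 - p) / (p - 2)))) μ := by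
    intro x₀
    refine (hA.integrable_one_add_dist_rpow (hn.trans hq) hq x₀).congr (.of_forall fun x => ?_)
    simp only [momentWeight]
    rw [← Real.rpow_mul (by positivity), mul_neg]
  have hfin : ∀ ν : WassersteinSpace p M, powerIntegral p μ ν.toMeasure ≠ ⊤ := fun ν =>
    powerIntegral_ne_top hp hp3 (hw ν.2.choose) ν
  refine isLSC_and_isUpperGradient_descendingSlope hp1 (fun ν => ?_) ?_ ?_
  · rw [renyiEntropy_of_two_lt_toReal hp hp3 ν (hfin ν)]
    exact EReal.coe_ne_bot _
  · let _ := wassersteinPseudoMetric (M := M) hp1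
    intro ν
    exact lowerSemicontinuous_renyiEntropy_of_two_lt hp1 hp hp3 (hw ν.2.choose) ν
  · let _ := wassersteinPseudoMetric (M := M) hp1
    -- On a single point regularity does not give positive measure of open sets, but convexity is
    -- trivial.
    rcases subsingleton_or_nontrivial M with _ | _
    · exact approxConvex_of_subsingleton _
    · have := hA.isOpenPosMeasure
      exact approxConvex_renyiEntropy_of_cdCondition hp1 hp hp3 hfin hCD hN

end DescendingSlope

end RenyiFlow

theorem mainTheorem12 {M : Type*} [MetricSpace M] [ProperSpace M] [MeasurableSpace M]
    [BorelSpace M] (hM : RenyiFlow.IsGeodesicSpace M)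
    (μ : MeasureTheory.Measure M) [MeasureTheory.IsLocallyFiniteMeasure μ] (p : ℝ)
    (h : (1 < p ∧ p < 2 ∧ ∃ K : ℝ, 0 ≤ K ∧ RenyiFlow.StrongCDInfty p K μ) ∨
      (2 < p ∧ p < (3 + √5) / 2 ∧ ∃ N : ℝ, p = (2 * N + 1) / N ∧
        RenyiFlow.CDCondition p 0 N μ ∧
        ∃ n : ℝ, 0 < n ∧ n < N ∧ RenyiFlow.AhlforsRegular n μ)) :
    RenyiFlow.IsLSC (RenyiFlow.wDist p)
        (RenyiFlow.descendingSlope (RenyiFlow.wDist p) (RenyiFlow.renyiEntropy p μ)) ∧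
      RenyiFlow.IsUpperGradient (RenyiFlow.wDist p)
        (RenyiFlow.descendingSlope (RenyiFlow.wDist p) (RenyiFlow.renyiEntropy p μ))
        (RenyiFlow.renyiEntropy p μ) := by
  rcases h with ⟨hp1, hp, K, hK, h⟩ | ⟨hp, hp', N, hpN, hCD, n, hn, hnN, hA⟩
  · exact h.descendingSlope_renyiEntropy hK hp1 hp
  · obtain ⟨hp3, hN, hq⟩ := RenyiFlow.exponent_estimates hp hp' hpN hn hnN
    exact hCD.descendingSlope_renyiEntropy hA hn hp hp3 hN hq
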